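/- **Notions.** Let $\Sigma$ be a finite totally ordered alphabet. A *tree* is a finite unordered $\Sigma$-labelled rooted tree $t=(N_t,\mathrm{root}_t,\mathrm{lab}_t,\mathrm{child}_t)$ (the relation $\mathrm{child}_t$ is acyclic and every non-root node has exactly one predecessor). An *unordered word* is a function $w:\Sigma\to\mathbb N$; concatenation $\uplus$ is pointwise addition. *Multiplicities* are $*,+,?,1,0$, with $[\![*]\!]=\mathbb N$, $[\![+]\!]=\{1,2,\dots\}$, $[\![?]\!]=\{0,1\}$, $[\![1]\!]=\{1\}$, $[\![0]\!]=\{0\}$. A *disjunctive multiplicity expression* is $E=D_1^{M_1}\|\cdots\|D_n^{M_n}$ (denoting the empty word if $n=0$) with $D_i=a_1^{M'_1}\mid\cdots\mid a_k^{M'_k}$, $k\ge 1$, where $M_i,M'_j$ are multiplicities and every symbol of $\Sigma$ occurs at most once in $E$. Its language is given by $L(a^M)=\{a^i: i\in[\![M]\!]\}$, $L(a_1^{M'_1}\mid\cdots\mid a_k^{M'_k})=\bigcup_j L(a_j^{M'_j})$, $L(D^M)=\{w_1\uplus\cdots\uplus w_i : i\in[\![M]\!],\ w_1,\dots,w_i\in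 L(D)\}$, and $L(E)=L(D_1^{M_1})\uplus\cdots\uplus L(D_n^{M_n})$. A *disjunctive multiplicity schema* (DMS) is a pair $S=(\mathrm{root}_S,R_S)$ of a root label $\mathrm{root}_S\in\Sigma$ and a map $R_S$ from $\Sigma$ to disjunctive multiplicity expressions. $L(S)$ is the set of trees $t$ whose root is labelled $\mathrm{root}_S$ and such that for every node $n$ the unordered word of the labels of the children of $n$ lies in $L(R_S(\mathrm{lab}_t(n)))$. The size of $S$ is $1+\sum_{a\in\Sigma}(1+|R_S(a)|)$, where $|E|$ is the number of disjunctions plus the number of symbol occurrences of $E$. A *sample* is a finite nonempty set $D$ of trees; it is *consistent* with $S$ if $D\subseteq L(S)$. **Theorem.** Disjunctive multiplicity schemas are learnable in polynomial time and data from positive examples, i.e. in the setting $(\mathit{Tree},\mathit{DMS},L)$, by a learner that returns minimal schemas. That is, there is an algorithm $\mathit{learner}$, the same for all alphabets $\Sigma$, mapping each sample to a DMS or to a special value $\mathit{null}$, such that: 1. (Polynomial time) its running time is bounded by a polynomial in the size of the input, namely $|\Sigma|$ plus the total number of nodes of the given trees. 2. (Soundness) For every sample $D$, $\mathit{learner}(D)$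 is a DMS consistent with $D$, or $\mathit{null}$ if no DMS is consistent with $D$. 3. (Completeness) There is a polynomial $q$, independent of $\Sigma$, such that every DMS $S$ over $\Sigma$ has a characteristic sample of cardinality at most $q(\mathrm{size}(S))$. Here a *characteristic sample* for $S$ is a sample $CS$, contained in $L(S)$ whenever $L(S)\neq\emptyset$, such that for every $D$ with $CS\subseteq D\subseteq L(S)$, $\mathit{learner}(D)$ is a DMS with language $L(S)$. Likewise there is a polynomial $q'$, independent of $\Sigma$, such that every DMS $S$ over $\Sigma$ has a characteristic sample of cardinality at most $q'(|\Sigma|)$. 4. (Minimality) For every sample $D$, if $\mathit{learner}(D)=S$ is a DMS, then $S$ is a minimal DMS consistent with $D$: $D\subseteq L(S)$ and there is no DMS $S'$ with $D\subseteq L(S')\subsetneq L(S)$. -/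

import Mathlib

namespace UnorderedXML

/-! # Unordered words, multiplicities, expressions -/

/-- Unordered words: `w a` is the number of occurrences of `a`. Unordered concatenation is
pointwise addition and the empty word is `0`. -/
abbrev Word (α : Type) : Type := α → ℕ

/-- The multiplicities `*`, `+`, `?`, `1`, `0`. -/
inductive Mult where
  | star
  | plus
  | opt
  | one
  | zero
  deriving DecidableEq

/-- The set of natural numbers denoted by a multiplicity. -/
def Mult.sem : Mult → Set ℕ
  | .star => Set.univ
  | .plus => {i | 1 ≤ i}
  | .opt => {0, 1}
  | .one => {1}
  | .zero => {0}

/-- A disjunctive multiplicity expression `D₁^M₁ ‖ … ‖ Dₙ^Mₙ`, each `Dᵢ` being a nonempty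
disjunction `a₁^M₁' | … | aₖ^Mₖ'`, with every symbol occurring at most once in the whole
expression. The expression with `n = 0` denotes `ε`. -/
structure DME (α : Type) where
  /-- the list of the pairs `(Dᵢ, Mᵢ)` -/
  blocks : List (List (α × Mult) × Mult)
  nonempty : ∀ b ∈ blocks, b.1 ≠ []
  nodup : ((blocks.flatMap Prod.fst).map Prod.fst).Nodup

section Languages

variable {α : Type} [DecidableEq α]

/-- `L(a^M)`, the words consisting of `i` occurrences of `a`, for `i ∈ ⟦M⟧`. -/
def atomLang (p : α × Mult) : Set (Word α) :=
  {w | ∃ i ∈ p.2.sem, w = Pi.single p.1 i}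

/-- `L(a₁^M₁ | … | aₖ^Mₖ)`. -/
def disjLang (d : List (α × Mult)) : Set (Word α) :=
  {w | ∃ p ∈ d, w ∈ atomLang p}

/-- `L(D^M)`: concatenations of `i` words of `L(D)`, for `i ∈ ⟦M⟧`. -/
def blockLang (b : List (α × Mult) × Mult) : Set (Word α) :=
  {w | ∃ ws : List (Word α), ws.length ∈ b.2.sem ∧ (∀ v ∈ ws, v ∈ disjLang b.1) ∧ w = ws.sum}

/-- `L(D₁^M₁ ‖ … ‖ Dₙ^Mₙ)`. -/
def concatLang : List (List (α × Mult) × Mult) → Set (Word α)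
  | [] => {0}
  | b :: bs => {w | ∃ u ∈ blockLang b, ∃ v ∈ concatLang bs, w = u + v}

/-- The language of a disjunctive multiplicity expression. -/
def DME.lang (E : DME α) : Set (Word α) := concatLang E.blocks

end Languages

/-- The size of an expression: one for each disjunction and one for each symbol occurrence. -/
def DME.size {α : Type} (E : DME α) : ℕ := (E.blocks.map fun b => 1 + b.1.length).sum

/-- Disjunctive multiplicity schemas: a root label and a rule for every symbol. -/
structure DMS (α : Type) where
  root : α
  rule : α → DME α

/-- The size of a schema: its root label together with all its rules `a → R(a)`. -/
def DMS.size {α : Type} [Fintype α] (S : DMS α) : ℕ := 1 + ∑ a, (1 + (S.rule a).size)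

/-! # Trees -/

/-- Finite unordered labelled trees, with nodes numbered `0, …, n - 1`: the parent-child relation
is acyclic and every node other than the root has exactly one predecessor. -/
structure XTree (α : Type) where
  n : ℕ
  root : Fin n
  lab : Fin n → α
  child : Fin n → Fin n → Bool
  acyclic : ∀ m, ¬ Relation.TransGen (fun x y => child x y = true) m m
  parent : ∀ m, m ≠ root → ∃! p, child p m = true

section Trees

variable {α : Type} [DecidableEq α]

/-- The unordered word of the labels of the children of the node `m`. -/
def XTree.childWord (t : XTree α) (m : Fin t.n) : Word α := fun a =>
  (Finset.univ.filter fun m' : Fin t.n => t.child m m' = true ∧ t.lab m' = a).card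

/-- A tree satisfies a schema. -/
def XTree.Satisfies (t : XTree α) (S : DMS α) : Prop :=
  t.lab t.root = S.root ∧ ∀ m : Fin t.n, t.childWord m ∈ (S.rule (t.lab m)).lang

/-- The set of all trees satisfying the schema. -/
def DMS.lang (S : DMS α) : Set (XTree α) := {t | t.Satisfies S}

end Trees

/-! # Programs with a step count

Programs are those of a small `while` language computing on binary trees. Every elementary
operation is charged the size of the data that it reads, so the cost of a run also bounds the size
of the data that it writes. -/

/-- The data on which programs compute. -/
inductive Data where
  | nil
  | cons (a b : Data)
  deriving DecidableEq

namespace Data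

/-- The number of cells of a piece of data. -/
def size : Data → ℕ
  | nil => 1
  | cons a b => 1 + a.size + b.size

/-- First component. -/
def hd : Data → Data
  | nil => nil
  | cons a _ => a

/-- Second component. -/
def tl : Data → Data
  | nil => nil
  | cons _ b => b

/-- Unary numerals. -/
def ofNat : ℕ → Data
  | 0 => nil
  | k + 1 => cons nil (ofNat k)

/-- Lists. -/
def ofList : List Data → Data
  | [] => nil
  | a :: l => cons a (ofList l)

/-- Optional values. -/
def ofOption : Option Data → Data
  | none => nil
  | some a => cons nil a

theorem ofNat_injective : Function.Injective ofNat := by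
  intro i
  induction i with
  | zero => intro j h; cases j <;> simp_all [ofNat]
  | succ i ih =>
    intro j h
    cases j with
    | zero => simp [ofNat] at h
    | succ j => simp only [ofNat, cons.injEq, true_and] at h; rw [ih h]

theorem ofList_injective : Function.Injective ofList := by
  intro l
  induction l with
  | nil => intro l' h; cases l' <;> simp_all [ofList]
  | cons a l ih =>
    intro l' h
    cases l' with
    | nil => simp [ofList] at h
    | cons b l' => simp only [ofList, cons.injEq] at h; rw [h.1, ih h.2]

end Data

/-- Programs. Each one transforms an input into an output. -/
inductive Prog where
  /-- return the input -/
  | ident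
  /-- return `nil` -/
  | empty
  /-- first component of the input -/
  | hd
  /-- second component of the input -/
  | tl
  /-- are the two components of the input equal? -/
  | eqTest
  /-- pair the outputs of two programs run on the same input -/
  | pair (p q : Prog)
  /-- run `p`, then run `q` on the output of `p` -/
  | seq (p q : Prog)
  /-- run `p` if the output of `c` is not `nil`, and `q` otherwise -/
  | ite (c p q : Prog)
  /-- while the output of `c` is not `nil`, replace the current value by the output of `b` -/
  | loop (c b : Prog)

/-- `Runs p x y t`: on input `x` the program `p` halts with output `y` at cost `t`. -/
inductive Runs : Prog → Data → Data → ℕ → Prop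
  | ident (x : Data) : Runs .ident x x x.size
  | empty (x : Data) : Runs .empty x .nil x.size
  | hd (x : Data) : Runs .hd x x.hd x.size
  | tl (x : Data) : Runs .tl x x.tl x.size
  | eqTest (x : Data) :
      Runs .eqTest x (if x.hd = x.tl then .cons .nil .nil else .nil) (2 + x.size)
  | pair {p q : Prog} {x y z : Data} {s t : ℕ} :
      Runs p x y s → Runs q x z t → Runs (.pair p q) x (.cons y z) (1 + s + t)
  | seq {p q : Prog} {x y z : Data} {s t : ℕ} :
      Runs p x y s → Runs q y z t → Runs (.seq p q) x z (1 + s + t)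
  | ite_true {c p q : Prog} {x y z : Data} {s t : ℕ} :
      Runs c x y s → y ≠ .nil → Runs p x z t → Runs (.ite c p q) x z (1 + s + t)
  | ite_false {c p q : Prog} {x z : Data} {s t : ℕ} :
      Runs c x .nil s → Runs q x z t → Runs (.ite c p q) x z (1 + s + t)
  | loop_stop {c b : Prog} {x : Data} {s : ℕ} :
      Runs c x .nil s → Runs (.loop c b) x x (1 + s)
  | loop_step {c b : Prog} {x y x' z : Data} {s t u : ℕ} :
      Runs c x y s → y ≠ .nil → Runs b x x' t → Runs (.loop c b) x' z u →
        Runs (.loop c b) x z (1 + s + t + u)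

/-! # Learning settings -/

/-- A learning setting: examples, concepts, and the set of examples of each concept. -/
structure LearningSetting where
  Example : Type
  Concept : Type
  lang : Concept → Set Example

/-- A learning setting whose examples and concepts are presented to programs, with their sizes. -/
structure CodedSetting extends LearningSetting where
  exampleCode : Example → Data
  exampleCode_injective : Function.Injective exampleCode
  exampleSize : Example → ℕ
  conceptCode : Concept → Data
  conceptCode_injective : Function.Injective conceptCode
  conceptSize : Concept → ℕ

/-- A learner maps samples to a concept, or to the null value `none`. Only its values on nonempty
sets matter. -/
abbrev Learner (K : LearningSetting) : Type := Finset K.Example → Option K.Concept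

section Learning

variable {K : LearningSetting}

/-- A sample is a nonempty finite set of examples. -/
def IsSample (D : Finset K.Example) : Prop := D.Nonempty

/-- The sample `D` is consistent with the concept `c`. -/
def Consistent (D : Finset K.Example) (c : K.Concept) : Prop := ∀ e ∈ D, e ∈ K.lang c

/-- Soundness: on every sample the learner returns a consistent concept, or null if there is no
consistent concept. -/
def Sound (learner : Learner K) : Prop :=
  ∀ D : Finset K.Example, IsSample D →
    (∀ c, learner D = some c → Consistent D c) ∧
    (learner D = none → ¬ ∃ c, Consistent D c)

/-- `CS` is a characteristic sample for `c`: it consists of examples of `c` (if `c` has examples at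
all) and on every sample extending it consistently with `c`, the learner returns a concept
equivalent to `c`. -/
def IsCharacteristicSample (learner : Learner K) (c : K.Concept) (CS : Finset K.Example) : Prop :=
  IsSample CS ∧ ((K.lang c).Nonempty → Consistent CS c) ∧
    ∀ D : Finset K.Example, CS ⊆ D → Consistent D c →
      ∃ c', learner D = some c' ∧ K.lang c' = K.lang c

/-- `c` is a minimal concept consistent with `D`, for inclusion of languages. -/
def IsMinimalConsistent (D : Finset K.Example) (c : K.Concept) : Prop :=
  Consistent D c ∧ ∀ c', Consistent D c' → ¬ K.lang c' ⊂ K.lang c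

end Learning

section PolynomialLearning

variable (K : ℕ → CodedSetting) (learner : ∀ k, Learner (K k).toLearningSetting)

/-- One program computes the learners for all alphabet sizes `k`, in time polynomial in the size of
the input. The input is `k` and a list (in any order, repetitions allowed) of the examples of the
sample. Its size is `k` plus the sum of the sizes of the listed examples. -/
def PolynomialTime : Prop :=
  ∃ (P : Prog) (q : Polynomial ℕ), ∀ (k : ℕ) (D : Finset (K k).Example) (l : List (K k).Example),
    IsSample (K := (K k).toLearningSetting) D → (∀ e, e ∈ l ↔ e ∈ D) →
      ∃ t : ℕ,
        Runs P (.cons (.ofNat k) (.ofList (l.map (K k).exampleCode)))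
          (.ofOption ((learner k D).map (K k).conceptCode)) t ∧
        t ≤ q.eval (k + (l.map (K k).exampleSize).sum)

/-- Completeness, with characteristic samples of cardinality polynomial in the size of the
concept. -/
def Complete : Prop :=
  ∃ q : Polynomial ℕ, ∀ (k : ℕ) (c : (K k).Concept), ∃ CS : Finset (K k).Example,
    IsCharacteristicSample (learner k) c CS ∧ CS.card ≤ q.eval ((K k).conceptSize c)

/-- The learner witnesses learnability in polynomial time and data of the given concept classes,
uniformly in the alphabet size. -/
def LearnsInPolynomialTimeAndData : Prop :=
  PolynomialTime K learner ∧ (∀ k, Sound (learner k)) ∧ Complete K learner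

end PolynomialLearning

/-! # The setting of trees and disjunctive multiplicity schemas over an alphabet with `k` symbols -/

/-- Code of a multiplicity. -/
def Mult.code : Mult → Data
  | .star => .ofNat 0
  | .plus => .ofNat 1
  | .opt => .ofNat 2
  | .one => .ofNat 3
  | .zero => .ofNat 4

theorem Mult.code_injective : Function.Injective Mult.code := by
  intro a b h
  cases a <;> cases b <;> first | rfl | (simp [Mult.code, Data.ofNat] at h)

/-- Code of an expression: the list of the codes of its disjunctions with their multiplicities. -/
def DME.code {k : ℕ} (E : DME (Fin k)) : Data :=
  .ofList (E.blocks.map fun b =>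
    .cons (.ofList (b.1.map fun p => .cons (.ofNat p.1) p.2.code)) b.2.code)

theorem DME.code_injective {k : ℕ} : Function.Injective (DME.code (k := k)) := by
  rintro ⟨E, h1, h2⟩ ⟨E', h1', h2'⟩ h
  have hinj : Function.Injective (fun b : List (Fin k × Mult) × Mult =>
      Data.cons (.ofList (b.1.map fun p => .cons (.ofNat p.1) p.2.code)) b.2.code) := by
    rintro ⟨d, m⟩ ⟨d', m'⟩ hb
    simp only [Data.cons.injEq] at hb
    have hd : d = d' := by
      refine List.map_injective_iff.2 ?_ (Data.ofList_injective hb.1)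
      rintro ⟨a, n⟩ ⟨a', n'⟩ hp
      simp only [Data.cons.injEq] at hp
      rw [Fin.ext (Data.ofNat_injective hp.1), Mult.code_injective hp.2]
    rw [hd, Mult.code_injective hb.2]
  have hE : E = E' := List.map_injective_iff.2 hinj (Data.ofList_injective h)
  subst hE
  rfl

/-- Code of a schema: its root label and the list of its rules, in the order of the alphabet. -/
def DMS.code {k : ℕ} (S : DMS (Fin k)) : Data :=
  .cons (.ofNat S.root) (.ofList ((List.finRange k).map fun a => (S.rule a).code))

theorem DMS.code_injective {k : ℕ} : Function.Injective (DMS.code (k := k)) := by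
  rintro ⟨r, R⟩ ⟨r', R'⟩ h
  simp only [DMS.code, Data.cons.injEq] at h
  have hR : R = R' := by
    funext a
    exact DME.code_injective
      (List.map_inj_left.1 (Data.ofList_injective h.2) a (List.mem_finRange a))
  rw [Fin.ext (Data.ofNat_injective h.1), hR]

/-- Code of a tree: its root, the list of its nodes with their labels, and the list of the pairs of
its parent-child relation. -/
def XTree.code {k : ℕ} (t : XTree (Fin k)) : Data :=
  .cons (.ofNat t.root)
    (.cons (.ofList ((List.finRange t.n).map fun m : Fin t.n => .cons (.ofNat m) (.ofNat (t.lab m))))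
      (.ofList (((List.finRange t.n ×ˢ List.finRange t.n).filter
        fun e => t.child e.1 e.2).map fun e : Fin t.n × Fin t.n => .cons (.ofNat e.1) (.ofNat e.2))))

theorem XTree.code_injective {k : ℕ} : Function.Injective (XTree.code (k := k)) := by
  rintro ⟨n, r, lab, ch, h1, h2⟩ ⟨n', r', lab', ch', h1', h2'⟩ h
  simp only [XTree.code, Data.cons.injEq] at h
  obtain ⟨hr, hlab, hch⟩ := h
  have hlab := Data.ofList_injective hlab
  have hn : n = n' := by simpa using congrArg List.length hlab
  subst hn
  have hr : r = r' := Fin.ext (Data.ofNat_injective hr)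
  have hl : lab = lab' := by
    funext a
    have := List.map_inj_left.1 hlab a (List.mem_finRange a)
    simp only [Data.cons.injEq, true_and] at this
    exact Fin.ext (Data.ofNat_injective this)
  have hinj : Function.Injective (fun e : Fin n × Fin n =>
      Data.cons (.ofNat e.1) (.ofNat e.2)) := by
    rintro ⟨a, b⟩ ⟨a', b'⟩ he
    simp only [Data.cons.injEq] at he
    rw [Fin.ext (Data.ofNat_injective he.1), Fin.ext (Data.ofNat_injective he.2)]
  have hch := List.map_injective_iff.2 hinj (Data.ofList_injective hch)
  have hc : ch = ch' := by
    funext a b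
    have key : (a, b) ∈ (List.finRange n ×ˢ List.finRange n).filter (fun e => ch e.1 e.2) ↔
        (a, b) ∈ (List.finRange n ×ˢ List.finRange n).filter (fun e => ch' e.1 e.2) := by
      rw [hch]
    simp only [List.mem_filter, List.mem_product, List.mem_finRange, true_and] at key
    exact Bool.eq_iff_iff.2 key
  subst hr hl hc
  rfl

/-- The setting `(Tree, DMS, L)` over the alphabet `Fin k`. The size of a tree is its number of
nodes. -/
def dmsSetting (k : ℕ) : CodedSetting where
  Example := XTree (Fin k)
  Concept := DMS (Fin k)
  lang := DMS.lang
  exampleCode := XTree.code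
  exampleCode_injective := XTree.code_injective
  exampleSize := XTree.n
  conceptCode := DMS.code
  conceptCode_injective := DMS.code_injective
  conceptSize := DMS.size

end UnorderedXML

namespace UnorderedXML

/-! # Polynomial bounds -/

/-! Whether a word belongs to the language of an expression depends only on which symbols occur in
it and which occur at least twice. Every such language has a `NormalForm`: live symbols, repeatable
symbols, and disjoint blocks, some exclusive (at most one symbol occurs) and some required (at least
one occurs). A non-exclusive block can repeat all its live symbols.

The learner looks at a set `W` of words through three kinds of questions: does a symbol occur twice
in some word, do two symbols occur together, does some word avoid a given list. First-fit splits the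
occurring symbols into classes of symbols that never occur together. A class becomes an exclusive
block, required exactly when no word avoids it. The exceptions are one-symbol classes whose symbol
is both repeatable and avoidable. From these the learner greedily extracts disjoint minimal sets
that every word meets, which become blocks `(a | b | …)^+`; each symbol left over becomes `a^*`.

The heart is `learn_subset`. Suppose `W ⊆ N ⊆ learned` for a normal form `N`. By
`NormalForm.exists_mem`, `N` contains every word that its constraints do not rule out. Hence two
symbols of one class share an exclusive block of `N`, and maximality of first-fit puts the occurring
symbols of an exclusive block into one class. A required non-exclusive block of `N` either has a
symbol that is required by itself or contains one of the extracted sets. So the constraints of `N`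
follow from the learned ones. With `W` the whole language, this shows that the language itself is
learned (`learn_lang`).

One run asks polynomially many questions. A witness for each positive answer gives a small set of
words on which, and on whose extensions inside the language, the run is the same
(`exists_characteristic`).

For schemas, the rule of `a` is learned from the words below nodes labelled `a`, and null is
returned only if root labels disagree. Grafting (`XTree.exists_mem_obs`) places any allowed word
over realizable symbols below any realizable label. This turns inclusions of tree languages into
inclusions of rules restricted to such symbols, and words of small samples into trees.

For the running time, `Poly` is closed under composition, pairing, branching and list recursion with
polynomially bounded values, and the learner is assembled from these. -/

theorem eval_mono (q : Polynomial ℕ) {a b : ℕ} (h : a ≤ b) : q.eval a ≤ q.eval b := by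
  rw [Polynomial.eval_eq_sum_range, Polynomial.eval_eq_sum_range]
  gcongr

/-- `s` is bounded by a polynomial in `m`. -/
def PolyBdd {X : Type} (m s : X → ℕ) : Prop := ∃ q : Polynomial ℕ, ∀ x, s x ≤ q.eval (m x)

namespace PolyBdd

variable {X : Type} {m s s' : X → ℕ}

theorem refl (m : X → ℕ) : PolyBdd m m := ⟨Polynomial.X, fun x => by simp⟩

theorem mono (h : PolyBdd m s) (h' : ∀ x, s' x ≤ s x) : PolyBdd m s' := by
  obtain ⟨q, hq⟩ := h
  exact ⟨q, fun x => (h' x).trans (hq x)⟩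

end PolyBdd

/-! # Programs running in polynomial time -/

theorem Data.size_pos (x : Data) : 0 < x.size := by cases x <;> simp only [Data.size] <;> omega

theorem Data.size_hd_le (x : Data) : x.hd.size ≤ x.size := by
  cases x <;> simp [Data.size, Data.hd]; omega

theorem Data.size_tl_le (x : Data) : x.tl.size ≤ x.size := by
  cases x <;> simp [Data.size, Data.tl]

/-- This makes polynomial time compose: the input of a second program is no larger than the cost of
the first. -/
theorem Runs.size_le {p : Prog} {x y : Data} {t : ℕ} (h : Runs p x y t) :
    x.size ≤ t ∧ y.size ≤ t := by
  induction h with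
  | ident x => simp
  | empty x => exact ⟨le_rfl, x.size_pos⟩
  | hd x => exact ⟨le_rfl, x.size_hd_le⟩
  | tl x => exact ⟨le_rfl, x.size_tl_le⟩
  | eqTest x => refine ⟨by omega, ?_⟩; have := x.size_pos; split_ifs <;> simp only [Data.size] <;> omega
  | pair _ _ h1 h2 => simp only [Data.size]; omega
  | seq _ _ h1 h2 => omega
  | ite_true _ _ _ h1 h2 => omega
  | ite_false _ _ h1 h2 => omega
  | loop_stop _ h1 => omega
  | loop_step _ _ _ _ h1 h2 h3 => omega

/-- From `e x`, one program computes `f x` in time polynomial in the size of `e x`. -/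
def Poly {X : Type} (e f : X → Data) : Prop :=
  ∃ (P : Prog) (q : Polynomial ℕ), ∀ x, ∃ t, Runs P (e x) (f x) t ∧ t ≤ q.eval (e x).size

/-- Code of a truth value. -/
def Data.ofBool : Bool → Data
  | true => .cons .nil .nil
  | false => .nil

namespace Poly

variable {X : Type} {e f g : X → Data}

theorem bdd (h : Poly e f) : PolyBdd (fun x => (e x).size) fun x => (f x).size := by
  obtain ⟨P, q, h⟩ := h
  refine ⟨q, fun x => ?_⟩
  obtain ⟨t, ht, htq⟩ := h x
  exact ht.size_le.2.trans htq

theorem id (e : X → Data) : Poly e e :=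
  ⟨.ident, .X, fun x => ⟨_, .ident _, by simp⟩⟩

theorem nil (e : X → Data) : Poly e fun _ => .nil :=
  ⟨.empty, .X, fun x => ⟨_, .empty _, by simp⟩⟩

theorem trans (h : Poly e f) (h' : Poly f g) : Poly e g := by
  obtain ⟨P, q, h⟩ := h
  obtain ⟨P', q', h'⟩ := h'
  refine ⟨.seq P P', 1 + q + q'.comp q, fun x => ?_⟩
  obtain ⟨t, ht, htq⟩ := h x
  obtain ⟨t', ht', htq'⟩ := h' x
  refine ⟨_, .seq ht ht', ?_⟩
  have := htq'.trans (eval_mono q' (ht.size_le.2.trans htq))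
  simp only [Polynomial.eval_add, Polynomial.eval_one, Polynomial.eval_comp]
  omega

theorem reindex {Y : Type} (h : Poly e f) (φ : Y → X) :
    Poly (fun y => e (φ y)) fun y => f (φ y) := by
  obtain ⟨P, q, h⟩ := h
  exact ⟨P, q, fun y => h _⟩

theorem hd (h : Poly e f) : Poly e fun x => (f x).hd :=
  h.trans ⟨.hd, .X, fun x => ⟨_, .hd _, by simp⟩⟩

theorem tl (h : Poly e f) : Poly e fun x => (f x).tl :=
  h.trans ⟨.tl, .X, fun x => ⟨_, .tl _, by simp⟩⟩

theorem cons (h : Poly e f) (h' : Poly e g) : Poly e fun x => .cons (f x) (g x) := by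
  obtain ⟨P, q, h⟩ := h
  obtain ⟨P', q', h'⟩ := h'
  refine ⟨.pair P P', 1 + q + q', fun x => ?_⟩
  obtain ⟨t, ht, htq⟩ := h x
  obtain ⟨t', ht', htq'⟩ := h' x
  refine ⟨_, .pair ht ht', ?_⟩
  simp only [Polynomial.eval_add, Polynomial.eval_one]
  omega

theorem fst {f g : X → Data} (h : Poly e fun x => .cons (f x) (g x)) : Poly e f := h.hd

theorem snd {f g : X → Data} (h : Poly e fun x => .cons (f x) (g x)) : Poly e g := h.tl

theorem const (e : X → Data) (d : Data) : Poly e fun _ => d := by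
  induction d with
  | nil => exact nil e
  | cons a b iha ihb => exact iha.cons ihb

theorem cond {c : X → Bool} (hc : Poly e fun x => .ofBool (c x)) (h : Poly e f) (h' : Poly e g) :
    Poly e fun x => bif c x then f x else g x := by
  obtain ⟨C, r, hc⟩ := hc
  obtain ⟨P, q, h⟩ := h
  obtain ⟨P', q', h'⟩ := h'
  refine ⟨.ite C P P', 1 + r + (q + q'), fun x => ?_⟩
  obtain ⟨s, hs, hsr⟩ := hc x
  dsimp only at hs
  obtain ⟨t, ht, htq⟩ := h x
  obtain ⟨t', ht', htq'⟩ := h' x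
  simp only [Polynomial.eval_add, Polynomial.eval_one]
  cases hx : c x <;> rw [hx] at hs
  · exact ⟨_, .ite_false hs ht', by omega⟩
  · exact ⟨_, .ite_true hs (by simp [Data.ofBool]) ht, by omega⟩

theorem beq (h : Poly e f) (h' : Poly e g) :
    Poly e fun x => .ofBool (decide (f x = g x)) := by
  refine (h.cons h').trans ⟨.eqTest, 2 + .X, fun x => ⟨_, ?_, le_rfl⟩⟩
  have := Runs.eqTest (.cons (f x) (g x))
  simp only [Data.hd, Data.tl] at this
  by_cases hx : f x = g x <;> simpa [hx, Data.ofBool] using this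

theorem congr (h : Poly e f) (h' : ∀ x, f x = g x) : Poly e g := by
  rwa [← funext h']

theorem and {c d : X → Bool} (hc : Poly e fun x => .ofBool (c x))
    (hd : Poly e fun x => .ofBool (d x)) : Poly e fun x => .ofBool (c x && d x) :=
  (hc.cond hd (nil e)).congr fun x => by cases c x <;> rfl

theorem not {c : X → Bool} (hc : Poly e fun x => .ofBool (c x)) :
    Poly e fun x => .ofBool (!c x) :=
  (hc.cond (nil e) (const e (.ofBool true))).congr fun x => by cases c x <;> rfl

/-! ## Iteration -/

/-- A round costs 1 plus the test plus the body, hence at most `1 + 2 * T`; the last, failing test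
is charged as one more round. -/
theorem _root_.UnorderedXML.Runs.iterate {c b : Prog} {T : ℕ} (n : ℕ) (s : ℕ → Data)
    (hc : ∀ i < n, ∃ y t, y ≠ .nil ∧ Runs c (s i) y t ∧ t ≤ T)
    (hn : ∃ t, Runs c (s n) .nil t ∧ t ≤ T)
    (hb : ∀ i < n, ∃ t, Runs b (s i) (s (i + 1)) t ∧ t ≤ T) :
    ∃ t, Runs (.loop c b) (s 0) (s n) t ∧ t ≤ (n + 1) * (1 + 2 * T) := by
  induction n generalizing s with
  | zero =>
    obtain ⟨t, ht, h⟩ := hn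
    exact ⟨1 + t, by constructor; exact ht, by omega⟩
  | succ n ih =>
    obtain ⟨u, hu, hu'⟩ := ih (fun i => s (i + 1)) (fun i hi => hc _ (by omega)) hn
      fun i hi => hb _ (by omega)
    obtain ⟨y, t, hy, ht, htT⟩ := hc 0 (by omega)
    obtain ⟨t', ht', htT'⟩ := hb 0 (by omega)
    refine ⟨_, .loop_step ht hy ht' hu, ?_⟩
    have : (n + 1 + 1) * (1 + 2 * T) = (n + 1) * (1 + 2 * T) + (1 + 2 * T) := by ring
    omega

/-- A polynomial number of rounds is not enough, since a body that doubles its state runs in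
polynomial time. The size of all intermediate states must be bounded in terms of the initial one. -/
theorem iterate {n : X → ℕ} {s c : X → ℕ → Data}
    (hc : Poly (fun p : X × ℕ => s p.1 p.2) fun p => c p.1 p.2)
    (hpos : ∀ x, ∀ i < n x, c x i ≠ .nil) (hnil : ∀ x, c x (n x) = .nil)
    (hb : Poly (fun p : {p : X × ℕ // p.2 < n p.1} => s p.1.1 p.1.2)
      fun p => s p.1.1 (p.1.2 + 1))
    (hn : PolyBdd (fun x => (s x 0).size) n)
    (hs : ∃ r : Polynomial ℕ, ∀ x, ∀ i ≤ n x, (s x i).size ≤ r.eval (s x 0).size) :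
    Poly (fun x => s x 0) fun x => s x (n x) := by
  obtain ⟨C, qc, hc⟩ := hc
  obtain ⟨B, qb, hb⟩ := hb
  obtain ⟨qn, hn⟩ := hn
  obtain ⟨r, hr⟩ := hs
  refine ⟨.loop C B, (qn + 1) * (1 + 2 * (qc.comp r + qb.comp r)), fun x => ?_⟩
  set N := (s x 0).size with hN
  have hCT : ∀ i ≤ n x, ∃ t, Runs C (s x i) (c x i) t ∧ t ≤ qc.eval (r.eval N) + qb.eval (r.eval N) := by
    intro i hi
    obtain ⟨t, ht, htq⟩ := hc (x, i)
    exact ⟨t, ht, (htq.trans (eval_mono qc (hr x i hi))).trans (Nat.le_add_right _ _)⟩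
  have hBT : ∀ i < n x, ∃ t, Runs B (s x i) (s x (i + 1)) t ∧
      t ≤ qc.eval (r.eval N) + qb.eval (r.eval N) := by
    intro i hi
    obtain ⟨t, ht, htq⟩ := hb ⟨(x, i), hi⟩
    exact ⟨t, ht, (htq.trans (eval_mono qb (hr x i hi.le))).trans (Nat.le_add_left _ _)⟩
  obtain ⟨t, ht, htT⟩ := Runs.iterate (n x) (s x)
    (fun i hi => by
      obtain ⟨t, ht, h⟩ := hCT i hi.le
      exact ⟨_, t, hpos x i hi, ht, h⟩)
    (by have := hCT (n x) le_rfl; rwa [hnil] at this) hBT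
  refine ⟨t, ht, htT.trans ?_⟩
  simp only [Polynomial.eval_mul, Polynomial.eval_add, Polynomial.eval_one, Polynomial.eval_ofNat,
    Polynomial.eval_comp]
  exact Nat.mul_le_mul (Nat.add_le_add_right (hn x) 1) le_rfl

end Poly

/-! # Lists -/

namespace Data

theorem length_lt_size_ofList (l : List Data) : l.length < (ofList l).size := by
  induction l with
  | nil => simp [ofList, size]
  | cons a l ih => simp only [ofList, size, List.length_cons]; omega

theorem size_ofList (l : List Data) : (ofList l).size = 1 + (l.map fun a => 1 + a.size).sum := by
  induction l with
  | nil => simp [ofList, size]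
  | cons a l ih => simp only [ofList, size, List.map_cons, List.sum_cons, ih]; omega

theorem size_ofList_le_of_sublist {l l' : List Data} (h : l.Sublist l') :
    (ofList l).size ≤ (ofList l').size := by
  rw [size_ofList, size_ofList]
  exact Nat.add_le_add_left ((h.map _).sum_le_sum (by simp)) 1

theorem size_le_of_mem {l : List Data} {a : Data} (h : a ∈ l) : a.size ≤ (ofList l).size := by
  induction l with
  | nil => simp at h
  | cons b l ih =>
    simp only [ofList, size]
    rcases List.mem_cons.1 h with rfl | h
    · omega
    · have := ih h; omega

end Data

/-- Code of a list, given a code of its entries. -/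
abbrev listCode {β : Type} (enc : β → Data) (l : List β) : Data := .ofList (l.map enc)

namespace Poly

variable {X : Type} {e f g : X → Data}

/-- A loop reads a list from the front while structural recursion starts from the end, so recursion
begins with a reversal. -/
theorem reverse {l : X → List Data} (h : Poly e fun x => .ofList (l x)) :
    Poly e fun x => .ofList (l x).reverse := by
  have key : Poly (fun x => .cons (.ofList (l x)) (.ofList []))
      fun x => .cons (.ofList []) (.ofList (l x).reverse) := by
    have := iterate (X := X) (n := fun x => (l x).length)
      (s := fun x i => .cons (.ofList ((l x).drop i)) (.ofList ((l x).take i).reverse))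
      (c := fun x i => .ofList ((l x).drop i)) (id _).fst ?_ ?_ ?_ ?_ ?_
    · simpa using this
    · intro x i hi
      rw [List.drop_eq_getElem_cons hi]
      simp [Data.ofList]
    · simp [Data.ofList]
    · refine ((id _).fst.tl.cons ((id _).fst.hd.cons (id _).snd)).congr ?_
      rintro ⟨⟨x, i⟩, hi⟩
      dsimp only at hi ⊢
      rw [List.drop_eq_getElem_cons hi, List.take_succ_eq_append_getElem hi, List.reverse_append]
      rfl
    · refine (PolyBdd.refl _).mono fun x => ?_
      have := Data.length_lt_size_ofList (l x)
      simp only [Data.size, List.drop_zero]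
      omega
    · refine ⟨.X, fun x i hi => ?_⟩
      simp only [Data.size, Data.size_ofList, List.drop_zero, Polynomial.eval_X, List.map_reverse,
        List.sum_reverse, List.take_zero, List.reverse_nil, List.map_nil, List.sum_nil]
      have := congrArg (fun l => (l.map fun a => 1 + Data.size a).sum)
        (List.take_append_drop i (l x))
      simp only [List.map_append, List.sum_append] at this
      omega
  exact ((h.cons (nil e)).trans key).snd

/-- Structural recursion on a list. -/
theorem listRec {β : X → Type} {enc : ∀ x, β x → Data} {F : ∀ x, List (β x) → Data}
    {l : ∀ x, List (β x)} (hl : Poly e fun x => listCode (enc x) (l x))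
    (h0 : Poly e fun x => F x [])
    (hF : Poly (fun p : Σ x, β x × List (β x) => .cons (e p.1) (.cons (enc p.1 p.2.1)
        (.cons (listCode (enc p.1) p.2.2) (F p.1 p.2.2))))
      fun p => F p.1 (p.2.1 :: p.2.2))
    (hs : ∃ r : Polynomial ℕ, ∀ x, ∀ l', l' <:+ l x → (F x l').size ≤ r.eval (e x).size) :
    Poly e fun x => F x (l x) := by
  obtain ⟨r, hr⟩ := hs
  -- The state holds the context, the reversed list still to be read, the suffix already treated,
  -- and the value of `F` on that suffix.
  have key : Poly (fun x => .cons (e x) (.cons (listCode (enc x) (l x).reverse)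
      (.cons (listCode (enc x) []) (F x [])))) fun x => .cons (e x) (.cons (listCode (enc x) [])
      (.cons (listCode (enc x) (l x)) (F x (l x)))) := by
    have := iterate (X := X) (n := fun x => (l x).length)
      (s := fun x i => .cons (e x) (.cons (listCode (enc x) ((l x).reverse.drop i))
        (.cons (listCode (enc x) ((l x).drop ((l x).length - i)))
          (F x ((l x).drop ((l x).length - i))))))
      (c := fun x i => listCode (enc x) ((l x).reverse.drop i)) (id _).snd.fst ?_ ?_ ?_ ?_ ?_
    · have h : ∀ x, (l x).reverse.drop (l x).length = [] := fun x =>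
        List.drop_eq_nil_of_le (by simp)
      simpa [h] using this
    · intro x i hi
      rw [List.drop_eq_getElem_cons (by simpa using hi)]
      simp [listCode, Data.ofList]
    · intro x
      rw [List.drop_eq_nil_of_le (by simp)]
      rfl
    · have h1 := (id (X := {p : X × ℕ // p.2 < (l p.1).length})
        (fun p => Data.cons (e p.1.1) (.cons (listCode (enc p.1.1) ((l p.1.1).reverse.drop p.1.2))
        (.cons (listCode (enc p.1.1) ((l p.1.1).drop ((l p.1.1).length - p.1.2)))
          (F p.1.1 ((l p.1.1).drop ((l p.1.1).length - p.1.2)))))))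
      have h2 := hF.reindex (Y := {p : X × ℕ // p.2 < (l p.1).length})
        fun p => ⟨p.1.1, (l p.1.1)[(l p.1.1).length - p.1.2 - 1]'(by
            have := p.2; omega),
          (l p.1.1).drop ((l p.1.1).length - p.1.2)⟩
      have hdrop : ∀ p : {p : X × ℕ // p.2 < (l p.1).length},
          (l p.1.1).drop ((l p.1.1).length - (p.1.2 + 1)) =
          (l p.1.1)[(l p.1.1).length - p.1.2 - 1]'(by have := p.2; omega) ::
            (l p.1.1).drop ((l p.1.1).length - p.1.2) := by
        intro p
        have hp := p.2
        have h : (l p.1.1).length - (p.1.2 + 1) < (l p.1.1).length := by omega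
        rw [List.drop_eq_getElem_cons h]
        congr 2
        omega
      have hrev : ∀ p : {p : X × ℕ // p.2 < (l p.1).length},
          (l p.1.1).reverse.drop p.1.2 = (l p.1.1)[(l p.1.1).length - p.1.2 - 1]'(by
            have := p.2; omega) :: (l p.1.1).reverse.drop (p.1.2 + 1) := by
        intro p
        have hp := p.2
        rw [List.drop_eq_getElem_cons (by simpa using hp)]
        congr 1
        rw [List.getElem_reverse]
        congr 1
        omega
      have h3 : Poly _ _ := h1.fst.cons ((h1.snd.fst.congr fun p => by rw [hrev p]).hd.cons
        h1.snd.snd)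
      have h4 : Poly (fun p : {p : X × ℕ // p.2 < (l p.1).length} => _) fun p =>
          listCode (enc p.1.1) ((l p.1.1).drop ((l p.1.1).length - (p.1.2 + 1))) :=
        ((h1.snd.fst.congr fun p => by rw [hrev p]).hd.cons h1.snd.snd.fst).congr fun p => by
          rw [hdrop p]; rfl
      refine (h1.fst.cons ((h1.snd.fst.congr fun p => by rw [hrev p]).tl.cons
        (h4.cons (h3.trans h2)))).congr ?_
      intro p
      dsimp only
      rw [hdrop p]
      rfl
    · refine (PolyBdd.refl _).mono fun x => ?_
      have := Data.length_lt_size_ofList ((l x).reverse.map (enc x))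
      simp only [List.length_map, List.length_reverse] at this
      simp only [listCode, Data.size, List.drop_zero]
      omega
    · refine ⟨.X + .X + .X + r, fun x i hi => ?_⟩
      have h1 := hr x _ (List.drop_suffix ((l x).length - i) (l x))
      have h2 := Data.size_ofList_le_of_sublist
        ((List.drop_sublist i (l x).reverse).map (enc x))
      have h3 := Data.size_ofList_le_of_sublist
        ((List.drop_sublist ((l x).length - i) (l x)).map (enc x))
      have h4 : (Data.ofList ((l x).map (enc x))).size =
          (Data.ofList ((l x).reverse.map (enc x))).size := by
        simp [Data.size_ofList]
      simp only [listCode, Data.size, List.drop_zero, Polynomial.eval_X, Polynomial.eval_add] at *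
      refine le_trans ?_ (Nat.add_le_add_left (eval_mono r (show (e x).size ≤ _ from ?_)) _)
      · omega
      · omega
  exact (((id e).cons ((hl.reverse.congr fun x => by rw [← List.map_reverse]).cons
    ((nil e).cons h0))).trans key).snd.snd.snd

end Poly

/-- Code of the context `e` extended by an additional value. -/
abbrev extCode {X : Type} {β : X → Type} (e : X → Data) (enc : ∀ x, β x → Data) :
    (Σ x, β x) → Data := fun p => .cons (e p.1) (enc p.1 p.2)

/-! ### Extended contexts and list operations in polynomial time -/

namespace Poly

variable {X : Type} {e f g : X → Data} {β γ : X → Type} {enc : ∀ x, β x → Data}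
  {l : ∀ x, List (β x)}

theorem weaken (h : Poly e f) : Poly (extCode e enc) fun p => f p.1 :=
  (id (extCode e enc)).fst.trans (h.reindex Sigma.fst)

theorem var (e : X → Data) (enc : ∀ x, β x → Data) : Poly (extCode e enc) fun p => enc p.1 p.2 :=
  (id (extCode e enc)).snd

theorem subst {F : (Σ x, β x) → Data} (h : Poly (extCode e enc) F) {b : ∀ x, β x}
    (hb : Poly e fun x => enc x (b x)) : Poly e fun x => F ⟨x, b x⟩ :=
  ((id e).cons hb).trans (h.reindex fun x => ⟨x, b x⟩)

theorem bdd_mem {F : ∀ x, β x → Data} (hl : Poly e fun x => listCode (enc x) (l x))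
    (h : Poly (extCode e enc) fun p => F p.1 p.2) :
    ∃ r : Polynomial ℕ, ∀ x, ∀ b ∈ l x, (F x b).size ≤ r.eval (e x).size := by
  obtain ⟨r, hr⟩ := hl.bdd
  obtain ⟨q, hq⟩ := h.bdd
  refine ⟨q.comp (1 + .X + r), fun x b hb => (hq ⟨x, b⟩).trans ?_⟩
  rw [Polynomial.eval_comp]
  apply eval_mono
  have h1 := Data.size_le_of_mem (List.mem_map_of_mem (f := enc x) hb)
  have h2 := hr x
  simp only [Data.size, Polynomial.eval_add, Polynomial.eval_one, Polynomial.eval_X]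
  simp only [listCode] at h2
  omega

/-- The increment is bounded in terms of the context alone and not of the current value, so growth
is linear in the number of steps. -/
theorem bdd_suffix {r : Polynomial ℕ} {F : ∀ x, List (β x) → Data}
    (hl : Poly e fun x => listCode (enc x) (l x))
    (h0 : ∀ x, (F x []).size ≤ r.eval (e x).size)
    (h : ∀ x b l', b :: l' <:+ l x → (F x (b :: l')).size ≤ (F x l').size + r.eval (e x).size) :
    ∃ r : Polynomial ℕ, ∀ x, ∀ l', l' <:+ l x → (F x l').size ≤ r.eval (e x).size := by
  obtain ⟨q, hq⟩ := hl.bdd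
  refine ⟨(q + 1) * r, fun x l' hl' => ?_⟩
  have key : (F x l').size ≤ (l'.length + 1) * r.eval (e x).size := by
    induction l' with
    | nil => simpa using h0 x
    | cons b l' ih =>
      have h1 := ih ((List.suffix_cons b l').trans hl')
      have h2 := h x b l' hl'
      simp only [List.length_cons]
      rw [Nat.add_one_mul]
      omega
  refine key.trans ?_
  simp only [Polynomial.eval_mul, Polynomial.eval_add, Polynomial.eval_one]
  refine Nat.mul_le_mul ?_ le_rfl
  have h1 := Data.length_lt_size_ofList ((l x).map (enc x))
  have h2 := hq x
  have h3 := hl'.length_le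
  simp only [listCode, List.length_map] at h1 h2
  omega

/-- Structural recursion on a list, where the step does not use the tail of the list. -/
theorem foldr {F : ∀ x, List (β x) → Data} (hl : Poly e fun x => listCode (enc x) (l x))
    (h0 : Poly e fun x => F x [])
    (hF : Poly (fun p : Σ x, β x × List (β x) => .cons (extCode e enc ⟨p.1, p.2.1⟩) (F p.1 p.2.2))
      fun p => F p.1 (p.2.1 :: p.2.2))
    (hs : ∃ r : Polynomial ℕ, ∀ x, ∀ l', l' <:+ l x → (F x l').size ≤ r.eval (e x).size) :
    Poly e fun x => F x (l x) :=
  listRec hl h0 ((((id _).fst.cons (id _).snd.fst).cons (id _).snd.snd.snd).trans hF) hs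

theorem map {F : ∀ x, β x → Data} (hl : Poly e fun x => listCode (enc x) (l x))
    (h : Poly (extCode e enc) fun p => F p.1 p.2) : Poly e fun x => listCode (F x) (l x) := by
  obtain ⟨r, hr⟩ := bdd_mem hl h
  refine foldr (F := fun x l => listCode (F x) l) hl (nil e) ?_
    (bdd_suffix (r := 1 + r) hl (fun x => ?_) fun x b l' hl' => ?_)
  · exact ((id _).fst.trans (h.reindex fun p : Σ x, β x × List (β x) => ⟨p.1, p.2.1⟩)).cons
      (id _).snd
  · simp [listCode, Data.ofList, Data.size]
  · have := hr x b (hl'.subset (by simp))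
    simp only [listCode, Data.ofList, Data.size, List.map_cons, Polynomial.eval_add,
      Polynomial.eval_one]
    omega

theorem all {c : ∀ x, β x → Bool} (hl : Poly e fun x => listCode (enc x) (l x))
    (h : Poly (extCode e enc) fun p => .ofBool (c p.1 p.2)) :
    Poly e fun x => .ofBool ((l x).all (c x)) := by
  refine foldr (F := fun x l => .ofBool (l.all (c x))) hl (const e _) ?_
    ⟨3, fun x l' _ => ?_⟩
  · exact (and ((id _).fst.trans (h.reindex fun p : Σ x, β x × List (β x) => ⟨p.1, p.2.1⟩))
      (id _).snd).congr fun p => by simp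
  · cases l'.all (c x) <;> simp [Data.ofBool, Data.size]

theorem any {c : ∀ x, β x → Bool} (hl : Poly e fun x => listCode (enc x) (l x))
    (h : Poly (extCode e enc) fun p => .ofBool (c p.1 p.2)) :
    Poly e fun x => .ofBool ((l x).any (c x)) :=
  (hl.all (c := fun x b => !c x b) h.not).not.congr fun x => by simp [← List.not_any_eq_all_not]

theorem filter {c : ∀ x, β x → Bool} (hl : Poly e fun x => listCode (enc x) (l x))
    (h : Poly (extCode e enc) fun p => .ofBool (c p.1 p.2)) :
    Poly e fun x => listCode (enc x) ((l x).filter (c x)) := by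
  refine foldr (F := fun x l => listCode (enc x) (l.filter (c x))) hl (const e _) ?_ ?_
  · exact (cond ((id _).fst.trans (h.reindex fun p : Σ x, β x × List (β x) => ⟨p.1, p.2.1⟩))
      ((id _).fst.snd.cons (id _).snd) (id _).snd).congr fun p => by
        rw [List.filter_cons]; cases c p.1 p.2.1 <;> rfl
  · obtain ⟨q, hq⟩ := hl.bdd
    exact ⟨q, fun x l' hl' => (Data.size_ofList_le_of_sublist
      ((List.filter_sublist.trans hl'.sublist).map _)).trans (hq x)⟩

theorem append {l l' : X → List Data} (hl : Poly e fun x => .ofList (l x))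
    (hl' : Poly e fun x => .ofList (l' x)) : Poly e fun x => .ofList (l x ++ l' x) := by
  have hl : Poly e fun x => listCode (fun a : Data => a) (l x) := by simpa [listCode] using hl
  refine foldr (F := fun x l => .ofList (l ++ l' x)) hl (by simpa using hl')
    ((id _).fst.snd.cons (id _).snd) ?_
  obtain ⟨q, hq⟩ := hl.bdd
  obtain ⟨q', hq'⟩ := hl'.bdd
  refine ⟨q + q', fun x m hm => ?_⟩
  have h1 := hq x
  have h2 := hq' x
  have h3 := Data.size_ofList_le_of_sublist hm.sublist
  simp only [Data.size_ofList, List.map_append, List.sum_append, Polynomial.eval_add, listCode,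
    List.map_id_fun', id_eq] at *
  omega

theorem flatten {l : X → List (List Data)} (hl : Poly e fun x => listCode .ofList (l x)) :
    Poly e fun x => .ofList (l x).flatten := by
  refine foldr (F := fun x l => .ofList l.flatten) hl (nil e)
    ((append (id _).fst.snd (id _).snd).congr fun p => by simp) ?_
  obtain ⟨q, hq⟩ := hl.bdd
  refine ⟨q, fun x m hm => ?_⟩
  have h1 := hq x
  have h2 := Data.size_ofList_le_of_sublist (hm.sublist.map Data.ofList)
  refine le_trans ?_ (h2.trans h1)
  clear hm h1 h2
  induction m with
  | nil => simp
  | cons a m ih =>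
    simp only [Data.size_ofList, List.flatten_cons, List.map_append, List.sum_append,
      List.map_cons, List.sum_cons] at *
    omega

theorem flatMap {F : ∀ x, β x → List Data} (hl : Poly e fun x => listCode (enc x) (l x))
    (h : Poly (extCode e enc) fun p => .ofList (F p.1 p.2)) :
    Poly e fun x => .ofList ((l x).flatMap (F x)) :=
  (flatten (l := fun x => (l x).map (F x)) ((map (F := fun x b => .ofList (F x b)) hl h).congr
    fun x => by simp [listCode, Function.comp_def])).congr
    fun x => by simp [List.flatMap_def]

theorem mem [∀ x, DecidableEq (β x)] {a : ∀ x, β x} (henc : ∀ x, Function.Injective (enc x))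
    (ha : Poly e fun x => enc x (a x)) (hl : Poly e fun x => listCode (enc x) (l x)) :
    Poly e fun x => .ofBool (decide (a x ∈ l x)) :=
  (hl.any (c := fun x b => decide (enc x (a x) = enc x b)) (ha.weaken.beq (var e enc))).congr
    fun x => by
    congr 1
    rw [Bool.eq_iff_iff]
    simp [(henc x).eq_iff]

/-- Code of a symbol. -/
abbrev _root_.UnorderedXML.symCode {k : ℕ} (a : Fin k) : Data := .ofNat a

theorem _root_.UnorderedXML.symCode_injective {k : ℕ} :
    Function.Injective (symCode (k := k)) :=
  fun _ _ h => Fin.ext (Data.ofNat_injective h)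

theorem finRange {k : X → ℕ} (h : Poly e fun x => .ofNat (k x)) :
    Poly e fun x => listCode symCode (List.finRange (k x)) := by
  -- A unary numeral is also the code of a list of unit values, so list recursion serves as
  -- recursion on numbers.
  have hrep : ∀ n, Data.ofNat n = listCode (fun _ : Unit => .nil) (List.replicate n ()) := by
    intro n
    induction n with
    | zero => rfl
    | succ n ih => simp only [Data.ofNat, ih]; rfl
  have hrange : ∀ n, listCode symCode (List.finRange n) = .ofList ((List.range n).map .ofNat) := by
    intro n
    rw [← List.map_coe_finRange_eq_range, List.map_map]
    rfl
  simp only [hrange]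
  have h' := h.congr fun x => hrep (k x)
  refine (listRec (F := fun x l => .ofList ((List.range l.length).map .ofNat)) h' (nil e)
    ?_ ?_).congr fun x => by simp
  · have h1 := id (fun p : Σ _ : X, Unit × List Unit => Data.cons (e p.1) (.cons .nil
      (.cons (listCode (fun _ : Unit => .nil) p.2.2)
        (.ofList ((List.range p.2.2.length).map .ofNat)))))
    -- The code of the remaining tail is itself the numeral to be appended.
    refine (append (l' := fun p => [.ofNat p.2.2.length]) h1.snd.snd.snd
      ((h1.snd.snd.fst.cons (nil _)).congr fun p => ?_)).congr fun p => ?_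
    · have : listCode (fun _ : Unit => .nil) p.2.2 = .ofNat p.2.2.length := by
        rw [hrep]
        congr
        exact List.eq_replicate_iff.2 ⟨rfl, fun _ _ => rfl⟩
      rw [this]
      rfl
    · simp [List.range_succ]
  · obtain ⟨q, hq⟩ := h.bdd
    refine bdd_suffix (r := 1 + q) h' (fun x => by simp [Data.ofList, Data.size])
      fun x b m hm => ?_
    have h1 : (Data.ofNat (k x)).size ≤ _ := hq x
    have h2 : (Data.ofNat m.length).size ≤ (Data.ofNat (k x)).size := by
      rw [hrep, hrep]
      refine Data.size_ofList_le_of_sublist (List.Sublist.map _ ?_)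
      have := hm.length_le
      simp only [List.length_replicate] at this
      exact (List.replicate_sublist_replicate ()).2 ((Nat.le_succ _).trans this)
    simp only [List.length_cons, List.range_succ, Data.size_ofList, List.map_append,
      List.sum_append, List.map_cons, List.sum_cons, List.map_nil, List.sum_nil,
      Polynomial.eval_add, Polynomial.eval_one] at *
    omega

end Poly

/-! # Normal forms of languages of expressions -/

/-- A language given by the symbols that may occur and those that may occur more than once,
together with disjoint blocks of symbols, some of them exclusive and some of them required. -/
structure NormalForm (α I : Type) where
  live : α → Prop
  many : α → Prop
  mem : I → α → Prop
  excl : I → Prop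
  req : I → Prop
  disjoint : ∀ {i j x}, mem i x → mem j x → i = j
  many_of_free : ∀ {i x}, ¬ excl i → mem i x → live x → many x

namespace NormalForm

variable {α I : Type}

/-- The words described by a normal form. -/
structure Mem (N : NormalForm α I) (w : Word α) : Prop where
  live : ∀ a, 0 < w a → N.live a
  many : ∀ a, 1 < w a → N.many a
  excl : ∀ i, N.excl i → ∀ x y, N.mem i x → N.mem i y → 0 < w x → 0 < w y → x = y
  req : ∀ i, N.req i → ∃ x, N.mem i x ∧ 0 < w x

/-- The language of a normal form. -/
def lang (N : NormalForm α I) : Set (Word α) := {w | N.Mem w}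

/-- The words of a normal form in which only symbols of `U` occur. -/
def restrict (N : NormalForm α I) (U : Set α) : NormalForm α I where
  live a := N.live a ∧ a ∈ U
  many := N.many
  mem := N.mem
  excl := N.excl
  req := N.req
  disjoint := N.disjoint
  many_of_free h h' h'' := N.many_of_free h h' h''.1

theorem mem_lang_restrict {N : NormalForm α I} {U : Set α} {w : Word α} :
    w ∈ (N.restrict U).lang ↔ w ∈ N.lang ∧ ∀ a, 0 < w a → a ∈ U :=
  ⟨fun h => ⟨⟨fun a ha => (h.live a ha).1, h.many, h.excl, h.req⟩, fun a ha => (h.live a ha).2⟩,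
    fun h => ⟨fun a ha => ⟨h.1.live a ha, h.2 a ha⟩, h.1.many, h.1.excl, h.1.req⟩⟩

open Classical in
-- The word consists of `T` together with one live symbol outside `X` from each required block that
-- `T` misses, every repeatable symbol taken twice. A block that receives a chosen symbol has none
-- from `T`, and blocks are disjoint, so exclusivity is preserved.
theorem exists_mem (N : NormalForm α I) {T X : Set α} (hlive : ∀ a ∈ T, N.live a)
    (hexcl : ∀ i, N.excl i → ∀ x ∈ T, ∀ y ∈ T, N.mem i x → N.mem i y → x = y)
    (hTX : ∀ a ∈ T, a ∉ X) (hX : ∀ i, N.req i → ∃ x, N.mem i x ∧ N.live x ∧ x ∉ X) :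
    ∃ w ∈ N.lang, (∀ a ∈ T, 0 < w a ∧ (N.many a → 1 < w a)) ∧ ∀ x ∈ X, w x = 0 := by
  choose c hc hclive hcX using hX
  set T' : Set α := {a | a ∈ T ∨ ∃ i, ∃ h : N.req i, (∀ x ∈ T, ¬ N.mem i x) ∧ a = c i h} with hT'
  refine ⟨fun a => if a ∈ T' then (if N.many a then 2 else 1) else 0, ⟨?_, ?_, ?_, ?_⟩, ?_, ?_⟩
  · intro a ha
    by_cases h : a ∈ T'
    · rcases h with h | ⟨i, hi, -, rfl⟩
      exacts [hlive a h, hclive i hi]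
    · simp [h] at ha
  · intro a ha
    by_contra h
    simp only [h, if_false] at ha
    split_ifs at ha <;> omega
  · intro i hi x y hx hy hwx hwy
    have hx' : x ∈ T' := by by_contra h; simp [h] at hwx
    have hy' : y ∈ T' := by by_contra h; simp [h] at hwy
    rcases hx' with hx' | ⟨j, hj, hjT, rfl⟩ <;> rcases hy' with hy' | ⟨j', hj', hjT', rfl⟩
    · exact hexcl i hi x hx' y hy' hx hy
    · exact absurd (N.disjoint hy (hc j' hj') ▸ hx) (hjT' x hx')
    · exact absurd (N.disjoint hx (hc j hj) ▸ hy) (hjT y hy')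
    · obtain rfl := N.disjoint (hc j hj) hx
      obtain rfl := N.disjoint (hc j' hj') hy
      rfl
  · intro i hi
    by_cases h : ∃ x ∈ T, N.mem i x
    · obtain ⟨x, hx, hix⟩ := h
      refine ⟨x, hix, ?_⟩
      simp only [show x ∈ T' from Or.inl hx, if_true]
      split_ifs <;> omega
    · push Not at h
      refine ⟨c i hi, hc i hi, ?_⟩
      simp only [show c i hi ∈ T' from Or.inr ⟨i, hi, h, rfl⟩, if_true]
      split_ifs <;> omega
  · intro a ha
    simp only [show a ∈ T' from Or.inl ha, if_true]
    exact ⟨by split_ifs <;> omega, fun h => by simp [h]⟩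
  · intro x hx
    refine if_neg ?_
    rintro (h | ⟨i, hi, -, rfl⟩)
    exacts [hTX x h hx, hcX i hi hx]

end NormalForm

/-! # The normal form of an expression -/

section Blocks

variable {α : Type}

/-- The symbols of a block. -/
def blockSyms (b : List (α × Mult) × Mult) : List α := b.1.map Prod.fst

/-- A symbol that occurs in some word of a block. -/
def BlockLive (b : List (α × Mult) × Mult) (a : α) : Prop :=
  b.2 ≠ .zero ∧ ∃ m, (a, m) ∈ b.1 ∧ m ≠ .zero

/-- A symbol that occurs at least twice in some word of a block. -/
def BlockMany (b : List (α × Mult) × Mult) (a : α) : Prop :=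
  b.2 ≠ .zero ∧ ∃ m, (a, m) ∈ b.1 ∧ m ≠ .zero ∧
    (b.2 = .plus ∨ b.2 = .star ∨ m = .plus ∨ m = .star)

/-- A block in which different symbols exclude each other. -/
def BlockExcl (b : List (α × Mult) × Mult) : Prop := b.2 ≠ .plus ∧ b.2 ≠ .star

/-- A block whose language does not contain the empty word. -/
def BlockReq (b : List (α × Mult) × Mult) : Prop :=
  (b.2 = .one ∨ b.2 = .plus) ∧ ∀ p ∈ b.1, p.2 = .one ∨ p.2 = .plus

theorem DME.nodup_flatMap (E : DME α) : (E.blocks.flatMap blockSyms).Nodup := by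
  have := E.nodup
  rwa [List.map_flatMap] at this

variable [DecidableEq α]

/-- Every multiplicity is a union of some of the sets `{0}`, `{1}` and `{2, 3, …}`, so only these
three cases of a count can be distinguished. -/
theorem mem_disjLang {d : List (α × Mult)} {w : Word α} : w ∈ disjLang d ↔
    (∀ a, 0 < w a → ∃ m, (a, m) ∈ d ∧ m ≠ .zero) ∧
    (∀ a, 1 < w a → ∃ m, (a, m) ∈ d ∧ (m = .plus ∨ m = .star)) ∧
    (∀ x y, 0 < w x → 0 < w y → x = y) ∧
    ((∀ p ∈ d, p.2 = .one ∨ p.2 = .plus) → ∃ x, 0 < w x) := by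
  constructor
  · rintro ⟨⟨b, m⟩, hp, i, hi, rfl⟩
    have hne : ∀ a, 0 < (Pi.single b i : Word α) a → a = b := by
      intro a ha
      by_contra h
      simp [h] at ha
    refine ⟨fun a ha => ?_, fun a ha => ?_, fun x y hx hy => (hne x hx).trans (hne y hy).symm,
      fun h => ⟨b, ?_⟩⟩
    · obtain rfl := hne a ha
      refine ⟨m, hp, ?_⟩
      rintro rfl
      simp only [Mult.sem, Set.mem_singleton_iff] at hi
      simp [hi] at ha
    · obtain rfl := hne a (Nat.zero_lt_of_lt ha)
      refine ⟨m, hp, ?_⟩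
      rw [Pi.single_eq_same] at ha
      cases m <;> simp only [Mult.sem, Set.mem_insert_iff, Set.mem_singleton_iff] at hi <;>
        simp <;> omega
    · have := h _ hp
      simp only [Pi.single_eq_same]
      rcases this with h | h <;> simp only at h <;> subst h <;> simp [Mult.sem] at hi <;> omega
  · rintro ⟨h1, h2, h3, h4⟩
    by_cases h : ∃ x, 0 < w x
    · obtain ⟨x, hx⟩ := h
      have hw : w = Pi.single x (w x) := by
        funext y
        by_cases hy : y = x
        · subst hy; simp
        · rw [Pi.single_eq_of_ne hy]
          by_contra hwy
          exact hy (h3 y x (by omega) hx)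
      by_cases hx1 : 1 < w x
      · obtain ⟨m, hm, hm'⟩ := h2 x hx1
        refine ⟨_, hm, w x, ?_, hw⟩
        rcases hm' with rfl | rfl <;> simp [Mult.sem]
        omega
      · obtain ⟨m, hm, hm'⟩ := h1 x hx
        refine ⟨_, hm, w x, ?_, hw⟩
        have : w x = 1 := by omega
        rw [this]
        cases m <;> simp [Mult.sem] at hm' ⊢
    · have hw : w = 0 := by
        funext x
        by_contra hx
        exact h ⟨x, Nat.pos_of_ne_zero hx⟩
      have := mt h4 h
      push Not at this
      obtain ⟨⟨a, m⟩, hp, hm, hm'⟩ := this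
      refine ⟨_, hp, 0, ?_, by simp [hw]⟩
      cases m <;> simp [Mult.sem] at hm hm' ⊢

/-- Cutting a word into single occurrences shows that a block with outer `+` or `*` accepts every
nonempty word over its live symbols. -/
theorem sum_flatMap_single (d : List (α × Mult)) (hd : (d.map Prod.fst).Nodup) (w : Word α)
    (hw : ∀ a, 0 < w a → a ∈ d.map Prod.fst) :
    (d.flatMap fun p => List.replicate (w p.1) (Pi.single p.1 1 : Word α)).sum = w := by
  induction d generalizing w with
  | nil =>
    funext a
    have := hw a
    simp at this
    simp [this]
  | cons p d ih =>
    simp only [List.map_cons, List.nodup_cons] at hd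
    have hpd : ∀ q ∈ d, q.1 ≠ p.1 := fun q hq h => hd.1 (h ▸ List.mem_map_of_mem hq)
    have := ih hd.2 (Function.update w p.1 0) fun a ha => by
      by_cases h : a = p.1
      · subst h; simp at ha
      · rw [Function.update_of_ne h] at ha
        simpa [h] using hw a ha
    have h' : (d.flatMap fun q => List.replicate (Function.update w p.1 0 q.1)
        (Pi.single q.1 1 : Word α)) =
        d.flatMap fun q => List.replicate (w q.1) (Pi.single q.1 1 : Word α) := by
      refine List.flatMap_congr fun q hq => ?_
      rw [Function.update_of_ne (hpd q hq)]
    rw [List.flatMap_cons, List.sum_append, ← h', this]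
    funext a
    by_cases h : a = p.1
    · subst h; simp
    · simp [h]

theorem mem_blockLang {b : List (α × Mult) × Mult} (hb : (blockSyms b).Nodup) {w : Word α} :
    w ∈ blockLang b ↔ (∀ a, 0 < w a → BlockLive b a) ∧ (∀ a, 1 < w a → BlockMany b a) ∧
      (BlockExcl b → ∀ x y, 0 < w x → 0 < w y → x = y) ∧ (BlockReq b → ∃ x, 0 < w x) := by
  obtain ⟨d, M⟩ := b
  have hzero : ∀ w : Word α, (∀ a, ¬ 0 < w a) → w = 0 := fun w h =>
    funext fun a => by simpa using h a
  have hpm : M = .plus ∨ M = .star → (w ∈ blockLang (d, M) ↔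
      (∀ a, 0 < w a → ∃ m, (a, m) ∈ d ∧ m ≠ .zero) ∧
      (M = .plus → (∀ p ∈ d, p.2 = .one ∨ p.2 = .plus) → ∃ x, 0 < w x)) := by
    intro hM
    constructor
    · rintro ⟨ws, hlen, hws, rfl⟩
      constructor
      · intro a ha
        have : ∃ v ∈ ws, 0 < v a := by
          by_contra h
          push Not at h
          have : ws.sum a = 0 := by
            rw [Pi.list_sum_apply]
            exact List.sum_eq_zero (by simpa using h)
          omega
        obtain ⟨v, hv, hva⟩ := this
        exact (mem_disjLang.1 (hws v hv)).1 a hva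
      · rintro rfl h
        simp only [Mult.sem, Set.mem_ofPred_eq] at hlen
        obtain ⟨v, vs, rfl⟩ := List.exists_cons_of_length_pos hlen
        obtain ⟨x, hx⟩ := (mem_disjLang.1 (hws v (by simp))).2.2.2 h
        exact ⟨x, by simp; omega⟩
    · rintro ⟨h1, h2⟩
      by_cases h : ∃ x, 0 < w x
      · obtain ⟨x, hx⟩ := h
        have hsum := sum_flatMap_single d hb w fun a ha => by
          obtain ⟨m, hm, -⟩ := h1 a ha
          exact List.mem_map_of_mem (f := Prod.fst) hm
        refine ⟨_, ?_, ?_, hsum.symm⟩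
        · rcases hM with rfl | rfl
          · simp only [Mult.sem, Set.mem_ofPred_eq]
            rw [Nat.one_le_iff_ne_zero]
            intro h
            rw [List.length_eq_zero_iff.1 h] at hsum
            simp [← hsum] at hx
          · simp [Mult.sem]
        · intro v hv
          simp only [List.mem_flatMap, List.mem_replicate] at hv
          obtain ⟨p, hp, hpw, rfl⟩ := hv
          obtain ⟨m, hm, hm0⟩ := h1 p.1 (Nat.pos_of_ne_zero hpw)
          -- Every multiplicity other than `0` allows exactly one occurrence.
          refine ⟨_, hm, 1, ?_, rfl⟩
          cases m <;> simp [Mult.sem] at hm0 ⊢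
      · have hw := hzero w (by simpa using h)
        subst hw
        rcases hM with rfl | rfl
        -- Under `+` there must be at least one factor; here it is the empty word.
        · refine ⟨[0], by simp [Mult.sem], ?_, by simp⟩
          simp only [List.mem_singleton, forall_eq]
          exact mem_disjLang.2 ⟨by simp, by simp, by simp, h2 rfl⟩
        · exact ⟨[], by simp [Mult.sem], by simp, by simp⟩
  cases M with
  | star =>
    rw [hpm (.inr rfl)]
    simp only [BlockLive, BlockMany, BlockExcl, BlockReq]
    constructor
    · rintro ⟨h1, -⟩
      refine ⟨by simpa using h1, fun a ha => ?_, by simp, by simp⟩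
      obtain ⟨m, hm, hm'⟩ := h1 a (by omega)
      exact ⟨by simp, m, hm, hm', by simp⟩
    · rintro ⟨h1, -⟩
      simpa using h1
  | plus =>
    rw [hpm (.inl rfl)]
    simp only [BlockLive, BlockMany, BlockExcl, BlockReq]
    constructor
    · rintro ⟨h1, h2⟩
      refine ⟨by simpa using h1, fun a ha => ?_, by simp, by simpa using h2⟩
      obtain ⟨m, hm, hm'⟩ := h1 a (by omega)
      exact ⟨by simp, m, hm, hm', by simp⟩
    · rintro ⟨h1, -, -, h4⟩
      exact ⟨by simpa using h1, by simpa using h4⟩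
  | opt =>
    have : w ∈ blockLang (d, .opt) ↔ w = 0 ∨ w ∈ disjLang d := by
      constructor
      · rintro ⟨ws, hlen, hws, rfl⟩
        simp only [Mult.sem, Set.mem_insert_iff, Set.mem_singleton_iff] at hlen
        rcases hlen with hlen | hlen
        · rw [List.length_eq_zero_iff.1 hlen]; simp
        · obtain ⟨v, rfl⟩ := List.length_eq_one_iff.1 hlen
          right; simpa using hws
      · rintro (rfl | h)
        · exact ⟨[], by simp [Mult.sem], by simp, by simp⟩
        · exact ⟨[w], by simp [Mult.sem], by simpa using h, by simp⟩
    rw [this, mem_disjLang]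
    simp only [BlockLive, BlockMany, BlockExcl, BlockReq]
    constructor
    · rintro (rfl | ⟨h1, h2, h3, -⟩)
      · simp
      · refine ⟨by simpa using h1, fun a ha => ?_, fun _ => h3, by simp⟩
        obtain ⟨m, hm, hm'⟩ := h2 a ha
        exact ⟨by simp, m, hm, by rcases hm' with rfl | rfl <;> simp, by simpa using hm'⟩
    · rintro ⟨h1, h2, h3, -⟩
      by_cases h : ∃ x, 0 < w x
      · right
        refine ⟨by simpa using h1, fun a ha => ?_, h3 (by simp), fun _ => h⟩
        obtain ⟨-, m, hm, -, hm'⟩ := h2 a ha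
        exact ⟨m, hm, by simpa using hm'⟩
      · exact .inl (hzero w (by simpa using h))
  | one =>
    have : w ∈ blockLang (d, .one) ↔ w ∈ disjLang d := by
      constructor
      · rintro ⟨ws, hlen, hws, rfl⟩
        obtain ⟨v, rfl⟩ := List.length_eq_one_iff.1 hlen
        simpa using hws
      · exact fun h => ⟨[w], by simp [Mult.sem], by simpa using h, by simp⟩
    rw [this, mem_disjLang]
    simp only [BlockLive, BlockMany, BlockExcl, BlockReq]
    constructor
    · rintro ⟨h1, h2, h3, h4⟩
      refine ⟨by simpa using h1, fun a ha => ?_, fun _ => h3, fun h => h4 h.2⟩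
      obtain ⟨m, hm, hm'⟩ := h2 a ha
      exact ⟨by simp, m, hm, by rcases hm' with rfl | rfl <;> simp, by simpa using hm'⟩
    · rintro ⟨h1, h2, h3, h4⟩
      refine ⟨by simpa using h1, fun a ha => ?_, h3 (by simp), fun h => h4 ⟨by simp, h⟩⟩
      obtain ⟨-, m, hm, -, hm'⟩ := h2 a ha
      exact ⟨m, hm, by simpa using hm'⟩
  | zero =>
    have : w ∈ blockLang (d, .zero) ↔ w = 0 := by
      constructor
      · rintro ⟨ws, hlen, hws, rfl⟩
        rw [List.length_eq_zero_iff.1 hlen]; simp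
      · rintro rfl
        exact ⟨[], by simp [Mult.sem], by simp, by simp⟩
    rw [this]
    simp only [BlockLive, BlockMany, BlockExcl, BlockReq]
    constructor
    · rintro rfl
      simp
    · rintro ⟨h1, -⟩
      exact hzero w fun a ha => (h1 a ha).1 rfl

/-- Blocks share no symbols, so the factor belonging to a block can only be the restriction of `w`
to its symbols. -/
theorem mem_concatLang {bs : List (List (α × Mult) × Mult)}
    (hbs : (bs.flatMap blockSyms).Nodup) {w : Word α} : w ∈ concatLang bs ↔
      (∀ a, 0 < w a → ∃ b ∈ bs, a ∈ blockSyms b) ∧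
      ∀ b ∈ bs, (fun a => if a ∈ blockSyms b then w a else 0) ∈ blockLang b := by
  induction bs generalizing w with
  | nil =>
    simp only [concatLang, Set.mem_singleton_iff, List.not_mem_nil, false_and, exists_false,
      false_imp_iff, implies_true, and_true, imp_false]
    exact ⟨fun h => by simp [h], fun h => funext fun a => by simpa using h a⟩
  | cons b bs ih =>
    rw [List.flatMap_cons, List.nodup_append] at hbs
    obtain ⟨hb, hbs, hdis⟩ := hbs
    have hdis' : ∀ a ∈ blockSyms b, ∀ b' ∈ bs, a ∉ blockSyms b' := fun a ha b' hb' ha' =>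
      hdis a ha a (List.mem_flatMap.2 ⟨b', hb', ha'⟩) rfl
    constructor
    · rintro ⟨u, hu, v, hv, rfl⟩
      rw [ih hbs] at hv
      have hu' : ∀ a, 0 < u a → a ∈ blockSyms b := fun a ha => by
        obtain ⟨-, m, hm, -⟩ := ((mem_blockLang hb).1 hu).1 a ha
        exact List.mem_map_of_mem (f := Prod.fst) hm
      have hv' : ∀ a, 0 < v a → a ∉ blockSyms b := fun a ha h => by
        obtain ⟨b', hb', hab⟩ := hv.1 a ha
        exact hdis' a h b' hb' hab
      refine ⟨fun a ha => ?_, fun b' hb' => ?_⟩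
      · simp only [Pi.add_apply] at ha
        by_cases h : 0 < u a
        · exact ⟨b, by simp, hu' a h⟩
        · obtain ⟨b', hb', hab⟩ := hv.1 a (by omega)
          exact ⟨b', by simp [hb'], hab⟩
      · rcases List.mem_cons.1 hb' with rfl | hb'
        · convert hu using 1
          funext a
          have h1 := hu' a
          have h2 := hv' a
          simp only [Pi.add_apply]
          split_ifs with h
          · have : ¬ 0 < v a := fun h' => h2 h' h
            omega
          · have : ¬ 0 < u a := fun h' => h (h1 h')
            omega
        · convert hv.2 b' hb' using 1
          funext a
          have h1 := hu' a
          simp only [Pi.add_apply]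
          split_ifs with h
          · have : ¬ 0 < u a := fun h' => hdis' a (h1 h') b' hb' h
            omega
          · rfl
    · rintro ⟨h1, h2⟩
      refine ⟨_, h2 b (by simp), fun a => if a ∈ blockSyms b then 0 else w a,
        (ih hbs).2 ⟨fun a ha => ?_, fun b' hb' => ?_⟩, ?_⟩
      · split_ifs at ha with h
        · omega
        · obtain ⟨b', hb', hab⟩ := h1 a ha
          rcases List.mem_cons.1 hb' with rfl | hb'
          exacts [absurd hab h, ⟨b', hb', hab⟩]
      · convert h2 b' (by simp [hb']) using 1
        funext a
        by_cases h : a ∈ blockSyms b'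
        · have : a ∉ blockSyms b := fun h' => hdis' a h' b' hb' h
          simp [h, this]
        · simp [h]
      · funext a
        by_cases h : a ∈ blockSyms b <;> simp [h]

theorem eq_of_mem_blockSyms {bs : List (List (α × Mult) × Mult)}
    (hbs : (bs.flatMap blockSyms).Nodup) {b b' : List (α × Mult) × Mult} (hb : b ∈ bs)
    (hb' : b' ∈ bs) {a : α} (ha : a ∈ blockSyms b) (ha' : a ∈ blockSyms b') : b = b' := by
  by_contra h
  have : Std.Symm (Function.onFun List.Disjoint (blockSyms (α := α))) := ⟨fun _ _ h => h.symm⟩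
  exact (List.nodup_flatMap.1 hbs).2.forall hb hb' h ha ha'

/-- The normal form of a list of blocks. -/
def blocksNF (bs : List (List (α × Mult) × Mult)) (hbs : (bs.flatMap blockSyms).Nodup) :
    NormalForm α (List (α × Mult) × Mult) where
  live a := ∃ b ∈ bs, BlockLive b a
  many a := ∃ b ∈ bs, BlockMany b a
  mem b a := b ∈ bs ∧ a ∈ blockSyms b
  excl b := BlockExcl b
  req b := b ∈ bs ∧ BlockReq b
  disjoint h h' := eq_of_mem_blockSyms hbs h.1 h'.1 h.2 h'.2
  -- An outer `+` or `*` can choose the same live symbol twice.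
  many_of_free := by
    rintro b x hb ⟨hbs', hx⟩ ⟨b', hb', hl, m, hm, hm0⟩
    obtain rfl := eq_of_mem_blockSyms hbs hbs' hb' hx (List.mem_map_of_mem (f := Prod.fst) hm)
    refine ⟨b, hbs', hl, m, hm, hm0, ?_⟩
    simp only [BlockExcl] at hb
    tauto

theorem lang_blocksNF (bs : List (List (α × Mult) × Mult)) (hbs : (bs.flatMap blockSyms).Nodup) :
    (blocksNF bs hbs).lang = concatLang bs := by
  have hnd : ∀ b ∈ bs, (blockSyms b).Nodup := (List.nodup_flatMap.1 hbs).1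
  have hlm : ∀ {b a}, BlockLive b a → a ∈ blockSyms (α := α) b := by
    rintro b a ⟨-, m, hm, -⟩
    exact List.mem_map_of_mem (f := Prod.fst) hm
  have hmm : ∀ {b a}, BlockMany b a → a ∈ blockSyms (α := α) b := by
    rintro b a ⟨-, m, hm, -⟩
    exact List.mem_map_of_mem (f := Prod.fst) hm
  ext w
  rw [mem_concatLang hbs]
  constructor
  · intro h
    refine ⟨fun a ha => ?_, fun b hb => (mem_blockLang (hnd b hb)).2 ⟨fun a ha => ?_,
      fun a ha => ?_, fun he x y hx hy => ?_, fun hr => ?_⟩⟩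
    · obtain ⟨b, hb, hl⟩ := h.live a ha
      exact ⟨b, hb, hlm hl⟩
    · split_ifs at ha with hab
      · obtain ⟨b', hb', hl⟩ := h.live a ha
        rwa [eq_of_mem_blockSyms hbs hb hb' hab (hlm hl)]
      · omega
    · split_ifs at ha with hab
      · obtain ⟨b', hb', hl⟩ := h.many a ha
        rwa [eq_of_mem_blockSyms hbs hb hb' hab (hmm hl)]
      · omega
    · split_ifs at hx hy with hbx hby
      · exact h.excl b he x y ⟨hb, hbx⟩ ⟨hb, hby⟩ hx hy
      all_goals omega
    · obtain ⟨x, hx, hwx⟩ := h.req b ⟨hb, hr⟩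
      exact ⟨x, by simpa [hx.2] using hwx⟩
  · rintro ⟨h1, h2⟩
    have h2' := fun b hb => (mem_blockLang (hnd b hb)).1 (h2 b hb)
    refine ⟨fun a ha => ?_, fun a ha => ?_, fun b he x y hx hy hwx hwy => ?_, fun b hr => ?_⟩
    · obtain ⟨b, hb, hab⟩ := h1 a ha
      exact ⟨b, hb, (h2' b hb).1 a (by simpa [hab] using ha)⟩
    · obtain ⟨b, hb, hab⟩ := h1 a (by omega)
      exact ⟨b, hb, (h2' b hb).2.1 a (by simpa [hab] using ha)⟩
    · exact (h2' b hx.1).2.2.1 he x y (by simpa [hx.2] using hwx) (by simpa [hy.2] using hwy)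
    · obtain ⟨x, hx⟩ := (h2' b hr.1).2.2.2 hr.2
      split_ifs at hx with hbx
      · exact ⟨x, ⟨hr.1, hbx⟩, hx⟩
      · omega

/-- The normal form of an expression. -/
def DME.nf (E : DME α) : NormalForm α (List (α × Mult) × Mult) := blocksNF E.blocks E.nodup_flatMap

theorem DME.lang_nf (E : DME α) : E.nf.lang = E.lang := lang_blocksNF _ _

end Blocks

/-! # Learning an expression from unordered words -/

/-- What the learner asks about a set of words: which symbols occur more than once in some word,
which pairs of symbols occur together in some word, and which lists of symbols are avoided by some
word. -/
structure Stats (α : Type) where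
  many : α → Bool
  co : α → α → Bool
  avoid : List α → Bool

section Algorithm

variable {α : Type}

/-! ## First-fit partitions -/

/-- Insert a symbol into the first set of symbols none of which occurs together with it. -/
def insertFit (co : α → α → Bool) (v : α) : List (List α) → List (List α)
  | [] => [[v]]
  | K :: Ks => bif K.any (co v) then K :: insertFit co v Ks else (v :: K) :: Ks

/-- First-fit partition into sets of pairwise conflicting symbols. -/
def fit (co : α → α → Bool) (l : List α) : List (List α) := l.foldr (insertFit co) []

section Fit

variable {co : α → α → Bool} {l : List α}

theorem insertFit_perm (v : α) (Ks : List (List α)) :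
    (insertFit co v Ks).flatten.Perm (v :: Ks.flatten) := by
  induction Ks with
  | nil => simp [insertFit]
  | cons K Ks ih =>
    cases h : K.any (co v)
    · simp [insertFit, h]
    · simp only [insertFit, h, cond_true, List.flatten_cons]
      exact (ih.append_left K).trans List.perm_middle

theorem fit_perm (l : List α) : (fit co l).flatten.Perm l := by
  induction l with
  | nil => simp [fit]
  | cons v l ih => exact (insertFit_perm v _).trans (ih.cons v)

theorem mem_insertFit {v : α} {Ks : List (List α)} {K : List α} (h : K ∈ insertFit co v Ks) :
    K ∈ Ks ∨ K = [v] ∨ ∃ K' ∈ Ks, K = v :: K' ∧ ∀ x ∈ K', co v x = false := by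
  induction Ks with
  | nil => right; left; simpa [insertFit] using h
  | cons K' Ks ih =>
    cases h' : K'.any (co v) <;> simp only [insertFit, h', cond_true, cond_false,
      List.mem_cons] at h
    · rcases h with rfl | h
      · exact .inr (.inr ⟨K', by simp, rfl, by simpa using h'⟩)
      · simp [h]
    · rcases h with rfl | h
      · simp
      · rcases ih h with h | h | ⟨K'', hK'', h⟩
        exacts [by simp [h], .inr (.inl h), .inr (.inr ⟨K'', by simp [hK''], h⟩)]

theorem fit_ne_nil {K : List α} (h : K ∈ fit co l) : K ≠ [] := by
  induction l generalizing K with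
  | nil => simp [fit] at h
  | cons v l ih =>
    rcases mem_insertFit h with h | rfl | ⟨K', hK', rfl, -⟩
    exacts [ih h, by simp, by simp]

theorem fit_conflict (hco : ∀ x y, co x y = co y x) {K : List α} (h : K ∈ fit co l) {x y : α}
    (hx : x ∈ K) (hy : y ∈ K) (hxy : x ≠ y) : co x y = false := by
  induction l generalizing K with
  | nil => simp [fit] at h
  | cons v l ih =>
    rcases mem_insertFit h with h | rfl | ⟨K', hK', rfl, hv⟩
    · exact ih h hx hy
    · simp only [List.mem_singleton] at hx hy
      exact absurd (hx.trans hy.symm) hxy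
    · rcases List.mem_cons.1 hx with hx' | hx' <;> rcases List.mem_cons.1 hy with hy' | hy'
      · exact absurd (hx'.trans hy'.symm) hxy
      · exact hx' ▸ hv y hy'
      · rw [hco]; exact hy' ▸ hv x hx'
      · exact ih hK' hx' hy'

/-- A symbol passes over a set only if it occurs together with one of its members. Sets only grow,
so this witness is never lost. -/
theorem insertFit_pairwise {v : α} {Ks : List (List α)}
    (h : Ks.Pairwise fun K K' => ∀ y ∈ K', ∃ x ∈ K, co y x = true) :
    (insertFit co v Ks).Pairwise fun K K' => ∀ y ∈ K', ∃ x ∈ K, co y x = true := by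
  induction Ks with
  | nil => simp [insertFit]
  | cons K Ks ih =>
    rw [List.pairwise_cons] at h
    cases h' : K.any (co v) <;> simp only [insertFit, h', cond_true, cond_false,
      List.pairwise_cons]
    · refine ⟨fun K' hK' y hy => ?_, h.2⟩
      obtain ⟨x, hx, hxy⟩ := h.1 K' hK' y hy
      exact ⟨x, by simp [hx], hxy⟩
    · refine ⟨fun K' hK' y hy => ?_, ih h.2⟩
      have hv : ∃ x ∈ K, co v x = true := by simpa using h'
      rcases mem_insertFit hK' with hK' | rfl | ⟨K'', hK'', rfl, -⟩
      · exact h.1 K' hK' y hy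
      · rw [List.mem_singleton] at hy
        exact hy ▸ hv
      · rcases List.mem_cons.1 hy with rfl | hy
        exacts [hv, h.1 K'' hK'' y hy]

theorem fit_pairwise (l : List α) :
    (fit co l).Pairwise fun K K' => ∀ y ∈ K', ∃ x ∈ K, co y x = true := by
  induction l with
  | nil => simp [fit]
  | cons v l ih => exact insertFit_pairwise ih

/-- This is the form of maximality used for minimality: whichever class comes first, each symbol of
the other has a partner in it. Two classes therefore cannot split one exclusive block. -/
theorem fit_maximal {K K' : List α} (hK : K ∈ fit co l) (hK' : K' ∈ fit co l) (hne : K ≠ K') :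
    (∀ y ∈ K', ∃ x ∈ K, co y x = true) ∨ ∀ y ∈ K, ∃ x ∈ K', co y x = true := by
  have : Std.Symm fun K K' : List α => (∀ y ∈ K', ∃ x ∈ K, co y x = true) ∨
      ∀ y ∈ K, ∃ x ∈ K', co y x = true := ⟨fun _ _ h => h.symm⟩
  exact List.Pairwise.forall (R := fun K K' : List α => (∀ y ∈ K', ∃ x ∈ K, co y x = true) ∨
    ∀ y ∈ K, ∃ x ∈ K', co y x = true) ((fit_pairwise l).imp Or.inl) hK hK' hne

theorem length_fit_le (co : α → α → Bool) (l : List α) : (fit co l).length ≤ l.length := by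
  induction l with
  | nil => simp [fit]
  | cons v l ih =>
    have : ∀ Ks : List (List α), (insertFit co v Ks).length ≤ Ks.length + 1 := by
      intro Ks
      induction Ks with
      | nil => simp [insertFit]
      | cons K Ks ih =>
        cases h : K.any (co v) <;> simp [insertFit, h]
        exact ih
    exact (this _).trans (Nat.succ_le_succ ih)

theorem length_flatten_filter_le (p : List α → Bool) (Ks : List (List α)) :
    (Ks.filter p).flatten.length ≤ Ks.flatten.length :=
  List.Sublist.length_le (List.filter_sublist.flatten)

end Fit

variable [DecidableEq α]

/-! ## The learned expression -/

/-- Remove symbols from `X` as long as every word has a symbol of `v :: X`. -/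
def shrinkAux (avoid : List α → Bool) (v : α) (X l : List α) : List α :=
  l.foldr (fun z Y => bif avoid (v :: Y.filter (· ≠ z)) then Y else Y.filter (· ≠ z)) X

/-- A minimal list `Y ⊆ X` such that every word has a symbol of `v :: Y`. -/
def shrink (avoid : List α → Bool) (v : α) (X : List α) : List α := shrinkAux avoid v X X

/-- Extract disjoint minimal required sets from a list of symbols, the symbols left over forming
the first component. -/
def gather (avoid : List α → Bool) (l : List α) : List α × List (List α) :=
  l.foldr (fun v s => bif avoid (v :: s.1) then (v :: s.1, s.2)
    else (s.1.filter fun y => !decide (y ∈ shrink avoid v s.1), (v :: shrink avoid v s.1) :: s.2)) ([], [])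

namespace Stats

variable (st : Stats α) (syms : List α)

/-- The partition of the occurring symbols. -/
def classes : List (List α) := fit st.co (syms.filter fun a => st.co a a)

/-- A class of one symbol that may be absent and that may be repeated. -/
def free (K : List α) : Bool := K.tail.isEmpty && K.all st.many && st.avoid K

/-- The disjoint required sets and the remaining symbols among those of the free classes. -/
def gathered : List α × List (List α) :=
  gather st.avoid ((st.classes syms).filter st.free).flatten

/-- The block of an exclusive class. -/
def classBlock (K : List α) : List (α × Mult) × Mult :=
  (K.map fun a => (a, bif st.many a then .plus else .one), bif st.avoid K then .opt else .one)

end Stats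

/-- The block of a required set. -/
def reqBlock (Y : List α) : List (α × Mult) × Mult := (Y.map fun a => (a, .one), .plus)

/-- The block of an unconstrained symbol. -/
def starBlock (a : α) : List (α × Mult) × Mult := ([(a, .one)], .star)

/-- The learned expression. -/
def learn (syms : List α) (st : Stats α) : List (List (α × Mult) × Mult) :=
  ((st.classes syms).filter fun K => !st.free K).map st.classBlock ++
    ((st.gathered syms).2.map reqBlock ++ (st.gathered syms).1.map starBlock)

/-! ## Minimal required sets -/

section Gather

variable {avoid : List α → Bool}
  (hanti : ∀ {X Y : List α}, X ⊆ Y → avoid Y = true → avoid X = true)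

theorem shrinkAux_cons (v : α) (X : List α) (z : α) (l : List α) :
    shrinkAux avoid v X (z :: l) =
      bif avoid (v :: (shrinkAux avoid v X l).filter (· ≠ z)) then shrinkAux avoid v X l
      else (shrinkAux avoid v X l).filter (· ≠ z) := rfl

theorem shrinkAux_sublist (v : α) (X l : List α) : (shrinkAux avoid v X l).Sublist X := by
  induction l with
  | nil => exact List.Sublist.refl _
  | cons z l ih =>
    rw [shrinkAux_cons]
    cases avoid (v :: (shrinkAux avoid v X l).filter (· ≠ z))
    · exact List.filter_sublist.trans ih
    · exact ih

theorem avoid_shrinkAux {v : α} {X : List α} (l : List α) (h : avoid (v :: X) = false) :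
    avoid (v :: shrinkAux avoid v X l) = false := by
  induction l with
  | nil => exact h
  | cons z l ih =>
    rw [shrinkAux_cons]
    cases h' : avoid (v :: (shrinkAux avoid v X l).filter (· ≠ z))
    · exact h'
    · exact ih

include hanti in
-- One pass suffices. A symbol kept because its removal would let some word avoid the set remains
-- indispensable after further removals, as a smaller set is easier to avoid.
theorem shrinkAux_minimal {v : α} {X l : List α} {z : α} (hz : z ∈ l)
    (hz' : z ∈ shrinkAux avoid v X l) :
    avoid (v :: (shrinkAux avoid v X l).filter (· ≠ z)) = true := by
  induction l with
  | nil => simp at hz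
  | cons y l ih =>
    rw [shrinkAux_cons] at hz' ⊢
    cases h : avoid (v :: (shrinkAux avoid v X l).filter (· ≠ y)) <;>
      simp only [h, cond_true, cond_false] at hz' ⊢
    · have hzy : z ≠ y ∧ z ∈ shrinkAux avoid v X l := by
        rw [List.mem_filter] at hz'
        simpa [and_comm] using hz'
      refine hanti ?_ (ih ((List.mem_cons.1 hz).resolve_left hzy.1) hzy.2)
      exact List.cons_subset_cons _ (List.filter_sublist.filter _).subset
    · rcases List.mem_cons.1 hz with rfl | hz
      exacts [h, ih hz hz']

theorem gather_cons (v : α) (l : List α) : gather avoid (v :: l) =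
    bif avoid (v :: (gather avoid l).1) then (v :: (gather avoid l).1, (gather avoid l).2)
    else ((gather avoid l).1.filter fun y => !decide (y ∈ shrink avoid v (gather avoid l).1),
      (v :: shrink avoid v (gather avoid l).1) :: (gather avoid l).2) := rfl

theorem gather_fst_sublist (l : List α) : (gather avoid l).1.Sublist l := by
  induction l with
  | nil => exact List.Sublist.refl _
  | cons v l ih =>
    rw [gather_cons]
    cases avoid (v :: (gather avoid l).1)
    · exact (List.filter_sublist.trans ih).trans (List.sublist_cons_self _ _)
    · exact ih.cons_cons v

theorem gather_perm {l : List α} (hl : l.Nodup) :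
    ((gather avoid l).1 ++ (gather avoid l).2.flatten).Perm l := by
  induction l with
  | nil => simp [gather]
  | cons v l ih =>
    rw [List.nodup_cons] at hl
    have ih := ih hl.2
    rw [gather_cons]
    cases avoid (v :: (gather avoid l).1)
    · have hs := shrinkAux_sublist (avoid := avoid) v (gather avoid l).1 (gather avoid l).1
      have hnd := (gather_fst_sublist (avoid := avoid) l).nodup hl.2
      simp only [cond_false, List.flatten_cons, List.cons_append]
      refine List.perm_middle.trans (List.Perm.cons v ?_)
      refine List.Perm.trans ?_ ih
      rw [← List.append_assoc]
      refine List.Perm.append_right _ ?_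
      have h1 : (shrink avoid v (gather avoid l).1).Perm
          ((gather avoid l).1.filter (· ∈ shrink avoid v (gather avoid l).1)) := by
        refine (List.perm_ext_iff_of_nodup (hs.nodup hnd) (hnd.filter _)).2 fun a => ?_
        simp only [List.mem_filter, decide_eq_true_eq]
        exact ⟨fun h => ⟨hs.subset h, h⟩, fun h => h.2⟩
      refine (h1.append_left _).trans (List.perm_append_comm.trans ?_)
      simpa using List.filter_append_perm (fun a => decide (a ∈ shrink avoid v (gather avoid l).1))
        (gather avoid l).1
    · exact ih.cons v

include hanti in
-- The invariant of the extraction: some word avoids the whole pool of remaining symbols, so no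
-- required set is hidden in it.
theorem avoid_gather (h0 : avoid [] = true) (l : List α) : avoid (gather avoid l).1 = true := by
  induction l with
  | nil => exact h0
  | cons v l ih =>
    rw [gather_cons]
    cases h : avoid (v :: (gather avoid l).1)
    · exact hanti List.filter_sublist.subset ih
    · exact h

theorem gather_ne_nil {l Y : List α} (hY : Y ∈ (gather avoid l).2) : Y ≠ [] := by
  induction l with
  | nil => simp [gather] at hY
  | cons v l ih =>
    rw [gather_cons] at hY
    cases h : avoid (v :: (gather avoid l).1) <;> simp only [h, cond_true, cond_false] at hY
    · rcases List.mem_cons.1 hY with rfl | hY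
      exacts [by simp, ih hY]
    · exact ih hY

include hanti in
theorem gather_minimal (h0 : avoid [] = true) {l Y : List α} (hY : Y ∈ (gather avoid l).2) :
    avoid Y = false ∧ ∀ z ∈ Y, avoid (Y.filter (· ≠ z)) = true := by
  induction l with
  | nil => simp [gather] at hY
  | cons v l ih =>
    rw [gather_cons] at hY
    cases h : avoid (v :: (gather avoid l).1) <;> simp only [h, cond_true, cond_false] at hY
    · rcases List.mem_cons.1 hY with rfl | hY
      · refine ⟨avoid_shrinkAux _ h, fun z hz => ?_⟩
        -- Without `v` the set lies in the pool, which is avoidable by the invariant; the other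
        -- symbols are indispensable by the shrinking pass.
        by_cases hzv : z = v
        · subst hzv
          refine hanti ?_ (avoid_gather hanti h0 l)
          refine List.Subset.trans ?_ (shrinkAux_sublist (avoid := avoid) z _ (gather avoid l).1).subset
          intro y hy
          simp only [List.mem_filter, List.mem_cons, decide_eq_true_eq] at hy
          exact hy.1.resolve_left hy.2
        · have hz := (List.mem_cons.1 hz).resolve_left hzv
          refine hanti ?_ (shrinkAux_minimal hanti ((shrinkAux_sublist v _ _).subset hz) hz)
          intro y hy
          simp only [List.mem_filter, List.mem_cons, decide_eq_true_eq] at hy ⊢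
          tauto
      · exact ih hY
    · exact ih hY

end Gather

/-! ## Queries -/

section Queries

variable (avoid : List α → Bool)

/-- Later questions depend on earlier answers, so `Q` records those asked in the run on `avoid`. An
oracle that agrees on them goes through the same run. -/
theorem exists_queries_shrinkAux (v : α) (X l : List α) :
    ∃ Q : List (List α), Q.length ≤ l.length ∧ ∀ avoid' : List α → Bool,
      (∀ Y ∈ Q, avoid' Y = avoid Y) → shrinkAux avoid' v X l = shrinkAux avoid v X l := by
  induction l with
  | nil => exact ⟨[], by simp, fun _ _ => rfl⟩
  | cons z l ih =>
    obtain ⟨Q, hQ, h⟩ := ih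
    refine ⟨(v :: (shrinkAux avoid v X l).filter (· ≠ z)) :: Q, by simpa using hQ,
      fun avoid' h' => ?_⟩
    have h1 := h avoid' fun Y hY => h' Y (by simp [hY])
    rw [shrinkAux_cons, shrinkAux_cons, h1, h' _ List.mem_cons_self]

/-- A symbol costs one question and at most one shrinking pass over the pool. -/
theorem exists_queries_gather (l : List α) :
    ∃ Q : List (List α), Q.length ≤ l.length * (l.length + 1) ∧ ∀ avoid' : List α → Bool,
      (∀ Y ∈ Q, avoid' Y = avoid Y) → gather avoid' l = gather avoid l := by
  induction l with
  | nil => exact ⟨[], by simp, fun _ _ => rfl⟩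
  | cons v l ih =>
    obtain ⟨Q, hQ, h⟩ := ih
    obtain ⟨Q', hQ', h'⟩ := exists_queries_shrinkAux avoid v (gather avoid l).1 (gather avoid l).1
    refine ⟨(v :: (gather avoid l).1) :: (Q' ++ Q), ?_, fun avoid' h'' => ?_⟩
    · have := (gather_fst_sublist (avoid := avoid) l).length_le
      simp only [List.length_cons, List.length_append]
      nlinarith
    · rw [gather_cons, gather_cons, h avoid' fun Y hY => h'' Y (by simp [hY]), shrink, shrink,
        h' avoid' fun Y hY => h'' Y (by simp [hY]), h'' _ List.mem_cons_self]

/-- To the questions of the extraction are added those about the classes themselves, at most one per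
symbol. -/
theorem exists_queries_learn (syms : List α) (st : Stats α) :
    ∃ Q : List (List α), Q.length ≤ syms.length * (syms.length + 2) ∧ ∀ st' : Stats α,
      st'.many = st.many → st'.co = st.co → (∀ Y ∈ Q, st'.avoid Y = st.avoid Y) →
      learn syms st' = learn syms st := by
  obtain ⟨Q, hQ, h⟩ := exists_queries_gather st.avoid
    ((st.classes syms).filter st.free).flatten
  refine ⟨st.classes syms ++ Q, ?_, fun st' hm hc ha => ?_⟩
  · have h1 := length_fit_le st.co (syms.filter fun a => st.co a a)
    have h2 := length_flatten_filter_le st.free (st.classes syms)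
    have h3 := (fit_perm (co := st.co) (syms.filter fun a => st.co a a)).length_eq
    have h4 := List.length_filter_le (fun a => st.co a a) syms
    simp only [List.length_append]
    simp only [Stats.classes] at *
    nlinarith
  · have h1 : st'.classes syms = st.classes syms := by simp [Stats.classes, hc]
    have h2 : ∀ K ∈ st.classes syms, st'.avoid K = st.avoid K := fun K hK => ha K (by simp [hK])
    have h3 : ∀ K ∈ st.classes syms, st'.free K = st.free K := fun K hK => by
      simp [Stats.free, hm, h2 K hK]
    have h4 : (st.classes syms).filter st'.free = (st.classes syms).filter st.free :=
      List.filter_congr h3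
    have h5 : ((st.classes syms).filter fun K => !st'.free K) =
        (st.classes syms).filter fun K => !st.free K :=
      List.filter_congr fun K hK => by rw [h3 K hK]
    have h6 : st'.gathered syms = st.gathered syms := by
      rw [Stats.gathered, Stats.gathered, h1, h4, h _ fun Y hY => ha Y (by simp [hY])]
    rw [learn, learn, h6, h1, h5]
    congr 1
    refine List.map_congr_left fun K hK => ?_
    simp only [Stats.classBlock, hm, h2 K (List.mem_filter.1 hK).1]

end Queries

end Algorithm

/-! # Correctness of the learned expression -/

section Correctness

variable {α : Type} {syms : List α}

@[simp]
theorem blockSyms_classBlock (st : Stats α) (K : List α) : blockSyms (st.classBlock K) = K := by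
  simp [blockSyms, Stats.classBlock, Function.comp_def]

@[simp]
theorem blockSyms_reqBlock (Y : List α) : blockSyms (reqBlock Y) = Y := by
  simp [blockSyms, reqBlock, Function.comp_def]

@[simp]
theorem blockSyms_starBlock (a : α) : blockSyms (starBlock a) = [a] := rfl

theorem flatten_filter_perm (p : List α → Bool) (Ks : List (List α)) :
    ((Ks.filter fun K => !p K).flatten ++ (Ks.filter p).flatten).Perm Ks.flatten := by
  rw [← List.flatten_append]
  exact (List.perm_append_comm.trans (List.filter_append_perm p Ks)).flatten

theorem classes_perm (st : Stats α) :
    (st.classes syms).flatten.Perm (syms.filter fun a => st.co a a) := fit_perm _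

theorem free_iff {st : Stats α} {K : List α} (hK : K ≠ []) :
    st.free K = true ↔ ∃ a, K = [a] ∧ st.many a = true ∧ st.avoid [a] = true := by
  match K with
  | [] => exact absurd rfl hK
  | [a] => simp [Stats.free]
  | a :: b :: K => simp [Stats.free]

theorem nodup_classes (hsyms : syms.Nodup) (st : Stats α) : (st.classes syms).flatten.Nodup :=
  (classes_perm st).nodup_iff.2 (hsyms.filter _)

theorem exists_class (hall : ∀ a, a ∈ syms) {st : Stats α} {a : α} (ha : st.co a a = true) :
    ∃ K ∈ st.classes syms, a ∈ K := by
  have : a ∈ (st.classes syms).flatten :=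
    (classes_perm st).mem_iff.2 (List.mem_filter.2 ⟨hall a, by simpa using ha⟩)
  simpa using this

theorem co_of_mem_class {st : Stats α} {K : List α} (hK : K ∈ st.classes syms) {a : α}
    (ha : a ∈ K) : st.co a a = true := by
  have := (classes_perm st).mem_iff.1 (List.mem_flatten_of_mem hK ha)
  simpa using (List.mem_filter.1 this).2

/-! ## The statistics of a set of words -/

open Classical in
/-- The statistics of a set of words. -/
noncomputable def statsOf (W : Set (Word α)) : Stats α where
  many a := decide (∃ w ∈ W, 1 < w a)
  co a b := decide (∃ w ∈ W, 0 < w a ∧ 0 < w b)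
  avoid X := decide (∃ w ∈ W, ∀ x ∈ X, w x = 0)

variable {W : Set (Word α)}

@[simp]
theorem statsOf_many {a : α} : (statsOf W).many a = true ↔ ∃ w ∈ W, 1 < w a := by
  simp [statsOf]

@[simp]
theorem statsOf_co {a b : α} : (statsOf W).co a b = true ↔ ∃ w ∈ W, 0 < w a ∧ 0 < w b := by
  simp [statsOf]

@[simp]
theorem statsOf_avoid {X : List α} :
    (statsOf W).avoid X = true ↔ ∃ w ∈ W, ∀ x ∈ X, w x = 0 := by
  simp [statsOf]

theorem statsOf_avoid_eq_false {X : List α} :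
    (statsOf W).avoid X = false ↔ ∀ w ∈ W, ∃ x ∈ X, 0 < w x := by
  rw [← Bool.not_eq_true, statsOf_avoid]
  simp [Nat.pos_iff_ne_zero]

theorem statsOf_co_comm (x y : α) : (statsOf W).co x y = (statsOf W).co y x := by
  rw [Bool.eq_iff_iff, statsOf_co, statsOf_co]
  simp only [and_comm]

theorem statsOf_avoid_anti {X Y : List α} (h : X ⊆ Y) (hY : (statsOf W).avoid Y = true) :
    (statsOf W).avoid X = true := by
  rw [statsOf_avoid] at *
  obtain ⟨w, hw, hwY⟩ := hY
  exact ⟨w, hw, fun x hx => hwY x (h hx)⟩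

open Classical in
theorem exists_witnesses (L : Set (Word α)) (Φ : List (Word α → Prop)) :
    ∃ CS : Finset (Word α), ↑CS ⊆ L ∧ CS.card ≤ Φ.length ∧
      ∀ φ ∈ Φ, (∃ w ∈ L, φ w) → ∃ w ∈ CS, φ w := by
  induction Φ with
  | nil => exact ⟨∅, by simp⟩
  | cons φ Φ ih =>
    obtain ⟨CS, hCS, hcard, h⟩ := ih
    by_cases hφ : ∃ w ∈ L, φ w
    · obtain ⟨w, hw, hφw⟩ := hφ
      refine ⟨insert w CS, by simp [Set.insert_subset_iff, hw, hCS],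
        (Finset.card_insert_le _ _).trans (by simpa using hcard), fun ψ hψ hψL => ?_⟩
      rcases List.mem_cons.1 hψ with rfl | hψ
      · exact ⟨w, by simp, hφw⟩
      · obtain ⟨v, hv, hv'⟩ := h ψ hψ hψL
        exact ⟨v, by simp [hv], hv'⟩
    · refine ⟨CS, hCS, hcard.trans (by simp), fun ψ hψ hψL => ?_⟩
      rcases List.mem_cons.1 hψ with rfl | hψ
      exacts [absurd hψL hφ, h ψ hψ hψL]

/-! ## The language of the learned expression -/

variable [DecidableEq α]

theorem gathered_perm (hsyms : syms.Nodup) (st : Stats α) :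
    ((st.gathered syms).1 ++ (st.gathered syms).2.flatten).Perm
      ((st.classes syms).filter st.free).flatten :=
  gather_perm ((nodup_classes hsyms st).sublist List.filter_sublist.flatten)

theorem blockSyms_learn_perm (hsyms : syms.Nodup) (st : Stats α) :
    ((learn syms st).flatMap blockSyms).Perm (st.classes syms).flatten := by
  have h1 : (((st.classes syms).filter fun K => !st.free K).map st.classBlock).flatMap blockSyms =
      ((st.classes syms).filter fun K => !st.free K).flatten := by
    simp [List.flatMap_def, Function.comp_def]
  have h2 : ((st.gathered syms).2.map reqBlock).flatMap blockSyms =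
      (st.gathered syms).2.flatten := by
    simp [List.flatMap_def, Function.comp_def]
  have h3 : ((st.gathered syms).1.map starBlock).flatMap blockSyms = (st.gathered syms).1 := by
    simp [List.flatMap_map]
  rw [learn, List.flatMap_append, List.flatMap_append, h1, h2, h3]
  exact ((List.perm_append_comm.trans (gathered_perm hsyms st)).append_left _).trans
    (flatten_filter_perm _ _)

theorem nodup_learn (hsyms : syms.Nodup) (st : Stats α) :
    ((learn syms st).flatMap blockSyms).Nodup :=
  (blockSyms_learn_perm hsyms st).nodup_iff.2 (nodup_classes hsyms st)

theorem learn_ne_nil {st : Stats α} {b : List (α × Mult) × Mult} (hb : b ∈ learn syms st) :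
    b.1 ≠ [] := by
  simp only [learn, List.mem_append, List.mem_map] at hb
  rcases hb with ⟨K, hK, rfl⟩ | ⟨Y, hY, rfl⟩ | ⟨a, -, rfl⟩
  · simpa [Stats.classBlock] using fit_ne_nil (List.mem_filter.1 hK).1
  · simpa [reqBlock] using gather_ne_nil hY
  · simp [starBlock]

theorem class_eq (hsyms : syms.Nodup) {st : Stats α} {K K' : List α} (hK : K ∈ st.classes syms)
    (hK' : K' ∈ st.classes syms) {a : α} (ha : a ∈ K) (ha' : a ∈ K') : K = K' := by
  by_contra h
  have : Std.Symm (List.Disjoint (α := α)) := ⟨fun _ _ h => h.symm⟩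
  exact (List.nodup_flatten.1 (nodup_classes hsyms st)).2.forall hK hK' h ha ha'

theorem mem_gathered_iff (hsyms : syms.Nodup) {st : Stats α} {a : α} :
    a ∈ (st.gathered syms).1 ∨ (∃ Y ∈ (st.gathered syms).2, a ∈ Y) ↔
      [a] ∈ st.classes syms ∧ st.many a = true ∧ st.avoid [a] = true := by
  have := (gathered_perm hsyms st).mem_iff (a := a)
  rw [List.mem_append, List.mem_flatten, List.mem_flatten] at this
  rw [this]
  constructor
  · rintro ⟨K, hK, ha⟩
    rw [List.mem_filter] at hK
    obtain ⟨b, rfl, h⟩ := (free_iff (fit_ne_nil hK.1)).1 hK.2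
    obtain rfl : a = b := by simpa using ha
    exact ⟨hK.1, h⟩
  · rintro ⟨h, h'⟩
    exact ⟨[a], List.mem_filter.2 ⟨h, (free_iff (by simp)).2 ⟨a, rfl, h'⟩⟩, by simp⟩

/-- The conditions that a learned expression imposes. -/
structure LearnMem (syms : List α) (st : Stats α) (w : Word α) : Prop where
  live : ∀ a, 0 < w a → st.co a a = true
  many : ∀ a, 1 < w a → st.many a = true
  excl : ∀ K ∈ st.classes syms, ∀ x ∈ K, ∀ y ∈ K, 0 < w x → 0 < w y → x = y
  classReq : ∀ K ∈ st.classes syms, st.avoid K = false → ∃ x ∈ K, 0 < w x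
  req : ∀ Y ∈ (st.gathered syms).2, ∃ y ∈ Y, 0 < w y

/-- The conditions range over all classes although the free ones do not yield exclusive blocks. For
a free class they are void: it has one symbol and some word avoids it. -/
theorem mem_learn (hsyms : syms.Nodup) (hall : ∀ a, a ∈ syms) {st : Stats α} {w : Word α} :
    w ∈ concatLang (learn syms st) ↔ LearnMem syms st w := by
  have hbm : ∀ b, b ∈ learn syms st ↔
      (∃ K ∈ st.classes syms, st.free K = false ∧ st.classBlock K = b) ∨
      (∃ Y ∈ (st.gathered syms).2, reqBlock Y = b) ∨
      ∃ a ∈ (st.gathered syms).1, starBlock a = b := by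
    intro b
    simp only [learn, List.mem_append, List.mem_map, List.mem_filter, Bool.not_eq_true',
      and_assoc]
  have hblock : ∀ a, st.co a a = true → ∃ b ∈ learn syms st,
      BlockLive b a ∧ (st.many a = true → BlockMany b a) := by
    intro a ha
    obtain ⟨K, hK, haK⟩ := exists_class hall ha
    cases hf : st.free K
    · refine ⟨_, (hbm _).2 (.inl ⟨K, hK, hf, rfl⟩), ⟨?_, ?_⟩, fun hm => ⟨?_, .plus, ?_, ?_⟩⟩
      · simp only [Stats.classBlock]
        cases st.avoid K <;> simp
      · refine ⟨_, List.mem_map.2 ⟨a, haK, rfl⟩, ?_⟩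
        cases st.many a <;> simp
      · simp only [Stats.classBlock]
        cases st.avoid K <;> simp
      · exact List.mem_map.2 ⟨a, haK, by simp [hm]⟩
      · simp
    · obtain ⟨a', rfl, h⟩ := (free_iff (fit_ne_nil hK)).1 hf
      obtain rfl : a = a' := by simpa using haK
      rcases (mem_gathered_iff hsyms).2 ⟨hK, h⟩ with h | ⟨Y, hY, haY⟩
      · exact ⟨_, (hbm _).2 (.inr (.inr ⟨a, h, rfl⟩)), by simp [BlockLive, starBlock],
          by simp [BlockMany, starBlock]⟩
      · exact ⟨_, (hbm _).2 (.inr (.inl ⟨Y, hY, rfl⟩)), by simp [BlockLive, reqBlock, haY],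
          by simp [BlockMany, reqBlock, haY]⟩
  rw [← lang_blocksNF _ (nodup_learn hsyms st)]
  constructor
  · intro h
    refine ⟨fun a ha => ?_, fun a ha => ?_, fun K hK x hx y hy hwx hwy => ?_, fun K hK ha => ?_,
      fun Y hY => ?_⟩
    · obtain ⟨b, hb, -, m, hm, -⟩ := h.live a ha
      have : a ∈ (learn syms st).flatMap blockSyms :=
        List.mem_flatMap.2 ⟨b, hb, List.mem_map_of_mem (f := Prod.fst) hm⟩
      have := (classes_perm st).mem_iff.1 ((blockSyms_learn_perm hsyms st).mem_iff.1 this)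
      simpa using (List.mem_filter.1 this).2
    · obtain ⟨b, hb, -, m, hm, -, hpm⟩ := h.many a ha
      rcases (hbm b).1 hb with ⟨K, hK, -, rfl⟩ | ⟨Y, hY, rfl⟩ | ⟨a', ha', rfl⟩
      · simp only [Stats.classBlock, List.mem_map, Prod.mk.injEq] at hm hpm
        obtain ⟨a, -, rfl, rfl⟩ := hm
        cases hma : st.many a
        · cases hK : st.avoid K <;> simp [hma, hK] at hpm
        · rfl
      · simp only [reqBlock, List.mem_map, Prod.mk.injEq] at hm
        obtain ⟨a, haY, rfl, rfl⟩ := hm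
        exact ((mem_gathered_iff hsyms).1 (.inr ⟨Y, hY, haY⟩)).2.1
      · simp only [starBlock, List.mem_singleton, Prod.mk.injEq] at hm
        obtain ⟨rfl, rfl⟩ := hm
        exact ((mem_gathered_iff hsyms).1 (.inl ha')).2.1
    · cases hf : st.free K
      · have hb := (hbm _).2 (.inl ⟨K, hK, hf, rfl⟩)
        refine h.excl (st.classBlock K) ?_ x y ⟨hb, by simpa using hx⟩ ⟨hb, by simpa using hy⟩
          hwx hwy
        change BlockExcl _
        simp only [BlockExcl, Stats.classBlock]
        cases st.avoid K <;> simp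
      · obtain ⟨a, rfl, -⟩ := (free_iff (fit_ne_nil hK)).1 hf
        rw [List.mem_singleton] at hx hy
        rw [hx, hy]
    · have hf : st.free K = false := by simp [Stats.free, ha]
      have hb := (hbm _).2 (.inl ⟨K, hK, hf, rfl⟩)
      obtain ⟨x, hx, hwx⟩ := h.req (st.classBlock K) ⟨hb, by simp [Stats.classBlock, ha], by
        simp only [Stats.classBlock, List.mem_map]
        rintro _ ⟨a, -, rfl⟩
        cases st.many a <;> simp⟩
      exact ⟨x, by simpa using hx.2, hwx⟩
    · obtain ⟨x, hx, hwx⟩ := h.req (reqBlock Y) ⟨(hbm _).2 (.inr (.inl ⟨Y, hY, rfl⟩)),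
        by simp [reqBlock], by
          simp only [reqBlock, List.mem_map]
          rintro _ ⟨a, -, rfl⟩
          simp⟩
      exact ⟨x, by simpa using hx.2, hwx⟩
  · intro h
    refine ⟨fun a ha => ?_, fun a ha => ?_, fun b he x y hx hy hwx hwy => ?_, fun b hr => ?_⟩
    · obtain ⟨b, hb, hl, -⟩ := hblock a (h.live a ha)
      exact ⟨b, hb, hl⟩
    · obtain ⟨b, hb, -, hm⟩ := hblock a (h.live a (by omega))
      exact ⟨b, hb, hm (h.many a ha)⟩
    · replace he : BlockExcl b := he
      obtain ⟨hb, hx⟩ := hx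
      replace hy := hy.2
      rcases (hbm b).1 hb with ⟨K, hK, -, rfl⟩ | ⟨Y, hY, rfl⟩ | ⟨a', ha', rfl⟩
      · rw [blockSyms_classBlock] at hx hy
        exact h.excl K hK x hx y hy hwx hwy
      · simp [BlockExcl, reqBlock] at he
      · simp [BlockExcl, starBlock] at he
    · obtain ⟨hb, hr⟩ := hr
      rcases (hbm b).1 hb with ⟨K, hK, -, rfl⟩ | ⟨Y, hY, rfl⟩ | ⟨a', ha', rfl⟩
      · have : st.avoid K = false := by
          cases ha : st.avoid K
          · rfl
          · simp [BlockReq, Stats.classBlock, ha] at hr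
        obtain ⟨x, hx, hwx⟩ := h.classReq K hK this
        exact ⟨x, ⟨hb, by simpa using hx⟩, hwx⟩
      · obtain ⟨x, hx, hwx⟩ := h.req Y hY
        exact ⟨x, ⟨hb, by simpa using hx⟩, hwx⟩
      · simp [BlockReq, starBlock] at hr

/-! ## Minimality -/

/-- The learned expression contains the given words. -/
theorem subset_learn (hsyms : syms.Nodup) (hall : ∀ a, a ∈ syms) :
    W ⊆ concatLang (learn syms (statsOf W)) := by
  intro w hw
  rw [mem_learn hsyms hall]
  refine ⟨fun a ha => statsOf_co.2 ⟨w, hw, ha, ha⟩, fun a ha => statsOf_many.2 ⟨w, hw, ha⟩,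
    fun K hK x hx y hy hwx hwy => ?_, fun K hK ha => statsOf_avoid_eq_false.1 ha w hw,
    fun Y hY => ?_⟩
  · by_contra hxy
    have := fit_conflict statsOf_co_comm hK hx hy hxy
    rw [← Bool.not_eq_true, statsOf_co] at this
    exact this ⟨w, hw, hwx, hwy⟩
  -- The empty list is avoided only because `W` contains a word; the extraction starts from this.
  · have h0 : (statsOf W).avoid [] = true := statsOf_avoid.2 ⟨w, hw, by simp⟩
    exact statsOf_avoid_eq_false.1 (gather_minimal statsOf_avoid_anti h0 hY).1 w hw

/-- The learned expression is minimal. -/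
theorem learn_subset (hsyms : syms.Nodup) (hall : ∀ a, a ∈ syms) (hW : W.Nonempty) {I : Type}
    {N : NormalForm α I} (hWN : W ⊆ N.lang) (hN : N.lang ⊆ concatLang (learn syms (statsOf W))) :
    concatLang (learn syms (statsOf W)) ⊆ N.lang := by
  intro w hw
  rw [mem_learn hsyms hall] at hw
  set st := statsOf W with hst
  have hN : ∀ v ∈ N.lang, LearnMem syms st v := fun v hv => (mem_learn hsyms hall).1 (hN hv)
  obtain ⟨v₀, hv₀⟩ := hW
  have h0 : st.avoid [] = true := statsOf_avoid.2 ⟨v₀, hv₀, by simp⟩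
  have hlive : ∀ a, st.co a a = true → N.live a := fun a ha => by
    obtain ⟨v, hv, hva, -⟩ := statsOf_co.1 ha
    exact (hWN hv).live a hva
  have hco : ∀ v ∈ W, ∀ a, 0 < v a → st.co a a = true := fun v hv a ha =>
    statsOf_co.2 ⟨v, hv, ha, ha⟩
  have hreqlive : ∀ i, N.req i → ∃ x, N.mem i x ∧ N.live x ∧ x ∉ (∅ : Set α) := fun i hi => by
    obtain ⟨x, hx, hvx⟩ := (hWN hv₀).req i hi
    exact ⟨x, hx, (hWN hv₀).live x hvx, by simp⟩
  have hnoco : ∀ {i x y}, N.excl i → N.mem i x → N.mem i y → x ≠ y → st.co x y = false := by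
    intro i x y hi hx hy hxy
    rw [← Bool.not_eq_true, hst, statsOf_co]
    rintro ⟨v, hv, hvx, hvy⟩
    exact hxy ((hWN hv).excl i hi x y hx hy hvx hvy)
  -- different symbols of a class lie in a common exclusive block
  have hclass : ∀ {K x y}, K ∈ st.classes syms → x ∈ K → y ∈ K → x ≠ y →
      ∃ i, N.excl i ∧ N.mem i x ∧ N.mem i y := by
    intro K x y hK hx hy hxy
    by_contra hcon
    push Not at hcon
    have h1 : ∀ a ∈ ({x, y} : Set α), N.live a := by
      rintro a (rfl | rfl)
      exacts [hlive _ (co_of_mem_class hK hx), hlive _ (co_of_mem_class hK hy)]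
    have h2 : ∀ i, N.excl i → ∀ a ∈ ({x, y} : Set α), ∀ b ∈ ({x, y} : Set α),
        N.mem i a → N.mem i b → a = b := by
      rintro i hi a (rfl | rfl) b (rfl | rfl) ha hb
      exacts [rfl, absurd hb (hcon i hi ha), absurd ha (hcon i hi hb), rfl]
    -- Otherwise `N` accepts a word containing both `x` and `y`, which the learned expression
    -- forbids.
    obtain ⟨v, hv, hvT, -⟩ := N.exists_mem (X := ∅) h1 h2 (by simp) hreqlive
    exact hxy ((hN v hv).excl K hK x hx y hy (hvT x (by simp)).1 (hvT y (by simp)).1)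
  -- the occurring symbols of an exclusive block lie in a common class
  have hblock : ∀ {i K x y}, N.excl i → N.mem i x → N.mem i y → st.co y y = true →
      K ∈ st.classes syms → x ∈ K → y ∈ K := by
    intro i K x y hi hx hy hyU hK hxK
    by_contra hyK
    have hxy : x ≠ y := by rintro rfl; exact hyK hxK
    obtain ⟨K', hK', hyK'⟩ := exists_class hall hyU
    have hne : K ≠ K' := by rintro rfl; exact hyK hyK'
    -- A class that meets the exclusive block `i` lies inside it, so a symbol of `i` outside the
    -- class occurs together with none of its members. Applied to `K` and to `K'`, this contradicts
    -- the maximality of first-fit.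
    have key : ∀ {K x y}, N.mem i x → N.mem i y → K ∈ st.classes syms → x ∈ K → y ∉ K →
        ¬ ∃ z ∈ K, st.co y z = true := by
      rintro K x y hx hy hK hxK hyK ⟨z, hz, hyz⟩
      have hzi : N.mem i z := by
        by_cases hxz : x = z
        · exact hxz ▸ hx
        · obtain ⟨j, -, hjx, hjz⟩ := hclass hK hxK hz hxz
          exact N.disjoint hjx hx ▸ hjz
      have hyz' : y ≠ z := by rintro rfl; exact hyK hz
      rw [hnoco hi hy hzi hyz'] at hyz
      exact absurd hyz (by simp)
    rcases fit_maximal hK hK' hne with h | h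
    · exact key hx hy hK hxK hyK (h y hyK')
    · exact key hy hx hK' hyK' (fun h' => hne (class_eq hsyms hK hK' hxK h')) (h x hxK)
  refine ⟨fun a ha => hlive a (hw.live a ha), fun a ha => ?_, fun i hi x y hx hy hwx hwy => ?_,
    fun i hi => ?_⟩
  · obtain ⟨v, hv, hva⟩ := statsOf_many.1 (hw.many a ha)
    exact (hWN hv).many a hva
  · obtain ⟨K, hK, hxK⟩ := exists_class hall (hw.live x hwx)
    exact hw.excl K hK x hxK y (hblock hi hx hy (hw.live y hwy) hK hxK) hwx hwy
  · have hreqW : ∀ v ∈ W, ∃ x, N.mem i x ∧ 0 < v x := fun v hv => (hWN hv).req i hi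
    obtain ⟨x, hx, hvx⟩ := hreqW v₀ hv₀
    obtain ⟨K, hK, hxK⟩ := exists_class hall (hco v₀ hv₀ x hvx)
    by_cases hexi : N.excl i
    · have hKi : ∀ y ∈ K, N.mem i y := by
        intro y hy
        by_cases hxy : x = y
        · exact hxy ▸ hx
        · obtain ⟨j, -, hjx, hjy⟩ := hclass hK hxK hy hxy
          exact N.disjoint hjx hx ▸ hjy
      -- All occurring symbols of the block lie in `K`, so every word of `W` meets `K`, and the
      -- learned expression requires it.
      obtain ⟨y, hy, hwy⟩ := hw.classReq K hK (statsOf_avoid_eq_false.2 fun v hv => by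
        obtain ⟨y, hy, hvy⟩ := hreqW v hv
        exact ⟨y, hblock hexi hx hy (hco v hv y hvy) hK hxK, hvy⟩)
      exact ⟨y, hKi y hy, hwy⟩
    · by_contra hwi
      push Not at hwi
      -- Since `w` misses the non-exclusive block `i`, each occurring symbol of `i` went to the
      -- pool: alone in its class, repeatable, and not required by itself.
      have hZ : ∀ y, N.mem i y → st.co y y = true →
          y ∈ (st.gathered syms).1 ∨ ∃ Y ∈ (st.gathered syms).2, y ∈ Y := by
        intro y hy hyU
        rw [mem_gathered_iff hsyms]
        obtain ⟨Ky, hKy, hyK⟩ := exists_class hall hyU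
        have hsing : ∀ z ∈ Ky, z = y := by
          intro z hz
          by_contra hzy
          obtain ⟨j, hj, hjz, hjy⟩ := hclass hKy hz hyK hzy
          exact hexi (N.disjoint hjy hy ▸ hj)
        have hKy1 : Ky = [y] := by
          have hnd := (List.nodup_flatten.1 (nodup_classes hsyms st)).1 Ky hKy
          rw [List.eq_replicate_of_mem hsing] at hnd ⊢
          have := List.nodup_replicate.1 hnd
          have hpos := List.length_pos_of_mem hyK
          rw [show Ky.length = 1 by omega]
          rfl
        rw [hKy1] at hKy
        refine ⟨hKy, ?_, ?_⟩
        -- `N` has a word containing `y` twice; as the learned expression accepts it, `y` is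
        -- repeated in `W`.
        · obtain ⟨v, hv, hvT, -⟩ := N.exists_mem (T := {y}) (X := ∅) (by simpa using hlive y hyU)
            (by rintro j - a rfl b rfl - -; rfl) (by simp) hreqlive
          exact (hN v hv).many y ((hvT y rfl).2 (N.many_of_free hexi hy (hlive y hyU)))
        · by_contra ha
          rw [Bool.not_eq_true] at ha
          obtain ⟨z, hz, hwz⟩ := hw.classReq _ hKy ha
          rw [List.mem_singleton] at hz
          subst hz
          exact absurd hwz (by simpa using hwi z hy)
      -- A word of `W` that avoids the leftover symbols still meets block `i`, so it does so inside
      -- an extracted set `Y`.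
      have hpool : st.avoid (st.gathered syms).1 = true := avoid_gather statsOf_avoid_anti h0 _
      obtain ⟨v, hv, hvp⟩ := statsOf_avoid.1 hpool
      obtain ⟨y, hy, hvy⟩ := hreqW v hv
      obtain ⟨Y, hY, hyY⟩ := (hZ y hy (hco v hv y hvy)).resolve_left fun h => by
        have := hvp y h
        omega
      obtain ⟨hYreq, hYmin⟩ := gather_minimal statsOf_avoid_anti h0 hY
      -- `Y` contains a required block of `N`
      have : ∃ j, N.req j ∧ ∀ x, N.mem j x → N.live x → x ∈ Y := by
        by_contra hcon
        push Not at hcon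
        obtain ⟨v, hv, -, hvX⟩ := N.exists_mem (T := ∅) (X := {x | x ∈ Y}) (by simp) (by simp)
          (by simp) hcon
        obtain ⟨y, hy, hvy⟩ := (hN v hv).req Y hY
        have := hvX y hy
        omega
      obtain ⟨j, hj, hjY⟩ := this
      -- By minimality some word of `W` avoids `Y` without `z`. It meets the block `j`, and within
      -- `Y`, so it can only do so at `z`.
      have hYj : ∀ z ∈ Y, N.mem j z := by
        intro z hz
        by_contra hjz
        obtain ⟨v, hv, hvz⟩ := statsOf_avoid.1 (hYmin z hz)
        obtain ⟨x, hx, hvx⟩ := (hWN hv).req j hj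
        have := hvz x (List.mem_filter.2 ⟨hjY x hx ((hWN hv).live x hvx), by
          simp only [decide_eq_true_eq]
          rintro rfl
          exact hjz hx⟩)
        omega
      -- The blocks `j` and `i` share `y`, so `Y` lies in block `i`; but `w` meets `Y` and was
      -- assumed to miss `i`.
      obtain rfl := N.disjoint (hYj y hyY) hy
      obtain ⟨z, hz, hwz⟩ := hw.req Y hY
      have := hwi z (hYj z hz)
      omega

/-- The language of a normal form is learned from the set of all its words. -/
theorem learn_lang (hsyms : syms.Nodup) (hall : ∀ a, a ∈ syms) {I : Type}
    {N : NormalForm α I} (hN : N.lang.Nonempty) :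
    concatLang (learn syms (statsOf N.lang)) = N.lang :=
  (learn_subset hsyms hall hN subset_rfl (subset_learn hsyms hall)).antisymm
    (subset_learn hsyms hall)

/-- A small set of words from which the same expression is learned as from all words of `L`. -/
theorem exists_characteristic (L : Set (Word α)) :
    ∃ CS : Finset (Word α), ↑CS ⊆ L ∧ CS.card ≤ syms.length * (2 * syms.length + 3) ∧
      ∀ W : Set (Word α), ↑CS ⊆ W → W ⊆ L → (∀ a, a ∈ syms) →
        learn syms (statsOf W) = learn syms (statsOf L) := by
  obtain ⟨Q, hQ, h⟩ := exists_queries_learn syms (statsOf L)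
  obtain ⟨CS, hCS, hcard, hw⟩ := exists_witnesses L
    (syms.map (fun a w => 1 < w a) ++ ((syms ×ˢ syms).map (fun p w => 0 < w p.1 ∧ 0 < w p.2) ++
      Q.map fun X w => ∀ x ∈ X, w x = 0))
  -- Positive answers for `L` are witnessed in `CS`, and negative answers pass to subsets of `L`.
  -- With `n = syms.length` there are at most `n + n ^ 2 + n * (n + 2)` witnesses.
  refine ⟨CS, hCS, hcard.trans ?_, fun W hCW hWL hall => h _ ?_ ?_ ?_⟩
  · simp only [List.length_append, List.length_map, List.length_product]
    nlinarith
  · funext a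
    rw [Bool.eq_iff_iff, statsOf_many, statsOf_many]
    refine ⟨fun ⟨w, hw, h⟩ => ⟨w, hWL hw, h⟩, fun h' => ?_⟩
    obtain ⟨w, hwC, h⟩ := hw (fun w => 1 < w a) (by simp [hall]) h'
    exact ⟨w, hCW hwC, h⟩
  · funext a b
    rw [Bool.eq_iff_iff, statsOf_co, statsOf_co]
    refine ⟨fun ⟨w, hw, h⟩ => ⟨w, hWL hw, h⟩, fun h' => ?_⟩
    obtain ⟨w, hwC, h⟩ := hw (fun w => 0 < w a ∧ 0 < w b) (by
      simp only [List.mem_append, List.mem_map]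
      exact .inr (.inl ⟨(a, b), by simp [hall], rfl⟩)) h'
    exact ⟨w, hCW hwC, h⟩
  · intro X hX
    rw [Bool.eq_iff_iff, statsOf_avoid, statsOf_avoid]
    refine ⟨fun ⟨w, hw, h⟩ => ⟨w, hWL hw, h⟩, fun h' => ?_⟩
    obtain ⟨w, hwC, h⟩ := hw (fun w => ∀ x ∈ X, w x = 0) (by
      simp only [List.mem_append, List.mem_map]
      exact .inr (.inr ⟨X, hX, rfl⟩)) h'
    exact ⟨w, hCW hwC, h⟩

end Correctness

/-! # Trees -/

namespace XTree

variable {α : Type} (t : XTree α)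

/-- Gives induction in which a node may use its parent. -/
theorem wellFounded_child : WellFounded fun x y => t.child x y = true := by
  have : IsTrans (Fin t.n) (Relation.TransGen fun x y => t.child x y = true) :=
    ⟨fun _ _ _ => Relation.TransGen.trans⟩
  have : Std.Irrefl (Relation.TransGen fun x y => t.child x y = true) := ⟨t.acyclic⟩
  exact (Finite.wellFounded_of_trans_of_irrefl
    (Relation.TransGen fun x y => t.child x y = true)).mono fun _ _ h => Relation.TransGen.single h

/-- Gives induction in which a node may use its children. -/
theorem wellFounded_parent : WellFounded fun y x => t.child x y = true := by
  have : IsTrans (Fin t.n) fun y x => Relation.TransGen (fun x y => t.child x y = true) x y :=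
    ⟨fun _ _ _ h h' => h'.trans h⟩
  have : Std.Irrefl fun y x => Relation.TransGen (fun x y => t.child x y = true) x y :=
    ⟨t.acyclic⟩
  exact (Finite.wellFounded_of_trans_of_irrefl
    fun y x => Relation.TransGen (fun x y => t.child x y = true) x y).mono
      fun _ _ h => Relation.TransGen.single h

theorem reachable (m : Fin t.n) :
    Relation.ReflTransGen (fun x y => t.child x y = true) t.root m := by
  induction m using t.wellFounded_child.induction with
  | _ m ih =>
    by_cases h : m = t.root
    · exact h ▸ .refl
    · obtain ⟨p, hp, -⟩ := t.parent m h
      exact (ih p hp).tail hp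

theorem child_root (p : Fin t.n) : t.child p t.root = false := by
  rw [← Bool.not_eq_true]
  exact fun h => t.acyclic _ (Relation.TransGen.tail' (t.reachable p) h)

variable [DecidableEq α]

/-- The labels of the nodes of a tree, with the words of the labels of their children. -/
def obs (t : XTree α) : Set (α × Word α) := Set.range fun m => (t.lab m, t.childWord m)

theorem childWord_pos {t : XTree α} {m : Fin t.n} {a : α} :
    0 < t.childWord m a ↔ ∃ m', t.child m m' = true ∧ t.lab m' = a := by
  rw [childWord, Finset.card_pos]
  simp [Finset.Nonempty]

theorem satisfies_iff {S : DMS α} :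
    t.Satisfies S ↔ t.lab t.root = S.root ∧ ∀ p ∈ t.obs, p.2 ∈ (S.rule p.1).lang := by
  simp [Satisfies, obs]

open Classical in
-- Trees can thus be built on any finite type of nodes. Only the root label and the observations are
-- kept, because satisfaction of a schema depends on nothing else.
theorem exists_of_fintype {N : Type} [Fintype N] (root : N) (lab : N → α) (child : N → N → Prop)
    (acyclic : ∀ m, ¬ Relation.TransGen child m m)
    (parent : ∀ m, m ≠ root → ∃! p, child p m) :
    ∃ t : XTree α, t.lab t.root = lab root ∧ t.obs = Set.range fun m =>
      (lab m, fun a => (Finset.univ.filter fun m' => child m m' ∧ lab m' = a).card) := by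
  let e := Fintype.equivFin N
  refine ⟨⟨Fintype.card N, e root, fun m => lab (e.symm m),
    fun x y => decide (child (e.symm x) (e.symm y)), fun m h => ?_, fun m hm => ?_⟩, by simp, ?_⟩
  · refine acyclic (e.symm m) (Relation.TransGen.lift (p := child) e.symm (fun x y h => ?_) m m h)
    simpa using h
  · obtain ⟨p, hp, hu⟩ := parent (e.symm m) fun h => hm (by rw [← h]; simp)
    refine ⟨e p, by simpa using hp, fun q hq => ?_⟩
    rw [← hu (e.symm q) (by simpa using hq)]
    simp
  · unfold obs
    rw [← e.symm.surjective.range_comp]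
    congr 1
    funext m
    refine Prod.ext rfl (funext fun a => ?_)
    simp only [childWord, Function.comp_apply]
    refine Finset.card_bij (fun m' _ => e.symm m') ?_ ?_ ?_
    · simp
    · simp
    · intro m' hm'
      exact ⟨e m', by simpa using hm', by simp⟩

/-- The parent-child relation obtained by attaching trees below a new root. -/
inductive GraftChild (w : Word α) (T : α → XTree α) :
    Option (Σ c, Fin (w c) × Fin (T c).n) → Option (Σ c, Fin (w c) × Fin (T c).n) → Prop
  | root (c : α) (i : Fin (w c)) : GraftChild w T none (some ⟨c, i, (T c).root⟩)
  | sub (c : α) (i : Fin (w c)) (m m' : Fin (T c).n) (h : (T c).child m m' = true) :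
      GraftChild w T (some ⟨c, i, m⟩) (some ⟨c, i, m'⟩)

open Classical in
/-- Attaching `w c` copies of the tree `T c` below a new root with label `b`. -/
theorem exists_graft [Fintype α] (b : α) (w : Word α) (T : α → XTree α)
    (hT : ∀ c, 0 < w c → (T c).lab (T c).root = c) :
    ∃ t : XTree α, t.lab t.root = b ∧ t.obs = insert (b, w) {p | ∃ c, 0 < w c ∧ p ∈ (T c).obs} := by
  have hacyclic : ∀ x, ¬ Relation.TransGen (GraftChild w T) x x := by
    have key : ∀ c i m x, Relation.TransGen (GraftChild w T) (some ⟨c, i, m⟩) x →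
        ∃ m', x = some ⟨c, i, m'⟩ ∧
          Relation.TransGen (fun x y => (T c).child x y = true) m m' := by
      intro c i m x h
      induction h with
      | single h =>
        cases h with
        | sub _ _ _ m' h => exact ⟨m', rfl, .single h⟩
      | tail _ h ih =>
        obtain ⟨m', rfl, h'⟩ := ih
        cases h with
        | sub _ _ _ m'' h => exact ⟨m'', rfl, h'.tail h⟩
    rintro (_ | ⟨c, i, m⟩) h
    · obtain ⟨x, -, hx⟩ := Relation.TransGen.tail'_iff.1 h
      cases hx
    · obtain ⟨m', h, h'⟩ := key c i m _ h
      obtain rfl : m = m' := by simpa using h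
      exact (T c).acyclic m h'
  have hparent : ∀ x, x ≠ none → ∃! y, GraftChild w T y x := by
    rintro (_ | ⟨c, i, m⟩) hm
    · exact absurd rfl hm
    · by_cases h : m = (T c).root
      · subst h
        refine ⟨none, .root c i, ?_⟩
        intro x hx
        generalize hy : some (⟨c, i, (T c).root⟩ : Σ c, Fin (w c) × Fin (T c).n) = y at hx
        cases hx with
        | root => rfl
        | sub c' i' m m' h =>
          simp only [Option.some.injEq, Sigma.mk.injEq] at hy
          obtain ⟨rfl, hy⟩ := hy
          simp only [heq_eq_eq, Prod.mk.injEq] at hy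
          obtain ⟨rfl, rfl⟩ := hy
          rw [child_root] at h
          exact absurd h (by simp)
      · obtain ⟨p, hp, hu⟩ := (T c).parent m h
        refine ⟨some ⟨c, i, p⟩, .sub c i p m hp, ?_⟩
        intro x hx
        generalize hy : some (⟨c, i, m⟩ : Σ c, Fin (w c) × Fin (T c).n) = y at hx
        cases hx with
        | root c' i' =>
          simp only [Option.some.injEq, Sigma.mk.injEq] at hy
          obtain ⟨rfl, hy⟩ := hy
          simp only [heq_eq_eq, Prod.mk.injEq] at hy
          exact absurd hy.2 h
        | sub c' i' m₁ m' h' =>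
          simp only [Option.some.injEq, Sigma.mk.injEq] at hy
          obtain ⟨rfl, hy⟩ := hy
          simp only [heq_eq_eq, Prod.mk.injEq] at hy
          obtain ⟨rfl, rfl⟩ := hy
          rw [hu m₁ h']
  obtain ⟨t, ht, ho⟩ := exists_of_fintype (N := Option (Σ c, Fin (w c) × Fin (T c).n)) none
    (fun x => x.elim b fun p => (T p.1).lab p.2.2) (GraftChild w T) hacyclic hparent
  refine ⟨t, ht, ?_⟩
  have hnone : (fun a => (Finset.univ.filter fun m' : Option (Σ c, Fin (w c) × Fin (T c).n) =>
      GraftChild w T none m' ∧ m'.elim b (fun p => (T p.1).lab p.2.2) = a).card) = w := by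
    funext a
    have : (Finset.univ.filter fun m' : Option (Σ c, Fin (w c) × Fin (T c).n) =>
        GraftChild w T none m' ∧ m'.elim b (fun p => (T p.1).lab p.2.2) = a) =
        Finset.univ.image fun i : Fin (w a) => some ⟨a, i, (T a).root⟩ := by
      ext x
      simp only [Finset.mem_filter, Finset.mem_univ, true_and, Finset.mem_image]
      constructor
      · rintro ⟨⟨c, i⟩, h⟩
        have := hT c (Nat.zero_lt_of_lt i.2)
        simp only [Option.elim_some] at h
        obtain rfl : c = a := this.symm.trans h
        exact ⟨i, rfl⟩
      · rintro ⟨i, rfl⟩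
        exact ⟨.root a i, hT a (Nat.zero_lt_of_lt i.2)⟩
    rw [this, Finset.card_image_of_injective _ (fun i j h => by simpa using h)]
    simp
  have hsome : ∀ c i m, (fun a => (Finset.univ.filter
      fun m' : Option (Σ c, Fin (w c) × Fin (T c).n) => GraftChild w T (some ⟨c, i, m⟩) m' ∧
        m'.elim b (fun p => (T p.1).lab p.2.2) = a).card) = (T c).childWord m := by
    intro c i m
    funext a
    have : (Finset.univ.filter fun m' : Option (Σ c, Fin (w c) × Fin (T c).n) =>
        GraftChild w T (some ⟨c, i, m⟩) m' ∧ m'.elim b (fun p => (T p.1).lab p.2.2) = a) =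
        (Finset.univ.filter fun m' => (T c).child m m' = true ∧ (T c).lab m' = a).image
          fun m' => some ⟨c, i, m'⟩ := by
      ext x
      simp only [Finset.mem_filter, Finset.mem_univ, true_and, Finset.mem_image]
      constructor
      · rintro ⟨h, h'⟩
        cases h with
        | sub c i m m' h => exact ⟨m', ⟨h, h'⟩, rfl⟩
      · rintro ⟨m', ⟨h, h'⟩, rfl⟩
        exact ⟨.sub c i m m' h, h'⟩
    rw [this, Finset.card_image_of_injective _ (fun i j h => by simpa using h)]
    rfl
  rw [ho]
  ext p
  simp only [Set.mem_range, Set.mem_insert_iff, Set.mem_ofPred_eq]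
  constructor
  · rintro ⟨_ | ⟨c, i, m⟩, rfl⟩
    · left; rw [hnone]; rfl
    · right
      exact ⟨c, Nat.zero_lt_of_lt i.2, m, by rw [hsome]; rfl⟩
  · rintro (rfl | ⟨c, hc, m, rfl⟩)
    · exact ⟨none, by rw [hnone]; rfl⟩
    · exact ⟨some ⟨c, ⟨0, hc⟩, m⟩, by rw [hsome]; rfl⟩

/-! ## Replacing subtrees -/

variable [Fintype α] {R : Set (α × Word α)}

/-- The tree need not be the literal subtree: children with equal labels receive copies of one tree,
which changes nothing as far as `R` is concerned. -/
theorem exists_subtree {t : XTree α} (ht : t.obs ⊆ R) (m : Fin t.n) :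
    ∃ t' : XTree α, t'.obs ⊆ R ∧ t'.lab t'.root = t.lab m := by
  induction m using t.wellFounded_parent.induction with
  | _ m ih =>
    have : ∀ c, ∃ T : XTree α, 0 < t.childWord m c → T.obs ⊆ R ∧ T.lab T.root = c := by
      intro c
      by_cases hc : 0 < t.childWord m c
      · obtain ⟨m', hm', rfl⟩ := childWord_pos.1 hc
        obtain ⟨T, hT⟩ := ih m' hm'
        exact ⟨T, fun _ => hT⟩
      · exact ⟨t, fun h => absurd h hc⟩
    choose T hT using this
    obtain ⟨t', ht', ho⟩ := exists_graft (t.lab m) (t.childWord m) T fun c hc => (hT c hc).2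
    refine ⟨t', ?_, ht'⟩
    rw [ho, Set.insert_subset_iff]
    refine ⟨ht ⟨m, rfl⟩, ?_⟩
    rintro p ⟨c, hc, hp⟩
    exact (hT c hc).1 hp

/-- The replacement climbs from `m` to the root. Each parent is rebuilt with its own child word,
where all children sharing the label of the replaced node receive the new tree. -/
theorem exists_replace {t : XTree α} (ht : t.obs ⊆ R) (m : Fin t.n) {t₁ : XTree α}
    (ht₁ : t₁.obs ⊆ R) (h₁ : t₁.lab t₁.root = t.lab m) {p : α × Word α} (hp : p ∈ t₁.obs) :
    ∃ t' : XTree α, t'.obs ⊆ R ∧ t'.lab t'.root = t.lab t.root ∧ p ∈ t'.obs := by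
  induction m using t.wellFounded_child.induction generalizing t₁ with
  | _ m ih =>
    by_cases hm : m = t.root
    · exact ⟨t₁, ht₁, hm ▸ h₁, hp⟩
    · obtain ⟨q, hq, -⟩ := t.parent m hm
      have : ∀ c, ∃ T : XTree α, (0 < t.childWord q c → T.obs ⊆ R ∧ T.lab T.root = c) ∧
          (c = t.lab m → p ∈ T.obs) := by
        intro c
        by_cases hcm : c = t.lab m
        · exact ⟨t₁, fun _ => ⟨ht₁, hcm ▸ h₁⟩, fun _ => hp⟩
        · by_cases hc : 0 < t.childWord q c
          · obtain ⟨m', hm', rfl⟩ := childWord_pos.1 hc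
            obtain ⟨T, hT⟩ := exists_subtree ht m'
            exact ⟨T, fun _ => hT, fun h => absurd h hcm⟩
          · exact ⟨t, fun h => absurd h hc, fun h => absurd h hcm⟩
      choose T hT using this
      obtain ⟨t', ht', ho⟩ := exists_graft (t.lab q) (t.childWord q) T fun c hc => ((hT c).1 hc).2
      refine ih q hq (t₁ := t') ?_ ht' ?_
      · rw [ho, Set.insert_subset_iff]
        refine ⟨ht ⟨q, rfl⟩, ?_⟩
        rintro p' ⟨c, hc, hp'⟩
        exact ((hT c).1 hc).1 hp'
      · rw [ho]
        exact .inr ⟨t.lab m, childWord_pos.2 ⟨m, hq, rfl⟩, (hT _).2 rfl⟩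

/-- Any word of symbols that label roots of trees may be put below any node. -/
theorem exists_mem_obs {t : XTree α} (ht : t.obs ⊆ R) (m : Fin t.n) {w : Word α}
    (hw : (t.lab m, w) ∈ R)
    (hT : ∀ c, 0 < w c → ∃ T : XTree α, T.obs ⊆ R ∧ ∃ m', T.lab m' = c) :
    ∃ t' : XTree α, t'.obs ⊆ R ∧ t'.lab t'.root = t.lab t.root ∧ (t.lab m, w) ∈ t'.obs := by
  have : ∀ c, ∃ T : XTree α, 0 < w c → T.obs ⊆ R ∧ T.lab T.root = c := by
    intro c
    by_cases hc : 0 < w c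
    · obtain ⟨T, hTR, m', rfl⟩ := hT c hc
      obtain ⟨T', hT'⟩ := exists_subtree hTR m'
      exact ⟨T', fun _ => hT'⟩
    · exact ⟨t, fun h => absurd h hc⟩
  choose T hT using this
  obtain ⟨t₁, ht₁, ho⟩ := exists_graft (t.lab m) w T fun c hc => (hT c hc).2
  refine exists_replace ht m (t₁ := t₁) ?_ ht₁ ?_
  · rw [ho, Set.insert_subset_iff]
    refine ⟨hw, ?_⟩
    rintro p ⟨c, hc, hp⟩
    exact (hT c hc).1 hp
  · rw [ho]
    exact Set.mem_insert _ _

end XTree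

/-! # Learning schemas -/

section Schemas

variable {k : ℕ}

/-- The expression learned from a set of words. -/
noncomputable def learnDME (W : Set (Word (Fin k))) : DME (Fin k) where
  blocks := learn (List.finRange k) (statsOf W)
  nonempty _ := learn_ne_nil
  nodup := by
    rw [List.map_flatMap]
    exact nodup_learn (List.nodup_finRange k) _

/-- The words that occur below the nodes with label `a`. -/
def wordsAt (D : Finset (XTree (Fin k))) (a : Fin k) : Set (Word (Fin k)) :=
  {w | ∃ t ∈ D, (a, w) ∈ t.obs}

theorem mem_wordsAt {D : Finset (XTree (Fin k))} {a : Fin k} {w : Word (Fin k)} :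
    w ∈ wordsAt D a ↔ ∃ t ∈ D, ∃ m, t.lab m = a ∧ t.childWord m = w := by
  simp [wordsAt, XTree.obs]

open Classical in
/-- The schema learned from a sample. -/
noncomputable def learnDMS (D : Finset (XTree (Fin k))) : Option (DMS (Fin k)) :=
  if h : ∃ r, ∀ t ∈ D, t.lab t.root = r then
    some ⟨h.choose, fun a => learnDME (wordsAt D a)⟩
  else none

theorem learnDMS_eq_some {D : Finset (XTree (Fin k))} {r : Fin k} (hD : D.Nonempty)
    (h : ∀ t ∈ D, t.lab t.root = r) :
    learnDMS D = some ⟨r, fun a => learnDME (wordsAt D a)⟩ := by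
  have h' : ∃ r, ∀ t ∈ D, t.lab t.root = r := ⟨r, h⟩
  obtain ⟨t, ht⟩ := hD
  rw [learnDMS, dif_pos h', ← h t ht, ← h'.choose_spec t ht]

theorem learnDMS_eq_none {D : Finset (XTree (Fin k))}
    (h : ¬ ∃ r, ∀ t ∈ D, t.lab t.root = r) : learnDMS D = none := dif_neg h

theorem subset_lang_learnDME (W : Set (Word (Fin k))) : W ⊆ (learnDME W).lang :=
  subset_learn (List.nodup_finRange k) List.mem_finRange

theorem lang_learnDME_subset {W : Set (Word (Fin k))} (hW : W.Nonempty) {I : Type}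
    {N : NormalForm (Fin k) I} (hWN : W ⊆ N.lang) (hN : N.lang ⊆ (learnDME W).lang) :
    (learnDME W).lang ⊆ N.lang :=
  learn_subset (List.nodup_finRange k) List.mem_finRange hW hWN hN

theorem occurs_of_mem_learnDME {W : Set (Word (Fin k))} {w : Word (Fin k)}
    (hw : w ∈ (learnDME W).lang) {a : Fin k} (ha : 0 < w a) : ∃ v ∈ W, 0 < v a := by
  have := ((mem_learn (List.nodup_finRange k) List.mem_finRange).1 hw).live a ha
  obtain ⟨v, hv, h, -⟩ := statsOf_co.1 this
  exact ⟨v, hv, h⟩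

theorem learnDMS_eq_some_iff {D : Finset (XTree (Fin k))} (hD : D.Nonempty) {S : DMS (Fin k)} :
    learnDMS D = some S ↔
      (∀ t ∈ D, t.lab t.root = S.root) ∧ S.rule = fun a => learnDME (wordsAt D a) := by
  by_cases h : ∃ r, ∀ t ∈ D, t.lab t.root = r
  · obtain ⟨r, h⟩ := h
    rw [learnDMS_eq_some hD h]
    obtain ⟨t, ht⟩ := hD
    constructor
    · rintro ⟨⟩
      exact ⟨h, rfl⟩
    · rintro ⟨h', h''⟩
      have : r = S.root := (h t ht).symm.trans (h' t ht)
      cases S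
      simp_all
  · rw [learnDMS_eq_none h]
    simp only [reduceCtorEq, false_iff, not_and]
    exact fun h' => absurd ⟨_, h'⟩ h

theorem consistent_learnDMS {D : Finset (XTree (Fin k))} (hD : D.Nonempty) {S : DMS (Fin k)}
    (h : learnDMS D = some S) : ∀ t ∈ D, t ∈ S.lang := by
  rw [learnDMS_eq_some_iff hD] at h
  intro t ht
  refine t.satisfies_iff.2 ⟨h.1 t ht, fun p hp => ?_⟩
  rw [h.2]
  exact subset_lang_learnDME _ ⟨t, ht, hp⟩

/-- A property of labels that holds at the root and passes to children holds everywhere. -/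
theorem XTree.forall_lab {t : XTree (Fin k)} {P : Fin k → Prop} (h0 : P (t.lab t.root))
    (h : ∀ m, P (t.lab m) → ∀ c, 0 < t.childWord m c → P c) (m : Fin t.n) : P (t.lab m) := by
  induction t.reachable m with
  | refl => exact h0
  | @tail p c _ hpc ih => exact h p ih _ (XTree.childWord_pos.2 ⟨c, hpc, rfl⟩)

/-- The pairs of a label and a word allowed by a schema. -/
def DMS.allowed (S : DMS (Fin k)) : Set (Fin k × Word (Fin k)) := {p | p.2 ∈ (S.rule p.1).lang}

theorem DMS.mem_lang_iff {S : DMS (Fin k)} {t : XTree (Fin k)} :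
    t ∈ S.lang ↔ t.lab t.root = S.root ∧ t.obs ⊆ S.allowed := t.satisfies_iff

/-- Rules are compared only at labels occurring in `D`, and only on words over symbols seen below
that label in `D`. Other words allowed by `S'` may occur in no finite tree, so the inclusion of tree
languages says nothing about them. -/
theorem learnDMS_minimal {D : Finset (XTree (Fin k))} (hD : D.Nonempty) {S S' : DMS (Fin k)}
    (h : learnDMS D = some S) (hS' : ∀ t ∈ D, t ∈ S'.lang) (hSS' : S'.lang ⊆ S.lang) :
    S.lang ⊆ S'.lang := by
  rw [learnDMS_eq_some_iff hD] at h
  obtain ⟨hroot, hrule⟩ := h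
  obtain ⟨t₀, ht₀⟩ := hD
  have hDS' : ∀ t ∈ D, t.obs ⊆ S'.allowed := fun t ht => (DMS.mem_lang_iff.1 (hS' t ht)).2
  intro t ht
  -- Learned rules use only symbols that occur in the sample, so no new label appears in `t`.
  have hlab : ∀ m, ∃ t' ∈ D, ∃ m', t'.lab m' = t.lab m := by
    refine XTree.forall_lab (P := fun a => ∃ t' ∈ D, ∃ m', t'.lab m' = a) ?_ fun m _ c hc => ?_
    · exact ⟨t₀, ht₀, t₀.root, (hroot t₀ ht₀).trans ht.1.symm⟩
    · have := ht.2 m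
      rw [hrule] at this
      obtain ⟨v, hv, hvc⟩ := occurs_of_mem_learnDME this hc
      obtain ⟨t', ht', m', -, rfl⟩ := mem_wordsAt.1 hv
      obtain ⟨m'', -, h⟩ := XTree.childWord_pos.1 hvc
      exact ⟨t', ht', m'', h⟩
  refine ⟨ht.1.trans ((hroot t₀ ht₀).symm.trans (hS' t₀ ht₀).1), fun m => ?_⟩
  have hm := ht.2 m
  rw [hrule] at hm
  obtain ⟨t₁, ht₁, m₁, hm₁⟩ := hlab m
  set a := t.lab m
  set U : Set (Fin k) := {c | ∃ v ∈ wordsAt D a, 0 < v c}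
  have hsub := lang_learnDME_subset (W := wordsAt D a)
    (N := (S'.rule a).nf.restrict U) ⟨_, mem_wordsAt.2 ⟨t₁, ht₁, m₁, hm₁, rfl⟩⟩ ?_ ?_ hm
  · have := (NormalForm.mem_lang_restrict.1 hsub).1
    rwa [DME.lang_nf] at this
  · intro w hw
    rw [NormalForm.mem_lang_restrict, DME.lang_nf]
    refine ⟨?_, fun c hc => ⟨w, hw, hc⟩⟩
    obtain ⟨t', ht', hw⟩ := hw
    exact hDS' t' ht' hw
  · intro w hw
    rw [NormalForm.mem_lang_restrict, DME.lang_nf] at hw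
    -- A tree of `S'` containing `w` below the label `a` also satisfies `S`, hence `w` obeys the
    -- learned rule.
    obtain ⟨t', hobs, hr, hw'⟩ := XTree.exists_mem_obs (hDS' t₁ ht₁) m₁ (w := w)
      (by rw [hm₁]; exact hw.1) fun c hc => by
        obtain ⟨v, hv, hvc⟩ := hw.2 c hc
        obtain ⟨t', ht', m', -, rfl⟩ := mem_wordsAt.1 hv
        obtain ⟨m'', -, h⟩ := XTree.childWord_pos.1 hvc
        exact ⟨t', hDS' t' ht', m'', h⟩
    have : t' ∈ S'.lang := DMS.mem_lang_iff.2 ⟨hr.trans (hS' t₁ ht₁).1, hobs⟩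
    have := (DMS.mem_lang_iff.1 (hSS' this)).2 hw'
    rw [hm₁] at this
    simpa [DMS.allowed, hrule] using this

open Classical in
-- Only labels in `U`, those occurring in some tree of `S`, matter, and the language of `S` is
-- unchanged when its rules are restricted to symbols of `U`. Each of the at most `k` relevant rules
-- contributes its characteristic words, one tree per word.
theorem exists_characteristic_sample (S : DMS (Fin k)) (hS : S.lang.Nonempty) :
    ∃ CS : Finset (XTree (Fin k)), CS.Nonempty ∧ (∀ t ∈ CS, t ∈ S.lang) ∧
      CS.card ≤ 1 + k * (k * (2 * k + 3)) ∧
      ∀ D : Finset (XTree (Fin k)), CS ⊆ D → (∀ t ∈ D, t ∈ S.lang) →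
        ∃ S', learnDMS D = some S' ∧ S'.lang = S.lang := by
  obtain ⟨t₀, ht₀⟩ := hS
  set U : Set (Fin k) := {a | ∃ t ∈ S.lang, ∃ m, t.lab m = a} with hU
  set N := fun a => (S.rule a).nf.restrict U with hN
  have hNmem : ∀ a w, w ∈ (N a).lang ↔ w ∈ (S.rule a).lang ∧ ∀ c, 0 < w c → c ∈ U := by
    intro a w
    rw [NormalForm.mem_lang_restrict, DME.lang_nf]
  have hobsN : ∀ t ∈ S.lang, ∀ m, t.childWord m ∈ (N (t.lab m)).lang := by
    intro t ht m
    refine (hNmem _ _).2 ⟨ht.2 m, fun c hc => ?_⟩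
    obtain ⟨m', -, h⟩ := XTree.childWord_pos.1 hc
    exact ⟨t, ht, m', h⟩
  choose C hCN hCcard hC using fun a =>
    exists_characteristic (syms := List.finRange k) (N a).lang
  have htree : ∀ (a : Fin k) (w : Word (Fin k)), ∃ t : XTree (Fin k), t ∈ S.lang ∧
      (a ∈ U → w ∈ C a → (a, w) ∈ t.obs) := by
    intro a w
    by_cases h : a ∈ U ∧ w ∈ C a
    · obtain ⟨⟨t, ht, m, rfl⟩, hw⟩ := h
      have hw := (hNmem _ _).1 (hCN _ hw)
      obtain ⟨t', ho, hr, h'⟩ := XTree.exists_mem_obs (DMS.mem_lang_iff.1 ht).2 m (w := w) hw.1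
        fun c hc => by
          obtain ⟨T, hT, h⟩ := hw.2 c hc
          exact ⟨T, (DMS.mem_lang_iff.1 hT).2, h⟩
      exact ⟨t', DMS.mem_lang_iff.2 ⟨hr.trans ht.1, ho⟩, fun _ _ => h'⟩
    -- For irrelevant pairs `t₀` is a default that keeps the sample inside the language.
    · exact ⟨t₀, ht₀, fun h1 h2 => absurd ⟨h1, h2⟩ h⟩
  choose T hT hTobs using htree
  refine ⟨insert t₀ (Finset.univ.biUnion fun a => (C a).image (T a)), by simp, ?_, ?_, ?_⟩
  · intro t ht
    simp only [Finset.mem_insert, Finset.mem_biUnion, Finset.mem_univ, true_and,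
      Finset.mem_image] at ht
    rcases ht with rfl | ⟨a, w, -, rfl⟩
    exacts [ht₀, hT a w]
  · refine (Finset.card_insert_le _ _).trans ?_
    rw [add_comm]
    refine Nat.add_le_add_left ?_ 1
    refine (Finset.card_biUnion_le_card_mul _ _ (k * (2 * k + 3)) fun a _ => ?_).trans (by simp)
    exact Finset.card_image_le.trans (by simpa using hCcard a)
  · intro D hCD hD
    have ht₀D : t₀ ∈ D := hCD (by simp)
    refine ⟨_, learnDMS_eq_some ⟨t₀, ht₀D⟩ fun t ht => (hD t ht).1, ?_⟩
    -- The words of `D` below `a` lie between the characteristic words and the full restricted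
    -- language, so they yield the same expression.
    have hrule : ∀ a ∈ U, (learnDME (wordsAt D a)).lang = (N a).lang := by
      rintro a ⟨t, ht, m, rfl⟩
      have := hC (t.lab m) (wordsAt D (t.lab m)) ?_ ?_ List.mem_finRange
      · refine (congrArg concatLang this).trans ?_
        exact learn_lang (List.nodup_finRange k) List.mem_finRange ⟨_, hobsN t ht m⟩
      · intro w hw
        refine ⟨T (t.lab m) w, hCD ?_, hTobs _ _ ⟨t, ht, m, rfl⟩ hw⟩
        simp only [Finset.mem_insert, Finset.mem_biUnion, Finset.mem_univ, true_and,
          Finset.mem_image]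
        exact .inr ⟨_, w, hw, rfl⟩
      · intro w hw
        obtain ⟨t', ht', m', h1, rfl⟩ := mem_wordsAt.1 hw
        rw [← h1]
        exact hobsN t' (hD t' ht') m'
    ext t
    constructor
    · intro ht
      have hlab : ∀ m, t.lab m ∈ U := by
        refine XTree.forall_lab ⟨t₀, ht₀, t₀.root, ht₀.1.trans ht.1.symm⟩ fun m hm c hc => ?_
        have := ht.2 m
        simp only at this
        rw [hrule _ hm, hNmem] at this
        exact this.2 c hc
      refine ⟨ht.1, fun m => ?_⟩
      have := ht.2 m
      simp only at this
      rw [hrule _ (hlab m), hNmem] at this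
      exact this.1
    · intro ht
      refine ⟨ht.1, fun m => ?_⟩
      simp only
      rw [hrule _ ⟨t, ht, m, rfl⟩]
      exact hobsN t ht m

end Schemas

/-! # The learner runs in polynomial time -/

/-- Code of a list of symbols. -/
abbrev symsCode {k : ℕ} : List (Fin k) → Data := listCode symCode

theorem symsCode_le {k : ℕ} {l l' : List (Fin k)} (h : l.Sublist l') :
    (symsCode l).size ≤ (symsCode l').size :=
  Data.size_ofList_le_of_sublist (h.map _)

/-- The worst case opens a new set, which needs three cells besides the code of `v`. -/
theorem size_insertFit_le {k : ℕ} (co : Fin k → Fin k → Bool) (v : Fin k)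
    (Ks : List (List (Fin k))) : (listCode symsCode (insertFit co v Ks)).size ≤
      (listCode symsCode Ks).size + ((symCode v).size + 3) := by
  induction Ks with
  | nil =>
    simp only [insertFit, listCode, symsCode, List.map_cons, List.map_nil, Data.ofList, Data.size]
    omega
  | cons K Ks ih =>
    cases h : K.any (co v) <;>
      simp only [insertFit, h, cond_true, cond_false, listCode, symsCode, List.map_cons,
        Data.ofList, Data.size] at ih ⊢ <;> omega

/-! ### Programs for the first-fit partition and for the extraction of required sets -/

namespace Poly

variable {X : Type} {e : X → Data} {k : X → ℕ}

theorem eq_symCode {a b : ∀ x, Fin (k x)} (ha : Poly e fun x => symCode (a x))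
    (hb : Poly e fun x => symCode (b x)) : Poly e fun x => .ofBool (decide (a x = b x)) :=
  (ha.beq hb).congr fun x => by simp [symCode_injective.eq_iff, symCode]

theorem insertFit {co : ∀ x, Fin (k x) → Fin (k x) → Bool} {v : ∀ x, Fin (k x)}
    {Ks : ∀ x, List (List (Fin (k x)))}
    (hco : Poly (extCode e fun x (p : Fin (k x) × Fin (k x)) => .cons (symCode p.1) (symCode p.2))
      fun p => .ofBool (co p.1 p.2.1 p.2.2))
    (hv : Poly e fun x => symCode (v x)) (hKs : Poly e fun x => listCode symsCode (Ks x)) :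
    Poly e fun x => listCode symsCode (UnorderedXML.insertFit (co x) (v x) (Ks x)) := by
  refine listRec (F := fun x l => listCode symsCode (UnorderedXML.insertFit (co x) (v x) l)) hKs
    ((hv.cons (nil e)).cons (nil e)) ?_ ?_
  · have h := id (fun p : Σ x, List (Fin (k x)) × List (List (Fin (k x))) =>
      Data.cons (e p.1) (.cons (symsCode p.2.1) (.cons (listCode symsCode p.2.2)
        (listCode symsCode (UnorderedXML.insertFit (co p.1) (v p.1) p.2.2)))))
    have hv' := h.fst.trans (hv.reindex fun p : Σ x, List (Fin (k x)) × List (List (Fin (k x))) => p.1)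
    have hany := any (l := fun p : Σ x, List (Fin (k x)) × List (List (Fin (k x))) => p.2.1)
      (c := fun p => co p.1 (v p.1)) h.snd.fst
      ((h.fst.weaken.cons (hv'.weaken.cons (var _ _))).trans
        (hco.reindex fun q : Σ p : Σ x, List (Fin (k x)) × List (List (Fin (k x))), Fin (k p.1) =>
          ⟨q.1.1, v q.1.1, q.2⟩))
    refine (hany.cond (h.snd.fst.cons h.snd.snd.snd)
      ((hv'.cons h.snd.fst).cons h.snd.snd.fst)).congr fun p => ?_
    simp only [UnorderedXML.insertFit]
    cases p.2.1.any (co p.1 (v p.1)) <;> rfl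
  · obtain ⟨r, hr⟩ := hKs.bdd
    obtain ⟨r', hr'⟩ := hv.bdd
    refine ⟨r + (r' + 3), fun x l hl => (size_insertFit_le _ _ _).trans ?_⟩
    have h1 := hr x
    have h2 := hr' x
    have h3 := Data.size_ofList_le_of_sublist (hl.sublist.map symsCode)
    simp only [Polynomial.eval_add, Polynomial.eval_ofNat]
    simp only [listCode] at *
    omega

theorem fit {co : ∀ x, Fin (k x) → Fin (k x) → Bool} {l : ∀ x, List (Fin (k x))}
    (hco : Poly (extCode e fun x (p : Fin (k x) × Fin (k x)) => .cons (symCode p.1) (symCode p.2))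
      fun p => .ofBool (co p.1 p.2.1 p.2.2))
    (hl : Poly e fun x => symsCode (l x)) :
    Poly e fun x => listCode symsCode (UnorderedXML.fit (co x) (l x)) := by
  refine foldr (F := fun x l => listCode symsCode (UnorderedXML.fit (co x) l)) hl (nil e) ?_ ?_
  · have h := id (fun p : Σ x, Fin (k x) × List (Fin (k x)) =>
      Data.cons (.cons (e p.1) (symCode p.2.1))
        (listCode symsCode (UnorderedXML.fit (co p.1) p.2.2)))
    exact insertFit (co := fun p : Σ x, Fin (k x) × List (Fin (k x)) => co p.1)
      (((var _ _).fst.cons (var _ _).snd |> (h.fst.fst.weaken.cons ·)).trans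
        (hco.reindex fun q : Σ p : Σ x, Fin (k x) × List (Fin (k x)), Fin (k p.1) × Fin (k p.1) =>
          ⟨q.1.1, q.2⟩)) h.fst.snd h.snd
  · obtain ⟨r, hr⟩ := hl.bdd
    have hsize : ∀ {k : ℕ} (co : Fin k → Fin k → Bool) (l : List (Fin k)),
        (listCode symsCode (UnorderedXML.fit co l)).size ≤ 3 * (symsCode l).size := by
      intro k co l
      induction l with
      | nil => simp [UnorderedXML.fit, symsCode, listCode, Data.ofList, Data.size]
      | cons v l ih =>
        have := size_insertFit_le co v (UnorderedXML.fit co l)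
        have hpos := (symCode v).size_pos
        change (listCode symsCode (UnorderedXML.insertFit co v (UnorderedXML.fit co l))).size ≤ _
        simp only [symsCode, listCode, List.map_cons, Data.ofList, Data.size] at ih this ⊢
        omega
    refine ⟨3 * r, fun x l' hl' => (hsize _ _).trans ?_⟩
    simp only [Polynomial.eval_mul, Polynomial.eval_ofNat]
    exact Nat.mul_le_mul le_rfl ((symsCode_le hl'.sublist).trans (hr x))

theorem shrinkAux {avoid : ∀ x, List (Fin (k x)) → Bool} {v : ∀ x, Fin (k x)}
    {Y l : ∀ x, List (Fin (k x))}
    (hav : Poly (extCode e fun _ => symsCode) fun p => .ofBool (avoid p.1 p.2))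
    (hv : Poly e fun x => symCode (v x)) (hY : Poly e fun x => symsCode (Y x))
    (hl : Poly e fun x => symsCode (l x)) :
    Poly e fun x => symsCode (UnorderedXML.shrinkAux (avoid x) (v x) (Y x) (l x)) := by
  refine foldr (F := fun x l => symsCode (UnorderedXML.shrinkAux (avoid x) (v x) (Y x) l))
    hl hY ?_ ?_
  · have h := id (fun p : Σ x, Fin (k x) × List (Fin (k x)) =>
      Data.cons (.cons (e p.1) (symCode p.2.1))
        (symsCode (UnorderedXML.shrinkAux (avoid p.1) (v p.1) (Y p.1) p.2.2)))
    have hv' := h.fst.fst.trans (hv.reindex fun p : Σ x, Fin (k x) × List (Fin (k x)) => p.1)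
    have hf := filter (X := Σ x, Fin (k x) × List (Fin (k x)))
      (l := fun p => UnorderedXML.shrinkAux (avoid p.1) (v p.1) (Y p.1) p.2.2)
      (c := fun p y => !decide (y = p.2.1)) h.snd
      (eq_symCode (b := fun q : Σ p : Σ x, Fin (k x) × List (Fin (k x)), Fin (k p.1) => q.1.2.1)
        (var _ _) h.fst.snd.weaken).not
    have hc := (h.fst.fst.cons (hv'.cons hf)).trans (hav.reindex
      fun p : Σ x, Fin (k x) × List (Fin (k x)) => ⟨p.1, v p.1 ::
        (UnorderedXML.shrinkAux (avoid p.1) (v p.1) (Y p.1) p.2.2).filter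
          fun y => !decide (y = p.2.1)⟩)
    refine (hc.cond h.snd hf).congr fun p => ?_
    simp only [shrinkAux_cons, ne_eq, decide_not]
    cases avoid p.1 (v p.1 :: (UnorderedXML.shrinkAux (avoid p.1) (v p.1) (Y p.1) p.2.2).filter
      fun y => !decide (y = p.2.1)) <;> rfl
  · obtain ⟨r, hr⟩ := hY.bdd
    exact ⟨r, fun x l' _ => (symsCode_le (shrinkAux_sublist _ _ _)).trans (hr x)⟩

theorem gather {avoid : ∀ x, List (Fin (k x)) → Bool} {l : ∀ x, List (Fin (k x))}
    (hav : Poly (extCode e fun _ => symsCode) fun p => .ofBool (avoid p.1 p.2))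
    (hl : Poly e fun x => symsCode (l x)) :
    Poly e fun x => .cons (symsCode (UnorderedXML.gather (avoid x) (l x)).1)
      (listCode symsCode (UnorderedXML.gather (avoid x) (l x)).2) := by
  refine foldr (F := fun x l => .cons (symsCode (UnorderedXML.gather (avoid x) l).1)
      (listCode symsCode (UnorderedXML.gather (avoid x) l).2)) hl ((nil e).cons (nil e)) ?_ ?_
  · have h := id (fun p : Σ x, Fin (k x) × List (Fin (k x)) =>
      Data.cons (.cons (e p.1) (symCode p.2.1))
        (.cons (symsCode (UnorderedXML.gather (avoid p.1) p.2.2).1)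
          (listCode symsCode (UnorderedXML.gather (avoid p.1) p.2.2).2)))
    have hav' : Poly (extCode _ fun p : Σ x, Fin (k x) × List (Fin (k x)) => symsCode) _ :=
      (h.fst.fst.weaken.cons (var _ _)).trans (hav.reindex
        fun q : Σ p : Σ x, Fin (k x) × List (Fin (k x)), List (Fin (k p.1)) => ⟨q.1.1, q.2⟩)
    have hs := shrinkAux (avoid := fun p : Σ x, Fin (k x) × List (Fin (k x)) => avoid p.1)
      hav' h.fst.snd h.snd.fst h.snd.fst
    have hf := filter (X := Σ x, Fin (k x) × List (Fin (k x)))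
      (l := fun p => (UnorderedXML.gather (avoid p.1) p.2.2).1)
      (c := fun p y => !decide (y ∈ UnorderedXML.shrinkAux (avoid p.1) p.2.1
        (UnorderedXML.gather (avoid p.1) p.2.2).1 (UnorderedXML.gather (avoid p.1) p.2.2).1))
      h.snd.fst (mem (l := fun q : Σ p : Σ x, Fin (k x) × List (Fin (k x)), Fin (k p.1) =>
        UnorderedXML.shrinkAux (avoid q.1.1) q.1.2.1 (UnorderedXML.gather (avoid q.1.1) q.1.2.2).1
          (UnorderedXML.gather (avoid q.1.1) q.1.2.2).1)
        (fun _ => symCode_injective) (var _ _) hs.weaken).not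
    have hc := hav'.subst (b := fun p : Σ x, Fin (k x) × List (Fin (k x)) =>
      p.2.1 :: (UnorderedXML.gather (avoid p.1) p.2.2).1) (h.fst.snd.cons h.snd.fst)
    refine (hc.cond ((h.fst.snd.cons h.snd.fst).cons h.snd.snd)
      (hf.cons ((h.fst.snd.cons hs).cons h.snd.snd))).congr fun p => ?_
    simp only [gather_cons, shrink]
    cases avoid p.1 (p.2.1 :: (UnorderedXML.gather (avoid p.1) p.2.2).1) <;> rfl
  · obtain ⟨r, hr⟩ := hl.bdd
    -- The pair of empty lists has size 3. A step either adds one symbol to the pool or moves pool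
    -- symbols into one new set, whose code is no larger than that of the list.
    refine bdd_suffix (r := 3 + (1 + r)) hl ?_ fun x v l' hl' => ?_
    · simp only [UnorderedXML.gather, List.foldr_nil, listCode, symsCode, List.map_nil,
        Data.ofList, Data.size, Polynomial.eval_add, Polynomial.eval_ofNat, Polynomial.eval_one]
      omega
    · have h1 : (symsCode (l x)).size ≤ _ := hr x
      have h2 := symsCode_le hl'.sublist
      have h3 := symsCode_le ((gather_fst_sublist (avoid := avoid x) l').cons_cons v)
      have h4 := symsCode_le ((shrinkAux_sublist (avoid := avoid x) v
        (UnorderedXML.gather (avoid x) l').1 (UnorderedXML.gather (avoid x) l').1).cons_cons v)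
      have h5 := symsCode_le (List.filter_sublist (l := (UnorderedXML.gather (avoid x) l').1)
        (p := fun y => !decide (y ∈ shrink (avoid x) v (UnorderedXML.gather (avoid x) l').1)))
      rw [gather_cons]
      cases avoid x (v :: (UnorderedXML.gather (avoid x) l').1) <;>
      simp only [cond_true, cond_false, Data.size, Polynomial.eval_add, Polynomial.eval_one,
        Polynomial.eval_ofNat, listCode, List.map_cons, Data.ofList, shrink, symsCode] at * <;>
      omega

end Poly

/-- Code of a block. -/
def blockCode {k : ℕ} (b : List (Fin k × Mult) × Mult) : Data :=
  .cons (.ofList (b.1.map fun p => .cons (.ofNat p.1) p.2.code)) b.2.code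

namespace Poly

variable {X : Type} {e : X → Data} {k : X → ℕ} {st : ∀ x, Stats (Fin (k x))}

theorem learn
    (hmany : Poly (extCode e fun _ => symCode) fun p => .ofBool ((st p.1).many p.2))
    (hco : Poly (extCode e fun x (p : Fin (k x) × Fin (k x)) => .cons (symCode p.1) (symCode p.2))
      fun p => .ofBool ((st p.1).co p.2.1 p.2.2))
    (hav : Poly (extCode e fun _ => symsCode) fun p => .ofBool ((st p.1).avoid p.2))
    {l : ∀ x, List (Fin (k x))} (hl : Poly e fun x => symsCode (l x)) :
    Poly e fun x => listCode blockCode (UnorderedXML.learn (l x) (st x)) := by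
  have hclasses : Poly e fun x => listCode symsCode ((st x).classes (l x)) :=
    fit hco (filter (c := fun x a => (st x).co a a) hl
      ((((id _).fst.cons ((id _).snd.cons (id _).snd))).trans (hco.reindex
        fun p : Σ x, Fin (k x) => ⟨p.1, p.2, p.2⟩)))
  have hall : Poly (extCode e fun _ => symsCode) fun p : Σ x, List (Fin (k x)) =>
      .ofBool (p.2.all (st p.1).many) :=
    all (X := Σ x, List (Fin (k x))) (l := fun p => p.2) (c := fun p => (st p.1).many) (var _ _)
      ((weaken (id _).fst).cons (var _ _) |>.trans (hmany.reindex
        fun q : Σ p : Σ x, List (Fin (k x)), Fin (k p.1) => ⟨q.1.1, q.2⟩))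
  have hfree : Poly (extCode e fun _ => symsCode) fun p => .ofBool ((st p.1).free p.2) := by
    have htail : Poly (extCode e fun _ => symsCode) fun p : Σ x, List (Fin (k x)) =>
        .ofBool p.2.tail.isEmpty := by
      refine ((var e _).tl.beq (nil _)).congr fun p => ?_
      congr 1
      rcases p.2 with _ | ⟨a, _ | ⟨b, l⟩⟩ <;> rfl
    exact (htail.and hall).and hav
  have hgath : Poly e fun x => .cons (symsCode ((st x).gathered (l x)).1)
      (listCode symsCode ((st x).gathered (l x)).2) := by
    refine gather hav ?_
    refine (flatten (l := fun x => (((st x).classes (l x)).filter (st x).free).map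
      fun K => K.map symCode) ?_).congr fun x => ?_
    · refine (filter (c := fun x => (st x).free) hclasses hfree).congr fun x => ?_
      simp only [listCode, List.map_map]
      rfl
    · simp only [listCode, symsCode, List.map_flatten]
  have hblock : Poly (extCode e fun _ => symsCode) fun p => blockCode ((st p.1).classBlock p.2) := by
    have hsym : Poly (extCode e fun _ => symCode) fun p =>
        .cons (symCode p.2) (bif (st p.1).many p.2 then Mult.plus.code else Mult.one.code) :=
      (var _ _).cons (hmany.cond (const _ _) (const _ _))
    refine ((map (X := Σ x, List (Fin (k x))) (enc := fun _ => symCode) (l := fun p => p.2)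
      (F := fun p a => .cons (symCode a)
        (bif (st p.1).many a then Mult.plus.code else Mult.one.code)) (var e fun _ => symsCode)
      (((weaken (id _).fst).cons (var _ fun _ => symCode)).trans (hsym.reindex
        fun q : Σ p : Σ x, List (Fin (k x)), Fin (k p.1) => ⟨q.1.1, q.2⟩))).cons
      (hav.cond (const _ Mult.opt.code) (const _ Mult.one.code))).congr fun p => ?_
    simp only [blockCode, Stats.classBlock, listCode, List.map_map]
    congr 1
    · congr 2
      funext a
      simp only [Function.comp_apply]
      cases (st p.1).many a <;> rfl
    · cases (st p.1).avoid p.2 <;> rfl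
  have hreq : Poly (extCode e fun _ => symsCode) fun p : Σ x, List (Fin (k x)) =>
      blockCode (reqBlock p.2) := by
    refine ((map (X := Σ x, List (Fin (k x))) (l := fun p => p.2)
      (F := fun p a => .cons (symCode a) Mult.one.code) (var _ _)
        ((var _ _).cons (const _ _))).cons (const _ Mult.plus.code)).congr fun p => ?_
    simp only [blockCode, reqBlock, listCode, List.map_map]
    rfl
  have hstar : Poly (extCode e fun _ => symCode) fun p : Σ x, Fin (k x) =>
      blockCode (starBlock p.2) :=
    ((((var _ _).cons (const _ Mult.one.code)).cons (nil _)).cons (const _ Mult.star.code))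
  refine (append (map (F := fun x K => blockCode ((st x).classBlock K))
    (filter (c := fun x K => !(st x).free K) hclasses hfree.not) hblock)
    (append (map (F := fun x K => blockCode (reqBlock K)) hgath.snd hreq)
      (map (F := fun x a => blockCode (starBlock a)) hgath.fst hstar))).congr fun x => ?_
  simp only [UnorderedXML.learn, listCode, List.map_append, List.map_map]
  rfl

end Poly

/-! ## Statistics of a list of words -/

section ListStats

variable {α : Type} [DecidableEq α]

/-- The statistics of a list of words, each given by the list of its symbols. -/
def listStats (W : List (List α)) : Stats α where
  many a := W.any fun l => !(l.filter fun b => decide (b = a)).tail.isEmpty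
  co a b := W.any fun l => decide (a ∈ l) && decide (b ∈ l)
  avoid X := W.any fun l => X.all fun x => !decide (x ∈ l)

/-- A symbol is repeated exactly when the list of its occurrences has a nonempty tail. -/
theorem listStats_eq (W : List (List α)) :
    listStats W = statsOf {w | ∃ l ∈ W, w = fun a => l.count a} := by
  have h : ∀ φ : Word α → Prop, (∃ w ∈ {w : Word α | ∃ l ∈ W, w = fun a => l.count a}, φ w) ↔
      ∃ l ∈ W, φ fun a => l.count a := by
    intro φ
    constructor
    · rintro ⟨_, ⟨l, hl, rfl⟩, h⟩
      exact ⟨l, hl, h⟩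
    · rintro ⟨l, hl, h⟩
      exact ⟨_, ⟨l, hl, rfl⟩, h⟩
  have h1 : ∀ (l : List α) a, l.count a = (l.filter fun b => decide (b = a)).length := by
    intro l a
    rw [List.count_eq_length_filter]
    rfl
  have h2 : ∀ (l : List α) a, 0 < l.count a ↔ a ∈ l := fun l a => List.count_pos_iff
  have hext : ∀ {s s' : Stats α}, (∀ a, s.many a = true ↔ s'.many a = true) →
      (∀ a b, s.co a b = true ↔ s'.co a b = true) →
      (∀ X, s.avoid X = true ↔ s'.avoid X = true) → s = s' := by
    rintro ⟨m, c, v⟩ ⟨m', c', v'⟩ h1 h2 h3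
    congr 1
    · exact funext fun a => Bool.eq_iff_iff.2 (h1 a)
    · exact funext fun a => funext fun b => Bool.eq_iff_iff.2 (h2 a b)
    · exact funext fun X => Bool.eq_iff_iff.2 (h3 X)
  refine hext (fun a => ?_) (fun a b => ?_) fun X => ?_
  · rw [statsOf_many, h fun w => 1 < w a]
    simp only [listStats, List.any_eq_true, h1]
    refine exists_congr fun l => and_congr_right fun _ => ?_
    rcases l.filter (fun b => decide (b = a)) with _ | ⟨b, _ | ⟨c, m⟩⟩ <;> simp
  · rw [statsOf_co, h fun w => 0 < w a ∧ 0 < w b]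
    simp [listStats, h2]
  · rw [statsOf_avoid, h fun w => ∀ x ∈ X, w x = 0]
    simp [listStats, List.count_eq_zero]

end ListStats

namespace Poly

variable {X : Type} {e : X → Data} {k : X → ℕ}

theorem learn_listStats {W : ∀ x, List (List (Fin (k x)))}
    (hk : Poly e fun x => .ofNat (k x)) (hW : Poly e fun x => listCode symsCode (W x)) :
    Poly e fun x => listCode blockCode
      (UnorderedXML.learn (List.finRange (k x)) (listStats (W x))) := by
  refine learn (st := fun x => listStats (W x)) ?_ ?_ ?_ (finRange hk)
  · refine any (X := Σ x, Fin (k x)) (l := fun p => W p.1)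
      (c := fun p l => !(l.filter fun b => decide (b = p.2)).tail.isEmpty) hW.weaken (not ?_)
    have hf := filter (X := Σ p : Σ x, Fin (k x), List (Fin (k p.1)))
      (e := extCode (extCode e fun _ => symCode) fun p => symsCode) (l := fun q => q.2)
      (c := fun q b => decide (b = q.1.2)) (var _ _)
      (eq_symCode (b := fun r : Σ q : Σ p : Σ x, Fin (k x), List (Fin (k p.1)), Fin (k q.1.1) =>
        r.1.1.2) (var _ _) (var _ _).weaken.weaken)
    refine (hf.tl.beq (nil _)).congr fun q => ?_
    congr 1
    rcases q.2.filter (fun b => decide (b = q.1.2)) with _ | ⟨b, _ | ⟨c, m⟩⟩ <;>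
      simp [listCode, Data.ofList, Data.tl]
  · refine any (X := Σ x, Fin (k x) × Fin (k x)) (l := fun p => W p.1)
      (c := fun p l => decide (p.2.1 ∈ l) && decide (p.2.2 ∈ l)) hW.weaken (and ?_ ?_)
    · exact mem (a := fun q : Σ p : Σ x, Fin (k x) × Fin (k x), List (Fin (k p.1)) => q.1.2.1)
        (fun _ => symCode_injective) (id _).fst.snd.fst (var _ _)
    · exact mem (a := fun q : Σ p : Σ x, Fin (k x) × Fin (k x), List (Fin (k p.1)) => q.1.2.2)
        (fun _ => symCode_injective) (id _).fst.snd.snd (var _ _)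
  · refine any (X := Σ x, List (Fin (k x))) (l := fun p => W p.1)
      (c := fun p l => p.2.all fun x => !decide (x ∈ l)) hW.weaken ?_
    refine all (X := Σ p : Σ x, List (Fin (k x)), List (Fin (k p.1))) (l := fun q => q.1.2)
      (c := fun q x => !decide (x ∈ q.2)) (var _ _).weaken (not ?_)
    exact mem (l := fun r : Σ q : Σ p : Σ x, List (Fin (k x)), List (Fin (k p.1)), Fin (k q.1.1) =>
      r.1.2) (fun _ => symCode_injective) (var _ _) (var _ _).weaken

end Poly

/-! ## Reading trees -/

namespace XTree

variable {k : ℕ}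

/-- The labels of the children of the node `m`. -/
def childList (t : XTree (Fin k)) (m : Fin t.n) : List (Fin k) :=
  ((List.finRange t.n).filter (t.child m)).map t.lab

theorem count_childList (t : XTree (Fin k)) (m : Fin t.n) (a : Fin k) :
    (t.childList m).count a = t.childWord m a := by
  rw [childList, List.count_eq_countP, List.countP_map, List.countP_filter,
    List.countP_eq_length_filter, childWord, ← List.toFinset_card_of_nodup
      ((List.nodup_finRange _).filter _)]
  congr 1
  ext m'
  simp [and_comm]

/-- Code of a node, as listed in the code of the tree. -/
abbrev nodeCode (t : XTree (Fin k)) (m : Fin t.n) : Data := .cons (symCode m) (symCode (t.lab m))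

end XTree

/-- The words below the nodes with label `a`, for all trees of a list. -/
def wordList {k : ℕ} (l : List (XTree (Fin k))) (a : Fin k) : List (List (Fin k)) :=
  l.flatMap fun t => ((List.finRange t.n).filter fun m => decide (t.lab m = a)).map t.childList

/-- Statistics depend only on the set of words, so the order and repetitions of the listed trees are
irrelevant. -/
theorem listStats_wordList {k : ℕ} {D : Finset (XTree (Fin k))} {l : List (XTree (Fin k))}
    (h : ∀ t, t ∈ l ↔ t ∈ D) (a : Fin k) :
    listStats (wordList l a) = statsOf (wordsAt D a) := by
  rw [listStats_eq]
  congr 1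
  ext w
  simp only [wordList, mem_wordsAt, Set.mem_ofPred_eq, List.mem_flatMap, List.mem_map,
    List.mem_filter, List.mem_finRange, true_and, decide_eq_true_eq, h]
  constructor
  · rintro ⟨_, ⟨t, ht, m, hm, rfl⟩, rfl⟩
    exact ⟨t, ht, m, hm, funext fun b => (t.count_childList m b).symm⟩
  · rintro ⟨t, ht, m, hm, rfl⟩
    exact ⟨_, ⟨t, ht, m, hm, rfl⟩, funext fun b => (t.count_childList m b).symm⟩

namespace Poly

variable {X : Type} {e : X → Data} {k : X → ℕ} {t : ∀ x, XTree (Fin (k x))}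

theorem nodes (ht : Poly e fun x => (t x).code) :
    Poly e fun x => listCode (t x).nodeCode (List.finRange (t x).n) := ht.snd.fst

theorem rootLabel (ht : Poly e fun x => (t x).code) :
    Poly e fun x => symCode ((t x).lab (t x).root) := by
  -- The root label is looked up by filtering the node list for the number of the root.
  have h := filter (β := fun x => Fin (t x).n) (c := fun x m => decide (m = (t x).root)) ht.nodes
    (eq_symCode (X := Σ x, Fin (t x).n) (k := fun p => (t p.1).n) (b := fun p => (t p.1).root)
      (var _ fun x => (t x).nodeCode).fst ht.fst.weaken)
  refine h.hd.tl.congr fun x => ?_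
  have : (List.finRange (t x).n).filter (fun m => decide (m = (t x).root)) = [(t x).root] := by
    have h1 := List.filter_eq (l := List.finRange (t x).n) (t x).root
    rwa [List.count_eq_one_of_mem (List.nodup_finRange _) (List.mem_finRange (t x).root)] at h1
  rw [this]
  rfl

theorem childList {m : ∀ x, Fin (t x).n} (ht : Poly e fun x => (t x).code)
    (hm : Poly e fun x => symCode (m x)) : Poly e fun x => symsCode ((t x).childList (m x)) := by
  have hc : Poly (extCode e fun x => (t x).nodeCode) fun p =>
      .ofBool ((t p.1).child (m p.1) p.2) := by
    refine (mem (X := Σ x, Fin (t x).n) (β := fun p => Fin (t p.1).n × Fin (t p.1).n)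
      (enc := fun _ q => .cons (symCode q.1) (symCode q.2)) (a := fun p => (m p.1, p.2))
      (l := fun p => (List.finRange (t p.1).n ×ˢ List.finRange (t p.1).n).filter
        fun q => (t p.1).child q.1 q.2) ?_
      (hm.weaken.cons (var _ fun x => (t x).nodeCode).fst) ht.snd.snd.weaken).congr fun p => ?_
    · rintro p ⟨a, b⟩ ⟨a', b'⟩ h
      simp only [Data.cons.injEq, symCode_injective.eq_iff] at h
      rw [h.1, h.2]
    · congr 1
      rw [Bool.eq_iff_iff]
      simp
  refine (map (F := fun x m' => symCode ((t x).lab m'))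
    (filter (c := fun x => (t x).child (m x)) ht.nodes hc)
    (var _ fun x => (t x).nodeCode).snd).congr fun x => ?_
  simp only [XTree.childList, listCode, symsCode, List.map_map]
  rfl

theorem wordList {l : ∀ x, List (XTree (Fin (k x)))} {a : ∀ x, Fin (k x)}
    (hl : Poly e fun x => listCode XTree.code (l x)) (ha : Poly e fun x => symCode (a x)) :
    Poly e fun x => listCode symsCode (UnorderedXML.wordList (l x) (a x)) := by
  have ht := var e fun x => XTree.code (k := k x)
  have hlab := filter (X := Σ x, XTree (Fin (k x))) (β := fun p => Fin p.2.n)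
    (c := fun p m => decide (p.2.lab m = a p.1)) (nodes (X := Σ x, XTree (Fin (k x))) (k := fun p => k p.1)
      (t := fun p => p.2) ht)
    (eq_symCode (X := Σ p : Σ x, XTree (Fin (k x)), Fin p.2.n) (k := fun q => k q.1.1)
      (b := fun q => a q.1.1)
      (var _ fun p : Σ x, XTree (Fin (k x)) => p.2.nodeCode).snd ha.weaken.weaken)
  have hwords := map (F := fun p m => symsCode (p.2.childList m)) hlab
    (childList (X := Σ p : Σ x, XTree (Fin (k x)), Fin p.2.n) (k := fun q => k q.1.1)
      (t := fun q => q.1.2) (m := fun q => q.2) ht.weaken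
      (var _ fun p : Σ x, XTree (Fin (k x)) => p.2.nodeCode).fst)
  refine (flatMap (F := fun x t => ((List.finRange t.n).filter
    fun m => decide (t.lab m = a x)).map fun m => symsCode (t.childList m)) hl hwords).congr
    fun x => ?_
  simp only [UnorderedXML.wordList, listCode, List.map_flatMap, List.map_map]
  rfl

end Poly

/-- Lists of trees over some finite alphabet. -/
abbrev TreeList : Type := Σ k, {l : List (XTree (Fin k)) // l ≠ []}

/-- Code of a list of trees and its alphabet. -/
def TreeList.code (x : TreeList) : Data := .cons (.ofNat x.1) (listCode XTree.code x.2.1)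

open Classical in
theorem exists_program : ∃ P q, ∀ x : TreeList, ∀ D : Finset (XTree (Fin x.1)),
    (∀ t, t ∈ x.2.1 ↔ t ∈ D) →
      ∃ s, Runs P x.code (.ofOption ((learnDMS D).map DMS.code)) s ∧
        s ≤ Polynomial.eval x.code.size q := by
  have hk : Poly TreeList.code fun x => .ofNat x.1 := (Poly.id _).fst
  have hl : Poly TreeList.code fun x => listCode XTree.code x.2.1 := (Poly.id _).snd
  let hdt : ∀ x : TreeList, XTree (Fin x.1) := fun x => x.2.1.head x.2.2
  have hhd : Poly TreeList.code fun x => (hdt x).code := by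
    refine hl.hd.congr fun x => ?_
    obtain ⟨k, l, hl⟩ := x
    cases l with
    | nil => exact absurd rfl hl
    | cons t l => rfl
  have hroot := hhd.rootLabel
  have hall := Poly.all (c := fun x t => decide (t.lab t.root = (hdt x).lab (hdt x).root)) hl
    (Poly.eq_symCode (X := Σ x : TreeList, XTree (Fin x.1)) (k := fun p => p.1.1)
      (b := fun p => (hdt p.1).lab (hdt p.1).root)
      (Poly.rootLabel (X := Σ x : TreeList, XTree (Fin x.1)) (k := fun p => p.1.1)
        (t := fun p => p.2) (Poly.var _ _)) hroot.weaken)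
  have hrules := Poly.map (β := fun x : TreeList => Fin x.1) (enc := fun _ => symCode)
    (F := fun x a => listCode blockCode
      (learn (List.finRange x.1) (listStats (wordList x.2.1 a)))) hk.finRange
    (Poly.learn_listStats (X := Σ x : TreeList, Fin x.1) (k := fun p => p.1.1)
      (W := fun p => wordList p.1.2.1 p.2) hk.weaken
      (Poly.wordList (X := Σ x : TreeList, Fin x.1) (k := fun p => p.1.1)
        (l := fun p => p.1.2.1) (a := fun p => p.2) hl.weaken (Poly.var _ _)))
  -- All roots are compared with that of the first listed tree; on disagreement the output is `nil`,
  -- the code of null.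
  obtain ⟨P, q, h⟩ := hall.cond ((Poly.nil _).cons (hroot.cons hrules)) (Poly.nil _)
  refine ⟨P, q, fun x D hD => ?_⟩
  obtain ⟨s, hs, hsq⟩ := h x
  refine ⟨s, ?_, hsq⟩
  convert hs using 1
  have hmem : hdt x ∈ D := (hD _).1 (List.head_mem _)
  dsimp only
  by_cases hr : ∀ t ∈ D, t.lab t.root = (hdt x).lab (hdt x).root
  · have h1 : x.2.1.all (fun t => decide (t.lab t.root = (hdt x).lab (hdt x).root)) = true := by
      simpa [hD] using hr
    rw [h1, learnDMS_eq_some ⟨_, hmem⟩ hr]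
    simp only [listStats_wordList hD]
    rfl
  · have h1 : x.2.1.all (fun t => decide (t.lab t.root = (hdt x).lab (hdt x).root)) = false := by
      rw [Bool.eq_false_iff]
      simpa [hD] using hr
    rw [h1, learnDMS_eq_none]
    · rfl
    · rintro ⟨r, h⟩
      exact hr fun t ht => (h t ht).trans (h _ hmem).symm

/-! ## The size of the input -/

theorem Data.size_ofNat (n : ℕ) : (Data.ofNat n).size = 2 * n + 1 := by
  induction n with
  | zero => rfl
  | succ n ih => simp only [Data.ofNat, Data.size, ih]; omega

theorem Data.size_ofList_le_mul {l : List Data} {b : ℕ} (h : ∀ a ∈ l, a.size ≤ b) :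
    (Data.ofList l).size ≤ 1 + l.length * (1 + b) := by
  induction l with
  | nil => simp [Data.ofList, Data.size]
  | cons a l ih =>
    have h1 := h a (by simp)
    have h2 := ih fun a ha => h a (by simp [ha])
    simp only [Data.ofList, Data.size, List.length_cons, Nat.add_one_mul]
    omega

/-- The cube comes from at most `N ^ 2` edges whose endpoints are written in unary. -/
theorem XTree.size_code_le {k : ℕ} (t : XTree (Fin k)) {N : ℕ} (hn : t.n ≤ N) (hk : k ≤ N) :
    t.code.size ≤ 10 * (N + 1) ^ 3 := by
  have h1 : ∀ {m : ℕ} (a : Fin m), m ≤ N → (Data.ofNat a).size ≤ 2 * N + 1 := by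
    intro m a hm
    rw [Data.size_ofNat]
    have := a.2
    omega
  have h2 := Data.size_ofList_le_mul (b := 4 * N + 3)
    (l := (List.finRange t.n).map fun m : Fin t.n => .cons (.ofNat m) (.ofNat (t.lab m))) (by
      simp only [List.mem_map, forall_exists_index, and_imp, forall_apply_eq_imp_iff₂, Data.size]
      intro m _
      have := h1 m hn
      have := h1 (t.lab m) hk
      omega)
  have h3 := Data.size_ofList_le_mul (b := 4 * N + 3)
    (l := ((List.finRange t.n ×ˢ List.finRange t.n).filter fun e => t.child e.1 e.2).map
      fun e : Fin t.n × Fin t.n => .cons (.ofNat e.1) (.ofNat e.2)) (by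
      simp only [List.mem_map, forall_exists_index, and_imp, forall_apply_eq_imp_iff₂, Data.size]
      intro e _
      have := h1 e.1 hn
      have := h1 e.2 hn
      omega)
  have h4 := h1 t.root hn
  have h5 : ((List.finRange t.n ×ˢ List.finRange t.n).filter
      fun e => t.child e.1 e.2).length ≤ N * N := by
    refine (List.length_filter_le _ _).trans ?_
    rw [List.length_product, List.length_finRange]
    exact Nat.mul_le_mul hn hn
  rw [List.length_map] at h3
  rw [List.length_map, List.length_finRange] at h2
  have h6 := Nat.mul_le_mul_right (1 + (4 * N + 3)) h5
  have h7 := Nat.mul_le_mul_right (1 + (4 * N + 3)) hn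
  have h8 := Nat.add_le_add h4 (Nat.add_le_add (h2.trans (Nat.add_le_add_left h7 1))
    (h3.trans (Nat.add_le_add_left h6 1)))
  simp only [XTree.code, Data.size]
  refine (show _ ≤ 2 + _ from ?_).trans ((Nat.add_le_add_left h8 2).trans ?_)
  · omega
  · nlinarith [Nat.zero_le N, Nat.zero_le (N ^ 2), Nat.zero_le (N ^ 3)]

theorem TreeList.size_code_le (x : TreeList) {N : ℕ} (hN : x.1 + (x.2.1.map XTree.n).sum ≤ N) :
    x.code.size ≤ 3 + 2 * N + N * (1 + 10 * (N + 1) ^ 3) := by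
  have h1 := Data.size_ofList_le_mul (b := 10 * (N + 1) ^ 3) (l := x.2.1.map XTree.code) (by
    simp only [List.mem_map, forall_exists_index, and_imp, forall_apply_eq_imp_iff₂]
    intro t ht
    have := List.single_le_sum (l := x.2.1.map XTree.n) (by simp) _ (List.mem_map_of_mem ht)
    exact t.size_code_le (by omega) (by omega))
  -- Every tree has a root, so there are no more trees than nodes.
  have h2 : x.2.1.length ≤ (x.2.1.map XTree.n).sum := by
    have := List.card_nsmul_le_sum (x.2.1.map XTree.n) 1 (by
      simp only [List.mem_map, forall_exists_index, and_imp, forall_apply_eq_imp_iff₂]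
      exact fun t _ => t.root.pos)
    simpa using this
  rw [List.length_map] at h1
  have h3 := Nat.mul_le_mul_right (1 + 10 * (N + 1) ^ 3) (show x.2.1.length ≤ N by omega)
  simp only [code, Data.size, Data.size_ofNat, listCode]
  omega

/-! # The theorem -/

theorem polynomialTime_learnDMS : PolynomialTime dmsSetting fun _ D => learnDMS D := by
  obtain ⟨P, q, h⟩ := exists_program
  refine ⟨P, q.comp (3 + 2 * .X + .X * (1 + 10 * (.X + 1) ^ 3)), fun k D l hD hl => ?_⟩
  obtain ⟨t, ht⟩ := hD
  obtain ⟨s, hs, hsq⟩ := h ⟨k, l, List.ne_nil_of_mem ((hl t).2 ht)⟩ D hl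
  refine ⟨s, hs, hsq.trans ?_⟩
  rw [Polynomial.eval_comp]
  apply eval_mono
  simpa [dmsSetting] using TreeList.size_code_le ⟨k, l, List.ne_nil_of_mem ((hl t).2 ht)⟩ le_rfl

theorem sound_learnDMS (k : ℕ) :
    Sound (K := (dmsSetting k).toLearningSetting) fun D => learnDMS D := by
  refine fun D hD => ⟨fun S h => consistent_learnDMS hD h, ?_⟩
  rintro h ⟨S, hS⟩
  cases h.symm.trans (learnDMS_eq_some hD fun t ht => (hS t ht).1)

theorem exists_isCharacteristicSample {k : ℕ} (S : DMS (Fin k)) :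
    ∃ CS : Finset (XTree (Fin k)),
      IsCharacteristicSample (K := (dmsSetting k).toLearningSetting) (fun D => learnDMS D) S CS ∧
        CS.card ≤ 1 + k * (k * (2 * k + 3)) := by
  by_cases hS : S.lang.Nonempty
  · obtain ⟨CS, h0, h1, h2, h3⟩ := exists_characteristic_sample S hS
    exact ⟨CS, ⟨h0, fun _ => h1, h3⟩, h2⟩
  -- If the language is empty, no sample is consistent with `S`, so any single tree is
  -- characteristic; a one-node tree is taken.
  · let t : XTree (Fin k) :=
      { n := 1
        root := 0
        lab := fun _ => S.root
        child := fun _ _ => false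
        acyclic := fun m h => by
          obtain ⟨_, h, -⟩ := Relation.TransGen.head'_iff.1 h
          cases h
        parent := fun m hm => absurd (Subsingleton.elim m 0) hm }
    refine ⟨{t}, ⟨Finset.singleton_nonempty t, fun h => absurd h hS, fun D hD h => ?_⟩, by simp⟩
    exact absurd ⟨t, h t (hD (Finset.mem_singleton_self t))⟩ hS

/-- Turns the bound in the alphabet size into a bound in the size of the schema. -/
theorem le_size {k : ℕ} (S : DMS (Fin k)) : k ≤ S.size := by
  have : k = ∑ _a : Fin k, 1 := by simp
  refine this.trans_le (le_trans ?_ (Nat.le_add_left _ _))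
  exact Finset.sum_le_sum fun a _ => Nat.le_add_right _ _

end UnorderedXML

theorem mainTheorem1 :
    ∃ learner : ∀ k : ℕ, UnorderedXML.Learner (UnorderedXML.dmsSetting k).toLearningSetting,
      UnorderedXML.LearnsInPolynomialTimeAndData UnorderedXML.dmsSetting learner ∧
      (∀ (k : ℕ) (D : Finset (UnorderedXML.XTree (Fin k))) (S : UnorderedXML.DMS (Fin k)),
        D.Nonempty → learner k D = some S →
          UnorderedXML.IsMinimalConsistent
            (K := (UnorderedXML.dmsSetting k).toLearningSetting) D S) ∧
      (∃ q : Polynomial ℕ, ∀ (k : ℕ) (S : UnorderedXML.DMS (Fin k)),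
        ∃ CS : Finset (UnorderedXML.XTree (Fin k)),
          UnorderedXML.IsCharacteristicSample (learner k) S CS ∧ CS.card ≤ q.eval k) := by
  let q : Polynomial ℕ := 1 + .X * (.X * (2 * .X + 3))
  have hq : ∀ k, q.eval k = 1 + k * (k * (2 * k + 3)) := fun k => by simp [q]
  refine ⟨fun k D => UnorderedXML.learnDMS D, ⟨UnorderedXML.polynomialTime_learnDMS,
    UnorderedXML.sound_learnDMS, q, fun k S => ?_⟩, fun k D S hD h => ?_, q, fun k S => ?_⟩
  · obtain ⟨CS, h1, h2⟩ := UnorderedXML.exists_isCharacteristicSample S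
    exact ⟨CS, h1, h2.trans ((hq k).symm.trans_le
      (UnorderedXML.eval_mono q (UnorderedXML.le_size S)))⟩
  · exact ⟨UnorderedXML.consistent_learnDMS hD h, fun S' hS' hlt =>
      hlt.2 (UnorderedXML.learnDMS_minimal hD h hS' hlt.1)⟩
  · obtain ⟨CS, h1, h2⟩ := UnorderedXML.exists_isCharacteristicSample S
    exact ⟨CS, h1, h2.trans_eq (hq k).symm⟩
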